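/- Let $M$ be a (nonempty) compact smooth manifold of dimension $n$ without boundary, with a smooth Riemannian metric, and let $|\cdot|$ denote the norms it induces on $TM$ and $T^*M$. Let $X_0$ be a $C^\infty$ Anosov vector field on $M$: $X_0$ has no zero, there is a splitting $TM=\mathbb{R}X_0\oplus E^u_0\oplus E^s_0$ invariant under the flow $\varphi^0_t$ of $X_0$, and for constants $C,\beta>0$ and all $t\ge 0$, $$\|d\varphi^0_{-t}|_{E^u_0}\|\le Ce^{-\beta t},\qquad \|d\varphi^0_{t}|_{E^s_0}\|\le Ce^{-\beta t}.$$ Fix a $C^1$ norm on vector fields, defined by finitely many charts and compact subsets of their domains covering $M$. For a $C^1$ vector field $X$ with flow $\varphi_t$ let $\Phi_t(x,\xi)=(\varphi_t(x),\xi\circ(d_x\varphi_t)^{-1})$ be the lifted Hamiltonian flow on $T^*M$ of $p(x,\xi)=\xi(X(x))$, let $X_*$ be its generator, and let $X^\perp=\{p=0\}$. Conical sets are sets invariant under multiplication of covectors by positive reals, and $S^*M=\partial T^*M$ is the set of directions of nonzero covectors. A closed conical $\Phi_t$-invariant set $L\subset T^*M$ is a sink with admissible neighbourhood $U$ and constants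 $C',\beta'>0$ if $U$ is an open conical set of nonzero covectors containing all nonzero elements of $L$, if $|\Phi_t(\xi)|\ge \frac1{C'}e^{\beta' t}|\xi|$ for all $\xi\in U$, $t>0$, and if $\Phi_t(U\cap S^*M)\to L\cap S^*M$ as $t\to+\infty$ (every open conical neighbourhood of $L\setminus 0$ contains $\Phi_t(U)$ for all large $t$). A source is a sink for $\Phi_{-t}$. Then there are open conical sets $U_u,U_s\subset T^*M\setminus 0$, a function ${\bf m}\in C^\infty(S^*M)$ (that is, a smooth $0$-homogeneous function on $T^*M\setminus0$) with ${\bf m}=1$ on $U_u$ and ${\bf m}=-1$ on $U_s$, numbers $\eta>0$, $T>0$, $C'>C/2$, $\beta'>\beta/2$, $\Lambda\ge\beta'$, and a function $R:\mathbb{C}\to\mathbb{R}$, such that every $C^1$ (in particular every $C^\infty$) vector field $X$ with $\|X-X_0\|_{C^1}<\eta$ satisfies: 1. $\Phi_t$ has a sink $E^*_u$ and a source $E^*_s$, with admissible neighbourhoods $U_u$ and $U_s$ respectively and with the constants $C',\beta'$. Both are contained in $X^\perp$, and, away from the zero section, $E^*_u\subset\{{\bf m}=1\}$ and $E^*_s\subset\{{\bf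 m}=-1\}$. 2. For all nonzero $\xi\in X^\perp$ and all $t>T$: if $\xi\notin U_s$ then $\Phi_t(\xi)\in U_u$, and if $\xi\notin U_u$ then $\Phi_{-t}(\xi)\in U_s$. 3. $X_*{\bf m}\ge0$ on $S^*M$. 4. $|\Phi_t(\xi)|\le e^{\Lambda|t|}|\xi|$ for all $t\in\mathbb{R}$ and $\xi\in T^*M$. Moreover the minimal strength is bounded uniformly: for every $\lambda\in[\beta',\Lambda]$ such that $|\Phi_t(\xi)|\le e^{\lambda|t|}|\xi|$ for all $t,\xi$, and for every $s\in\mathbb{C}$, $$r_X(s):=\frac1\lambda\,(2C')^{\lambda/\beta'}\Big(2\|\mathrm{div}X\|_{L^\infty}-4\,\mathrm{Re}\,s+\sup_{T^*M\setminus0}\frac{X_*|\xi|}{|\xi|}\Big)$$ satisfies $|r_X(s)|\le R(s)$. The same bound holds with $2/C'$ in place of $2C'$. -/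

import Mathlib

open Set Filter Topology Bundle
open scoped Manifold ContDiff ENNReal

noncomputable section

namespace AnosovWeight

/-- The model space of `n`-dimensional manifolds. -/
abbrev Model (n : ℕ) : Type := EuclideanSpace ℝ (Fin n)

section Manifold

variable (n : ℕ) (M : Type*) [TopologicalSpace M] [ChartedSpace (Model n) M]

/-- A vector field (no regularity imposed). -/
abbrev VField : Type _ := (x : M) → TangentSpace (𝓡 n) x

variable [IsManifold (𝓡 n) ∞ M]

/-- A smooth Riemannian metric on `M`. -/
abbrev Metric : Type _ :=
  ContMDiffRiemannianMetric (𝓡 n) ∞ (Model n) (fun x : M => TangentSpace (𝓡 n) x)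

/-- The cotangent bundle `T*M`, with its topology and smooth structure as a bundle of
continuous linear maps. A point is a pair `ξ = ⟨x, covector at x⟩`. -/
abbrev Cotangent : Type _ :=
  TotalSpace (Model n →L[ℝ] ℝ) (fun x : M => TangentSpace (𝓡 n) x →L[ℝ] Trivial M ℝ x)

/-- A finite family of preferred charts (given by their centers) with compact subsets `K c` of the
chart domains which cover `M`. It serves to define a `C¹` norm. -/
structure ChartCover where
  centers : Finset M
  K : M → Set M
  isCompact : ∀ c ∈ centers, IsCompact (K c)
  subset_source : ∀ c ∈ centers, K c ⊆ (chartAt (Model n) c).source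
  covers : ∀ x : M, ∃ c ∈ centers, x ∈ K c

end Manifold

variable {n : ℕ} {M : Type*} [TopologicalSpace M] [ChartedSpace (Model n) M]

/-- `X` is of class `C^k`. -/
def IsCk [IsManifold (𝓡 n) ∞ M] (k : WithTop ℕ∞) (X : VField n M) : Prop :=
  ContMDiff (𝓡 n) (𝓡 n).tangent k (fun x => (⟨x, X x⟩ : TangentBundle (𝓡 n) M))

/-- The time `t` map of the flow of `X`: `flow X t x` is the value at `t` of the integral curve of
`X` defined on the whole line and starting at `x`. For a `C¹` vector field on a compact Hausdorff
manifold this curve exists and is unique, so that the default value `x` is not used. -/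
def flow (X : VField n M) (t : ℝ) (x : M) : M :=
  open scoped Classical in
  if h : ∃ γ : ℝ → M, γ 0 = x ∧ IsMIntegralCurve γ X then h.choose t else x

/-- The differential `d_x φ_t` of the flow. -/
def dflow (X : VField n M) (t : ℝ) (x : M) :
    TangentSpace (𝓡 n) x →L[ℝ] TangentSpace (𝓡 n) (flow X t x) :=
  mfderiv (𝓡 n) (𝓡 n) (flow X t) x

variable [IsManifold (𝓡 n) ∞ M]

/-- Coordinates of the vector field `X` in the preferred chart centered at `c`. -/
def localRep (X : VField n M) (c : M) (z : Model n) : Model n :=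
  (trivializationAt (Model n) (TangentSpace (𝓡 n) : M → Type _) c
    ⟨(extChartAt (𝓡 n) c).symm z, X ((extChartAt (𝓡 n) c).symm z)⟩).2

/-- The `C¹` norm of a vector field with respect to a finite family of charts, as an extended
nonnegative number. -/
def C1Norm (𝒜 : ChartCover n M) (V : VField n M) : ℝ≥0∞ :=
  ⨆ c ∈ 𝒜.centers, ⨆ y ∈ 𝒜.K c,
    (‖localRep V c (extChartAt (𝓡 n) c y)‖ₑ
      + ‖fderiv ℝ (localRep V c) (extChartAt (𝓡 n) c y)‖ₑ)

/-- The Riemannian norm of a tangent vector. -/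
def vnorm (g : Metric n M) {x : M} (v : TangentSpace (𝓡 n) x) : ℝ := √(g.inner x v v)

/-- The dual norm of a covector. -/
def conorm (g : Metric n M) (ξ : Cotangent n M) : ℝ :=
  ⨆ v : {v : TangentSpace (𝓡 n) ξ.1 // vnorm g v ≤ 1}, |(ξ.2 v.1 : ℝ)|

/-- The density, in the preferred chart centered at `c`, of the Riemannian volume. -/
def volDensity (g : Metric n M) (c : M) (z : Model n) : ℝ :=
  √(Matrix.det (Matrix.of fun i j : Fin n =>
    g.inner ((extChartAt (𝓡 n) c).symm z)
      ((trivializationAt (Model n) (TangentSpace (𝓡 n) : M → Type _) c).symm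
        ((extChartAt (𝓡 n) c).symm z) (EuclideanSpace.single i 1))
      ((trivializationAt (Model n) (TangentSpace (𝓡 n) : M → Type _) c).symm
        ((extChartAt (𝓡 n) c).symm z) (EuclideanSpace.single j 1))))

/-- The Riemannian divergence `ρ⁻¹ ∑ i, ∂ᵢ (ρ Xⁱ)` at `x`, computed in the chart centered at `x`,
where `ρ` is the density of the Riemannian volume. -/
def divergence (g : Metric n M) (X : VField n M) (x : M) : ℝ :=
  (volDensity g x (extChartAt (𝓡 n) x x))⁻¹ *
    ∑ i : Fin n, fderiv ℝ (fun z => volDensity g x z * localRep X x z i)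
      (extChartAt (𝓡 n) x x) (EuclideanSpace.single i 1)

/-- `X` is an Anosov vector field with splitting `TM = ℝX ⊕ Eu ⊕ Es` and constants `C`, `β`. -/
structure IsAnosov (g : Metric n M) (X : VField n M)
    (Eu Es : (x : M) → Submodule ℝ (TangentSpace (𝓡 n) x)) (C β : ℝ) : Prop where
  C_pos : 0 < C
  beta_pos : 0 < β
  ne_zero : ∀ x, X x ≠ 0
  independent : ∀ x, iSupIndep ![Submodule.span ℝ {X x}, Eu x, Es x]
  spanning : ∀ x, Submodule.span ℝ {X x} ⊔ Eu x ⊔ Es x = ⊤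
  invariant_u : ∀ t x, ∀ v ∈ Eu x, dflow X t x v ∈ Eu (flow X t x)
  invariant_s : ∀ t x, ∀ v ∈ Es x, dflow X t x v ∈ Es (flow X t x)
  contract_u : ∀ t, 0 ≤ t → ∀ x, ∀ v ∈ Eu x,
    vnorm g (dflow X (-t) x v) ≤ C * Real.exp (-β * t) * vnorm g v
  contract_s : ∀ t, 0 ≤ t → ∀ x, ∀ v ∈ Es x,
    vnorm g (dflow X t x v) ≤ C * Real.exp (-β * t) * vnorm g v

/-- Multiplication by scalars in the fibers of `T*M`. -/
def scale (r : ℝ) (ξ : Cotangent n M) : Cotangent n M := ⟨ξ.1, r • ξ.2⟩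

/-- The lifted (Hamiltonian) flow `Φ_t (x, ξ) = (φ_t x, ξ ∘ (d_x φ_t)⁻¹)` on `T*M`. -/
def lift (X : VField n M) (t : ℝ) (ξ : Cotangent n M) : Cotangent n M :=
  ⟨flow X t ξ.1, ξ.2.comp (dflow X t ξ.1).inverse⟩

/-- The Hamiltonian `p (x, ξ) = ξ (X x)`. -/
def symbol (X : VField n M) (ξ : Cotangent n M) : ℝ := ξ.2 (X ξ.1)

/-- Open conical subsets of `T*M` without its zero section, i.e. open subsets of `S*M`. -/
structure IsOpenCone (U : Set (Cotangent n M)) : Prop where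
  isOpen : IsOpen U
  ne_zero : ∀ ξ ∈ U, ξ.2 ≠ 0
  scale_mem : ∀ r : ℝ, 0 < r → ∀ ξ ∈ U, scale r ξ ∈ U

/-- `U` is a conical neighbourhood of `L ∩ ∂T*M`, where `∂T*M = S*M` is the set of directions of
nonzero covectors. -/
def IsConicalNhd (L U : Set (Cotangent n M)) : Prop :=
  IsOpenCone U ∧ ∀ ξ ∈ L, ξ.2 ≠ 0 → ξ ∈ U

/-- `L` is a sink for the flow `Ψ` on `T*M`, with admissible conical neighbourhood `U` and
constants `C'`, `β'`. The last field says that `Ψ_t (U ∩ ∂T*M)` tends to `L ∩ ∂T*M`. -/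
structure IsSink (g : Metric n M) (Ψ : ℝ → Cotangent n M → Cotangent n M)
    (L U : Set (Cotangent n M)) (C' β' : ℝ) : Prop where
  C_pos : 0 < C'
  beta_pos : 0 < β'
  isClosed : IsClosed L
  scale_mem : ∀ r : ℝ, 0 < r → ∀ ξ ∈ L, scale r ξ ∈ L
  invariant : ∀ t, ∀ ξ ∈ L, Ψ t ξ ∈ L
  nhd : IsConicalNhd L U
  growth : ∀ ξ ∈ U, ∀ t, 0 < t → 1 / C' * Real.exp (β' * t) * conorm g ξ ≤ conorm g (Ψ t ξ)
  tendsto : ∀ W, IsConicalNhd L W → ∀ᶠ t in atTop, ∀ ξ ∈ U, Ψ t ξ ∈ W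

/-- A source for `Ψ_t` is a sink for `Ψ_{-t}`. -/
def IsSource (g : Metric n M) (Ψ : ℝ → Cotangent n M → Cotangent n M)
    (L U : Set (Cotangent n M)) (C' β' : ℝ) : Prop :=
  IsSink g (fun t => Ψ (-t)) L U C' β'

/-- `m` is a smooth function on `S*M`, i.e. a smooth function of the nonzero covectors which is
positively homogeneous of degree `0`. -/
def IsSmoothWeight (m : Cotangent n M → ℝ) : Prop :=
  ContMDiffOn ((𝓡 n).prod 𝓘(ℝ, Model n →L[ℝ] ℝ)) 𝓘(ℝ, ℝ) ∞ m {ξ | ξ.2 ≠ 0} ∧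
    ∀ ξ : Cotangent n M, ξ.2 ≠ 0 → ∀ r : ℝ, 0 < r → m (scale r ξ) = m ξ

/-- `|Φ_t ξ| ≤ e^{Λ|t|} |ξ|` on `T*M`. -/
def HasGrowthRate (g : Metric n M) (X : VField n M) (Λ : ℝ) : Prop :=
  ∀ t ξ, conorm g (lift X t ξ) ≤ Real.exp (Λ * |t|) * conorm g ξ

/-- `‖div X‖_{L^∞}`. -/
def supDiv (g : Metric n M) (X : VField n M) : EReal :=
  ⨆ x : M, ((|divergence g X x| : ℝ) : EReal)

/-- The logarithmic derivative `X_*|ξ| / |ξ|` of the norm along the lifted flow. -/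
def normRate (g : Metric n M) (X : VField n M) (ξ : Cotangent n M) : ℝ :=
  deriv (fun t => conorm g (lift X t ξ)) 0 / conorm g ξ

/-- `sup X_*|ξ| / |ξ|` over the nonzero covectors. -/
def supNormRate (g : Metric n M) (X : VField n M) : EReal :=
  ⨆ ξ : {ξ : Cotangent n M // ξ.2 ≠ 0}, (normRate g X ξ.1 : EReal)

/-- The strength
`Λ⁻¹ (2 / κ)^{Λ / β'} (2 ‖div X‖_{L^∞} - 4 Re s + sup X_*|ξ| / |ξ|)`
attached to a growth rate `Λ` of the lifted flow and to the exponent `β'` and a multiplicative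
constant `κ` of its sink and source. -/
def strength (g : Metric n M) (X : VField n M) (Λ κ β' : ℝ) (s : ℂ) : EReal :=
  ((Λ⁻¹ * (2 / κ) ^ (Λ / β') : ℝ) : EReal) *
    (2 * supDiv g X - ((4 * s.re : ℝ) : EReal) + supNormRate g X)

end AnosovWeight

end

/-! Fix a nonzero covector and let L(t) be the logarithm of its norm along the lifted flow of `X₀`.
The norm is comparable with the sum of three terms: the norm of the restriction to Es, which expands
in the future, the norm of the restriction to Eu, which expands in the past, and |p|, which is
conserved. Whichever term dominates dictates the behaviour of L. At each time, up to a uniform error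
e, L grows linearly in the future, or grows linearly in the past, or is almost minimal; the last
case forces |p| to be comparable with the norm (`IsAnosov.exists_trichotomy`).

The escape function G averages L(t) - L(-t) over finitely many times in a window (0, S]. Its
derivative along the lifted flow of `X₀` is, up to a Riemann sum error, (L(S) - 2 L(0) + L(-S)) / S.
The trichotomy makes this second difference at least 1 where c ≤ |G| ≤ c + 1, with c = 3 e + 1, and
also where |G| ≤ c + 1 and |p| is small (`one_le_of_oddMean_mem`, `one_le_of_growsFrom_zero`). The
weight is a monotone cutoff of G, constant for |G| ≤ c and for |G| ≥ c + 1, so it never decreases;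
on {p = 0} the strict increase of G bounds the transit time. One-sided averages of L over a longer
window S₂ are logarithmic norms with derivative at least (3/4) β where G ≥ c in the future, and
where G ≤ -c in the past.

Uniformity in X comes from the form of these functions. They are built from the flow of `X₀` alone,
as logarithms of sums of squares of symbols of finitely many smooth vector fields V. The derivative
of the symbol of V along the lifted flow of X is the symbol of [X, V], which involves X only through
its first jet. So every strict inequality survives a small C¹ perturbation (`abs_meanRate_sub_le`,
`IsAnosov.exists_isLyapunov`).

The sink is the set of orbits trapped in {G ≥ c + 1}. Compactness of the cosphere bundle gives
convergence to it, and the logarithmic norm gives exponential growth (`isSink_trapped`). The source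
is the sink of -X. The bound on the strength follows from uniform bounds for the derivative of the
metric along the flow, which control the divergence, the growth rate and the norm rate. -/

set_option linter.unusedSectionVars false

noncomputable section

namespace AnosovWeight

/-! ### Differentiable dependence of local flows on the initial point. -/

section LocalFlow

/-- The solution of an ordinary differential equation given by the Picard–Lindelöf theorem stays in
the ball where the vector field is controlled. -/
theorem exists_solution_mem_closedBall {E : Type*} [NormedAddCommGroup E] [NormedSpace ℝ E]
    [CompleteSpace E] {f : ℝ → E → E} {x₀ x : E} {a r L K : NNReal} {τ : ℝ} (hτ : 0 < τ)
    (hf : ∀ t ∈ Icc (-τ) τ, LipschitzOnWith K (f t) (Metric.closedBall x₀ a))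
    (hc : ∀ y ∈ Metric.closedBall x₀ a, ContinuousOn (f · y) (Icc (-τ) τ))
    (hb : ∀ t ∈ Icc (-τ) τ, ∀ y ∈ Metric.closedBall x₀ a, ‖f t y‖ ≤ L)
    (hL : L * τ ≤ a - r) (hx : x ∈ Metric.closedBall x₀ r) :
    ∃ α : ℝ → E, α 0 = x ∧ ∀ t ∈ Ioo (-τ) τ,
      HasDerivAt α (f t (α t)) t ∧ α t ∈ Metric.closedBall x₀ a := by
  have h : IsPicardLindelof f (tmin := -τ) (tmax := τ) ⟨0, by simp [hτ.le]⟩ x₀ a r L K :=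
    ⟨hf, hc, hb, by simpa using hL⟩
  obtain ⟨α, hα⟩ := ODE.FunSpace.exists_isFixedPt_next h hx
  refine ⟨α.compProj, ?_, fun t ht => ⟨?_, ?_⟩⟩
  · have := ODE.FunSpace.compProj_val (α := α) (t := ⟨0, by simp [hτ.le]⟩)
    rw [this, ← hα, ODE.FunSpace.next_apply₀]
  · have h1 := ODE.hasDerivWithinAt_picard_Icc (Subtype.mem (⟨0, by simp [hτ.le]⟩ : Icc (-τ) τ))
      h.continuousOn_uncurry
      α.continuous_compProj.continuousOn (fun _ ht' ↦ α.compProj_mem_closedBall h.mul_max_le)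
      x (Ioo_subset_Icc_self ht)
    refine (h1.congr_of_mem ?_ (Ioo_subset_Icc_self ht)).hasDerivAt (Icc_mem_nhds ht.1 ht.2)
    intro t' ht'
    nth_rw 1 [← hα]
    rw [ODE.FunSpace.compProj_of_mem ht', ODE.FunSpace.next_apply]
  · exact α.compProj_mem_closedBall h.mul_max_le

/-- Two-sided Grönwall inequality. -/
theorem exists_gronwall_const (K τ : ℝ) (hK : 0 ≤ K) : ∃ C : ℝ, 0 ≤ C ∧
    ∀ {F : Type*} [NormedAddCommGroup F] [NormedSpace ℝ F] (h h' : ℝ → F) (ε : ℝ), 0 ≤ ε →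
      (∀ t ∈ Ioo (-τ) τ, HasDerivAt h (h' t) t) →
      (∀ t ∈ Ioo (-τ) τ, ‖h' t‖ ≤ K * ‖h t‖ + ε) →
      ∀ t ∈ Ioo (-τ) τ, ‖h t‖ ≤ C * (‖h 0‖ + ε) := by
  refine ⟨gronwallBound 1 K 1 |τ|, ?_, ?_⟩
  · have := gronwallBound_mono (zero_le_one (α := ℝ)) (zero_le_one (α := ℝ)) hK (abs_nonneg τ)
    rw [gronwallBound_x0] at this
    linarith
  intro F _ _
  have key : ∀ (h h' : ℝ → F) (ε : ℝ), 0 ≤ ε →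
      (∀ t ∈ Ioo (-τ) τ, HasDerivAt h (h' t) t) →
      (∀ t ∈ Ioo (-τ) τ, ‖h' t‖ ≤ K * ‖h t‖ + ε) →
      ∀ t ∈ Ioo (-τ) τ, 0 ≤ t → ‖h t‖ ≤ gronwallBound 1 K 1 |τ| * (‖h 0‖ + ε) := by
    intro h h' ε hε hd hb t ht ht0
    have hsub : Icc 0 t ⊆ Ioo (-τ) τ := fun s hs =>
      ⟨by linarith [ht.1, ht.2, hs.1], lt_of_le_of_lt hs.2 ht.2⟩
    -- Enlarging both the initial value and the inhomogeneity to ‖h 0‖ + ε makes the bound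
    -- homogeneous, hence a constant depending only on K and τ times ‖h 0‖ + ε.
    have h1 := norm_le_gronwallBound_of_norm_deriv_right_le (f := h) (f' := h')
      (δ := ‖h 0‖ + ε) (K := K) (ε := ‖h 0‖ + ε) (a := 0) (b := t)
      (fun s hs => (hd s (hsub hs)).continuousAt.continuousWithinAt)
      (fun s hs => (hd s (hsub (Ico_subset_Icc_self hs))).hasDerivWithinAt) (by linarith)
      (fun s hs => by
        have := hb s (hsub (Ico_subset_Icc_self hs))
        have := norm_nonneg (h 0)
        linarith) t ⟨ht0, le_rfl⟩
    have hn : 0 ≤ ‖h 0‖ + ε := by positivity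
    have h2 : gronwallBound (‖h 0‖ + ε) K (‖h 0‖ + ε) (t - 0)
        = gronwallBound 1 K 1 t * (‖h 0‖ + ε) := by
      unfold gronwallBound
      split_ifs <;> simp <;> ring
    have h3 : gronwallBound 1 K 1 t ≤ gronwallBound 1 K 1 |τ| :=
      gronwallBound_mono zero_le_one zero_le_one hK (ht.2.le.trans (le_abs_self τ))
    rw [h2] at h1
    exact h1.trans (mul_le_mul_of_nonneg_right h3 hn)
  intro h h' ε hε hd hb t ht
  rcases le_total 0 t with h0 | h0
  · exact key h h' ε hε hd hb t ht h0
  · have hneg : ∀ s ∈ Ioo (-τ) τ, -s ∈ Ioo (-τ) τ := fun s hs => ⟨by linarith [hs.2], by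
      linarith [hs.1]⟩
    have := key (fun s => h (-s)) (fun s => -h' (-s)) ε hε
      (fun s hs => by
        simpa [Function.comp_def] using (hd (-s) (hneg s hs)).scomp s (hasDerivAt_neg s))
      (fun s hs => by simpa using hb (-s) (hneg s hs)) (-t) (hneg t ht) (by linarith)
    simpa using this

variable {E : Type*} [NormedAddCommGroup E] [NormedSpace ℝ E] [FiniteDimensional ℝ E]

/-- A local flow of a `C¹` vector field and its derivative with respect to the initial point. -/
theorem exists_local_flow_one {f : E → E} {x₀ : E} (hf : ContDiffAt ℝ 1 f x₀) {U : Set E}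
    (hU : U ∈ 𝓝 x₀) :
    ∃ (φ : E → ℝ → E) (A : E → ℝ → E →L[ℝ] E), ∃ r > 0, ∃ τ > 0, ∀ x ∈ Metric.ball x₀ r,
      φ x 0 = x ∧ A x 0 = ContinuousLinearMap.id ℝ E ∧ ∀ t ∈ Ioo (-τ) τ,
        φ x t ∈ U ∧ ‖A x t‖ ≤ ‖ContinuousLinearMap.id ℝ E‖ + 1 ∧
        HasDerivAt (φ x) (f (φ x t)) t ∧
        HasDerivAt (A x) ((fderiv ℝ f (φ x t)).comp (A x t)) t ∧
        HasFDerivAt (fun y => φ y t) (A x t) x ∧ ContinuousAt (fun y => A y t) x := by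
  have hev : ∀ᶠ y in 𝓝 x₀, ContDiffAt ℝ 1 f y := hf.eventually (by simp)
  obtain ⟨ρ, hρ, hρs⟩ := Metric.nhds_basis_closedBall.mem_iff.1 (inter_mem hev hU)
  have hC1 : ∀ y ∈ Metric.closedBall x₀ ρ, ContDiffAt ℝ 1 f y := fun y hy => (hρs hy).1
  have hcf : ContinuousOn (fderiv ℝ f) (Metric.closedBall x₀ ρ) := fun y hy =>
    ((hC1 y hy).fderiv_right (m := 0) (by simp)).continuousAt.continuousWithinAt
  have hcomp : IsCompact (Metric.closedBall x₀ ρ) := isCompact_closedBall _ _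
  obtain ⟨K, hK⟩ := hcomp.exists_bound_of_continuousOn hcf
  obtain ⟨B, hB⟩ := hcomp.exists_bound_of_continuousOn
    (fun y hy => ((hC1 y hy).continuousAt.continuousWithinAt : ContinuousWithinAt f _ y))
  have hx₀ : x₀ ∈ Metric.closedBall x₀ ρ := Metric.mem_closedBall_self hρ.le
  have hK0 : 0 ≤ K := (norm_nonneg _).trans (hK x₀ hx₀)
  have hB0 : 0 ≤ B := (norm_nonneg _).trans (hB x₀ hx₀)
  have hdiff : ∀ y ∈ Metric.closedBall x₀ ρ, DifferentiableAt ℝ f y := fun y hy =>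
    (hC1 y hy).differentiableAt (by simp)
  have hLip : ∀ y ∈ Metric.closedBall x₀ ρ, ∀ z ∈ Metric.closedBall x₀ ρ,
      ‖f z - f y‖ ≤ K * ‖z - y‖ := fun y hy z hz =>
    (convex_closedBall x₀ ρ).norm_image_sub_le_of_norm_fderiv_le hdiff hK hy hz
  set N : ℝ := ‖ContinuousLinearMap.id ℝ E‖ + 1 with hN
  have hN0 : 0 < N := by positivity
  -- the time of existence
  obtain ⟨τ, hτ, hτ1, hτ2⟩ : ∃ τ > 0, B * τ ≤ ρ / 2 ∧ K * N * τ ≤ 1 := by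
    refine ⟨min (ρ / 2 / (B + 1)) (1 / (K * N + 1)), by positivity, ?_, ?_⟩
    · calc B * min (ρ / 2 / (B + 1)) (1 / (K * N + 1)) ≤ (B + 1) * (ρ / 2 / (B + 1)) := by
            gcongr
            · linarith
            · exact min_le_left _ _
        _ = ρ / 2 := by field_simp
    · calc K * N * min (ρ / 2 / (B + 1)) (1 / (K * N + 1)) ≤
            (K * N + 1) * (1 / (K * N + 1)) := by
            gcongr
            · linarith
            · exact min_le_right _ _
        _ = 1 := by field_simp
  have hφ : ∀ x ∈ Metric.closedBall x₀ (ρ / 2), ∃ α : ℝ → E, α 0 = x ∧ ∀ t ∈ Ioo (-τ) τ,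
      HasDerivAt α (f (α t)) t ∧ α t ∈ Metric.closedBall x₀ ρ := by
    intro x hx
    exact exists_solution_mem_closedBall (f := fun _ => f) (a := ⟨ρ, hρ.le⟩)
      (r := ⟨ρ / 2, by positivity⟩) (L := ⟨B, hB0⟩) (K := ⟨K, hK0⟩) hτ
      (fun t _ => LipschitzOnWith.of_dist_le_mul fun y hy z hz => by
        rw [dist_eq_norm, dist_eq_norm]; exact hLip z hz y hy)
      (fun y _ => continuousOn_const) (fun t _ y hy => hB y hy)
      (by show B * τ ≤ ρ - ρ / 2; linarith) hx
  choose! φ hφ0 hφ1 using hφ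
  -- The variational equation is linear and starts at the identity; its solution stays in the unit
  -- ball around it because K N τ ≤ 1. Time is halved so that the closed interval lies inside the
  -- open one where φ x is differentiable.
  have hA : ∀ x ∈ Metric.closedBall x₀ (ρ / 2), ∃ α : ℝ → E →L[ℝ] E,
      α 0 = ContinuousLinearMap.id ℝ E ∧ ∀ t ∈ Ioo (-(τ / 2)) (τ / 2),
      HasDerivAt α ((fderiv ℝ f (φ x t)).comp (α t)) t ∧
        α t ∈ Metric.closedBall (ContinuousLinearMap.id ℝ E) 1 := by
    intro x hx
    have hsub : Icc (-(τ / 2)) (τ / 2) ⊆ Ioo (-τ) τ := fun t ht =>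
      ⟨by linarith [ht.1], by linarith [ht.2]⟩
    refine exists_solution_mem_closedBall (f := fun t (a : E →L[ℝ] E) => (fderiv ℝ f (φ x t)).comp a)
      (a := 1) (r := 0) (L := ⟨K * N, by positivity⟩) (K := ⟨K, hK0⟩) (by positivity)
      (fun t ht => LipschitzOnWith.of_dist_le_mul fun a _ b _ => ?_) (fun a _ => ?_)
      (fun t ht a ha => ?_) ?_ (by simp)
    · rw [dist_eq_norm, dist_eq_norm, ← ContinuousLinearMap.comp_sub]
      exact (ContinuousLinearMap.opNorm_comp_le _ _).trans
        (mul_le_mul_of_nonneg_right (hK _ (hφ1 x hx t (hsub ht)).2) (norm_nonneg _))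
    · have h1 : ContinuousOn (fun t => fderiv ℝ f (φ x t)) (Icc (-(τ / 2)) (τ / 2)) :=
        hcf.comp (fun t ht => (hφ1 x hx t (hsub ht)).1.continuousAt.continuousWithinAt)
          fun t ht => (hφ1 x hx t (hsub ht)).2
      exact h1.clm_comp continuousOn_const
    · refine (ContinuousLinearMap.opNorm_comp_le _ _).trans ?_
      show _ ≤ K * N
      refine mul_le_mul (hK _ (hφ1 x hx t (hsub ht)).2) ?_ (norm_nonneg _) hK0
      have : ‖a‖ ≤ ‖ContinuousLinearMap.id ℝ E‖ + ‖a - ContinuousLinearMap.id ℝ E‖ := by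
        have := norm_add_le (ContinuousLinearMap.id ℝ E) (a - ContinuousLinearMap.id ℝ E)
        simpa using this
      have h2 : ‖a - ContinuousLinearMap.id ℝ E‖ ≤ 1 := by
        simpa [dist_eq_norm] using ha
      linarith
    · show K * N * (τ / 2) ≤ (1 : ℝ) - 0
      have : 0 ≤ K * N * τ := by positivity
      linarith
  choose! A hA0 hA1 using hA
  have hball : Metric.ball x₀ (ρ / 2) ⊆ Metric.closedBall x₀ (ρ / 2) := Metric.ball_subset_closedBall
  have hsub : Ioo (-(τ / 2)) (τ / 2) ⊆ Ioo (-τ) τ := fun t ht =>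
      ⟨by linarith [ht.1], by linarith [ht.2]⟩
  have hAN : ∀ x ∈ Metric.closedBall x₀ (ρ / 2), ∀ t ∈ Ioo (-(τ / 2)) (τ / 2), ‖A x t‖ ≤ N := by
    intro x hx t ht
    have h2 : ‖A x t - ContinuousLinearMap.id ℝ E‖ ≤ 1 := by
      simpa [dist_eq_norm] using (hA1 x hx t ht).2
    have := norm_add_le (ContinuousLinearMap.id ℝ E) (A x t - ContinuousLinearMap.id ℝ E)
    rw [add_sub_cancel] at this
    linarith
  obtain ⟨G, hG0, hG⟩ := exists_gronwall_const K (τ / 2) hK0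
  -- Lipschitz dependence on the initial point
  have hφL : ∀ x ∈ Metric.closedBall x₀ (ρ / 2), ∀ y ∈ Metric.closedBall x₀ (ρ / 2),
      ∀ t ∈ Ioo (-(τ / 2)) (τ / 2), ‖φ y t - φ x t‖ ≤ G * ‖y - x‖ := by
    intro x hx y hy t ht
    have := hG (fun t => φ y t - φ x t) (fun t => f (φ y t) - f (φ x t)) 0 le_rfl
      (fun s hs => (hφ1 y hy s (hsub hs)).1.sub (hφ1 x hx s (hsub hs)).1)
      (fun s hs => by
        simpa using hLip _ (hφ1 x hx s (hsub hs)).2 _ (hφ1 y hy s (hsub hs)).2) t ht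
    simpa [hφ0 x hx, hφ0 y hy] using this
  have hunif := hcomp.uniformContinuousOn_of_continuous hcf
  rw [Metric.uniformContinuousOn_iff_le] at hunif
  -- Uniform continuity of the derivative of f, with the Lipschitz bound for φ, makes the
  -- linearisation error small uniformly in time.
  have hnear : ∀ ε > 0, ∃ δ > 0, ∀ x ∈ Metric.closedBall x₀ (ρ / 2),
      ∀ y ∈ Metric.closedBall x₀ (ρ / 2), ‖y - x‖ ≤ δ → ∀ t ∈ Ioo (-(τ / 2)) (τ / 2),
      ∀ z ∈ segment ℝ (φ x t) (φ y t), ‖fderiv ℝ f z - fderiv ℝ f (φ x t)‖ ≤ ε := by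
    intro ε hε
    obtain ⟨δ, hδ, hδ'⟩ := hunif ε hε
    refine ⟨δ / (G + 1), by positivity, fun x hx y hy hxy t ht z hz => ?_⟩
    have hzb : z ∈ Metric.closedBall x₀ ρ := (convex_closedBall x₀ ρ).segment_subset
      (hφ1 x hx t (hsub ht)).2 (hφ1 y hy t (hsub ht)).2 hz
    rw [← dist_eq_norm]
    refine hδ' _ hzb _ (hφ1 x hx t (hsub ht)).2 ?_
    have h1 : dist z (φ x t) ≤ ‖φ y t - φ x t‖ := by
      have := norm_sub_le_of_mem_segment hz
      rwa [dist_eq_norm]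
    refine h1.trans ((hφL x hx y hy t ht).trans ?_)
    calc G * ‖y - x‖ ≤ (G + 1) * (δ / (G + 1)) := by gcongr; linarith
      _ = δ := by field_simp
  refine ⟨φ, A, ρ / 2, by positivity, τ / 2, by positivity, fun x hx => ⟨hφ0 x (hball hx),
    hA0 x (hball hx), fun t ht => ⟨(hρs (hφ1 x (hball hx) t (hsub ht)).2).2, hAN x (hball hx) t ht,
      (hφ1 x (hball hx) t (hsub ht)).1, (hA1 x (hball hx) t ht).1, ?_, ?_⟩⟩⟩
  · rw [hasFDerivAt_iff_isLittleO, Asymptotics.isLittleO_iff]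
    intro c hc
    obtain ⟨δ, hδ, hδ'⟩ := hnear (c / (G * G + 1)) (by positivity)
    filter_upwards [Metric.isOpen_ball.mem_nhds hx, Metric.closedBall_mem_nhds x hδ] with y hy hyδ
    have hyδ' : ‖y - x‖ ≤ δ := by simpa [dist_eq_norm] using hyδ
    have hx' := hball hx
    have hy' := hball hy
    -- The first order error vanishes at time 0 and solves the variational equation up to a term
    -- that is o(‖y - x‖), so Grönwall keeps it o(‖y - x‖). The factor G * G + 1 absorbs the
    -- constants.
    have := hG (fun t => φ y t - φ x t - A x t (y - x))
      (fun t => f (φ y t) - f (φ x t) - ((fderiv ℝ f (φ x t)).comp (A x t)) (y - x))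
      (c / (G * G + 1) * (G * ‖y - x‖)) (by positivity)
      (fun s hs => ((hφ1 y hy' s (hsub hs)).1.sub (hφ1 x hx' s (hsub hs)).1).sub
        ((hA1 x hx' s hs).1.clm_apply (hasDerivAt_const s (y - x)) |>.congr_deriv (by simp)))
      (fun s hs => by
        have h1 : ‖f (φ y s) - f (φ x s) - fderiv ℝ f (φ x s) (φ y s - φ x s)‖ ≤
            c / (G * G + 1) * ‖φ y s - φ x s‖ :=
          (convex_segment (φ x s) (φ y s)).norm_image_sub_le_of_norm_fderiv_le'
            (fun z hz => hdiff z ((convex_closedBall x₀ ρ).segment_subset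
              (hφ1 x hx' s (hsub hs)).2 (hφ1 y hy' s (hsub hs)).2 hz))
            (fun z hz => hδ' x hx' y hy' hyδ' s hs z hz)
            (left_mem_segment _ _ _) (right_mem_segment _ _ _)
        have h2 : c / (G * G + 1) * ‖φ y s - φ x s‖ ≤ c / (G * G + 1) * (G * ‖y - x‖) := by
          gcongr
          exact hφL x hx' y hy' s hs
        have h3 : ‖fderiv ℝ f (φ x s) (φ y s - φ x s - A x s (y - x))‖ ≤
            K * ‖φ y s - φ x s - A x s (y - x)‖ :=
          (ContinuousLinearMap.le_opNorm _ _).trans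
            (mul_le_mul_of_nonneg_right (hK _ (hφ1 x hx' s (hsub hs)).2) (norm_nonneg _))
        have h4 : f (φ y s) - f (φ x s) - ((fderiv ℝ f (φ x s)).comp (A x s)) (y - x) =
            fderiv ℝ f (φ x s) (φ y s - φ x s - A x s (y - x)) +
            (f (φ y s) - f (φ x s) - fderiv ℝ f (φ x s) (φ y s - φ x s)) := by
          rw [map_sub (fderiv ℝ f (φ x s)) (φ y s - φ x s) (A x s (y - x))]
          simp only [ContinuousLinearMap.comp_apply]
          abel
        rw [h4]
        exact (norm_add_le _ _).trans (add_le_add h3 (h1.trans h2))) t ht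
    refine this.trans ?_
    have e0 : ‖φ y 0 - φ x 0 - A x 0 (y - x)‖ = 0 := by
      simp [hφ0 x hx', hφ0 y hy', hA0 x hx']
    rw [e0]
    calc G * (0 + c / (G * G + 1) * (G * ‖y - x‖))
        = (G * G) / (G * G + 1) * (c * ‖y - x‖) := by field_simp; ring
      _ ≤ 1 * (c * ‖y - x‖) := by
        gcongr
        rw [div_le_one (by positivity)]
        linarith
      _ = c * ‖y - x‖ := one_mul _
  · rw [Metric.continuousAt_iff']
    intro ε hε
    obtain ⟨δ, hδ, hδ'⟩ := hnear (ε / 2 / (G * N + 1)) (by positivity)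
    filter_upwards [Metric.isOpen_ball.mem_nhds hx, Metric.closedBall_mem_nhds x hδ] with y hy hyδ
    have hyδ' : ‖y - x‖ ≤ δ := by simpa [dist_eq_norm] using hyδ
    have hx' := hball hx
    have hy' := hball hy
    have := hG (fun t => A y t - A x t)
      (fun t => (fderiv ℝ f (φ y t)).comp (A y t) - (fderiv ℝ f (φ x t)).comp (A x t))
      (ε / 2 / (G * N + 1) * N) (by positivity)
      (fun s hs => (hA1 y hy' s hs).1.sub (hA1 x hx' s hs).1)
      (fun s hs => by
        have h4 : (fderiv ℝ f (φ y s)).comp (A y s) - (fderiv ℝ f (φ x s)).comp (A x s) =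
          (fderiv ℝ f (φ y s)).comp (A y s - A x s) +
            (fderiv ℝ f (φ y s) - fderiv ℝ f (φ x s)).comp (A x s) := by
          ext v; simp
        rw [h4]
        refine (norm_add_le _ _).trans (add_le_add ?_ ?_)
        · exact (ContinuousLinearMap.opNorm_comp_le _ _).trans
            (mul_le_mul_of_nonneg_right (hK _ (hφ1 y hy' s (hsub hs)).2) (norm_nonneg _))
        · refine (ContinuousLinearMap.opNorm_comp_le _ _).trans ?_
          gcongr
          · exact hδ' x hx' y hy' hyδ' s hs _ (right_mem_segment _ _ _)
          · exact hAN x hx' s hs) t ht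
    rw [dist_eq_norm]
    refine lt_of_le_of_lt this ?_
    have e0 : ‖A y 0 - A x 0‖ = 0 := by simp [hA0 x hx', hA0 y hy']
    rw [e0]
    calc G * (0 + ε / 2 / (G * N + 1) * N) = (G * N) / (G * N + 1) * (ε / 2) := by field_simp; ring
      _ ≤ 1 * (ε / 2) := by
        gcongr
        rw [div_le_one (by positivity)]
        linarith
      _ < ε := by linarith

/-- A `C^k` vector field has a local flow which is `C^k` in the initial point and whose derivative
solves the variational equation. -/
theorem exists_local_flow {E : Type*} [NormedAddCommGroup E] [NormedSpace ℝ E]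
    [FiniteDimensional ℝ E] (k : ℕ) {f : E → E} {x₀ : E} (hf : ContDiffAt ℝ (k + 1 : ℕ) f x₀)
    {U : Set E} (hU : U ∈ 𝓝 x₀) :
    ∃ φ : E → ℝ → E, ∃ r > 0, ∃ τ > 0, ∀ x ∈ Metric.ball x₀ r,
      φ x 0 = x ∧ ∀ t ∈ Ioo (-τ) τ,
        φ x t ∈ U ∧ HasDerivAt (φ x) (f (φ x t)) t ∧
        ContDiffAt ℝ (k + 1 : ℕ) (fun y => φ y t) x ∧
        HasDerivAt (fun s => fderiv ℝ (fun y => φ y s) x)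
          ((fderiv ℝ f (φ x t)).comp (fderiv ℝ (fun y => φ y t) x)) t := by
  induction k generalizing E with
  | zero =>
    obtain ⟨φ, A, r, hr, τ, hτ, h⟩ := exists_local_flow_one (by simpa using hf) hU
    refine ⟨φ, r, hr, τ, hτ, fun x hx => ⟨(h x hx).1, fun t ht => ?_⟩⟩
    obtain ⟨-, -, h2⟩ := h x hx
    refine ⟨(h2 t ht).1, (h2 t ht).2.2.1, ?_, ?_⟩
    · have hC : ContDiffOn ℝ ((0 : ℕ∞ω) + 1) (fun y => φ y t) (Metric.ball x₀ r) := by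
        rw [contDiffOn_succ_iff_hasFDerivWithinAt_of_uniqueDiffOn Metric.isOpen_ball.uniqueDiffOn]
        refine ⟨by simp, fun y => A y t, contDiffOn_zero.2 fun y hy =>
          ((h y hy).2.2 t ht).2.2.2.2.2.continuousWithinAt, fun y hy =>
          ((h y hy).2.2 t ht).2.2.2.2.1.hasFDerivWithinAt⟩
      simpa using (hC x hx).contDiffAt (Metric.isOpen_ball.mem_nhds hx)
    · have hA : ∀ s ∈ Ioo (-τ) τ, fderiv ℝ (fun y => φ y s) x = A x s := fun s hs =>
        (h2 s hs).2.2.2.2.1.fderiv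
      rw [hA t ht]
      exact (h2 t ht).2.2.2.1.congr_of_eventuallyEq
        (by filter_upwards [Ioo_mem_nhds ht.1 ht.2] with s hs using hA s hs)
  | succ k ih =>
    have hf1 : ContDiffAt ℝ 1 f x₀ := hf.of_le (by norm_cast; omega)
    have hfd : ContDiffAt ℝ (k + 1 : ℕ) (fderiv ℝ f) x₀ := hf.fderiv_right (by norm_cast)
    -- Induction through the tangent flow: this field on E × E has one derivative less than f, and
    -- the second component of its flow is the derivative of the flow of f applied to v. Regularity
    -- of that component gains one derivative for the flow of f.
    have hF : ContDiffAt ℝ (k + 1 : ℕ) (fun p : E × E => (f p.1, fderiv ℝ f p.1 p.2)) (x₀, 0) := by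
      refine ContDiffAt.prodMk ?_ ?_
      · exact ContDiffAt.comp (x₀, (0 : E)) (f := Prod.fst) (hf.of_le (by norm_cast; omega))
          contDiffAt_fst
      · exact ContDiffAt.clm_apply (ContDiffAt.comp (x₀, (0 : E)) (f := Prod.fst) hfd contDiffAt_fst)
          contDiffAt_snd
    obtain ⟨K, W, hW, hL⟩ := (hF.of_le (m := 1) (by norm_cast; omega)).exists_lipschitzOnWith
    obtain ⟨ρ, hρ, hρW⟩ := Metric.mem_nhds_iff.1 hW
    obtain ⟨Ψ, r₁, hr₁, τ₁, hτ₁, hΨ⟩ := ih hF (Metric.ball_mem_nhds _ hρ)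
    obtain ⟨φ, A, r₂, hr₂, τ₂, hτ₂, hφ⟩ :=
      exists_local_flow_one hf1 (inter_mem hU (Metric.ball_mem_nhds _ hρ))
    set N : ℝ := ‖ContinuousLinearMap.id ℝ E‖ + 1
    have hN : 0 < N := by positivity
    set τ := min τ₁ τ₂
    set r := min r₁ r₂
    have hτ1 : Ioo (-τ) τ ⊆ Ioo (-τ₁) τ₁ := Ioo_subset_Ioo (neg_le_neg (min_le_left _ _))
      (min_le_left _ _)
    have hτ2 : Ioo (-τ) τ ⊆ Ioo (-τ₂) τ₂ := Ioo_subset_Ioo (neg_le_neg (min_le_right _ _))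
      (min_le_right _ _)
    have hrb : Metric.ball x₀ r ⊆ Metric.ball x₀ r₂ := Metric.ball_subset_ball (min_le_right _ _)
    have hτ : 0 < τ := lt_min hτ₁ hτ₂
    -- the derivative of the flow is the second component of the flow on the tangent bundle
    have hkey : ∀ x ∈ Metric.ball x₀ r, ∀ v : E, ‖v‖ < min r₁ (ρ / N) → ∀ t ∈ Ioo (-τ) τ,
        (Ψ (x, v) t).2 = A x t v := by
      intro x hx v hv t ht
      have hxv : (x, v) ∈ Metric.ball (x₀, (0 : E)) r₁ := by
        rw [Metric.mem_ball, Prod.dist_eq, max_lt_iff]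
        exact ⟨lt_of_lt_of_le hx (min_le_left _ _), by simpa using lt_of_lt_of_le hv (min_le_left _ _)⟩
      obtain ⟨h0, h1⟩ := hΨ (x, v) hxv
      obtain ⟨g0, gA, g1⟩ := hφ x (hrb hx)
      have := ODE_solution_unique_of_mem_Ioo
        (v := fun _ => fun p : E × E => (f p.1, fderiv ℝ f p.1 p.2)) (s := fun _ => W) (K := K)
        (t₀ := 0) (f := Ψ (x, v)) (g := fun s => (φ x s, A x s v)) (a := -τ) (b := τ)
        (fun _ _ => hL) ⟨by linarith, hτ⟩
        (fun s hs => ⟨(h1 s (hτ1 hs)).2.1, hρW (h1 s (hτ1 hs)).1⟩)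
        (fun s hs => ⟨(g1 s (hτ2 hs)).2.2.1.prodMk
          (((g1 s (hτ2 hs)).2.2.2.1.clm_apply (hasDerivAt_const s v)).congr_deriv (by simp)),
          hρW ?_⟩) (by simp [h0, g0, gA]) ht
      · rw [this]
      · rw [Metric.mem_ball, Prod.dist_eq, max_lt_iff]
        refine ⟨(g1 s (hτ2 hs)).1.2, ?_⟩
        rw [dist_zero_right]
        calc ‖A x s v‖ ≤ ‖A x s‖ * ‖v‖ := ContinuousLinearMap.le_opNorm _ _
          _ ≤ N * ‖v‖ := by gcongr; exact (g1 s (hτ2 hs)).2.1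
          _ < N * (ρ / N) := by gcongr; exact lt_of_lt_of_le hv (min_le_right _ _)
          _ = ρ := by field_simp
    have hAC : ∀ t ∈ Ioo (-τ) τ, ContDiffOn ℝ (k + 1 : ℕ) (fun x => A x t) (Metric.ball x₀ r) := by
      intro t ht
      rw [contDiffOn_clm_apply]
      intro v
      -- The tangent flow is controlled only for small v; linearity of the derivative allows v to be
      -- rescaled.
      set c : ℝ := min r₁ (ρ / N) / (‖v‖ + 1) with hc
      have hmin : 0 < min r₁ (ρ / N) := lt_min hr₁ (by positivity)
      have hc0 : 0 < c := by positivity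
      have hcv : ‖c • v‖ < min r₁ (ρ / N) := by
        rw [norm_smul, Real.norm_of_nonneg hc0.le, hc, div_mul_eq_mul_div, div_lt_iff₀ (by positivity)]
        nlinarith
      have heq : ∀ x ∈ Metric.ball x₀ r, A x t v = c⁻¹ • (Ψ (x, c • v) t).2 := by
        intro x hx
        rw [hkey x hx _ hcv t ht, map_smul, smul_smul, inv_mul_cancel₀ hc0.ne', one_smul]
      refine ContDiffOn.congr (fun x hx => ?_) heq
      refine (ContDiffAt.const_smul _ ?_).contDiffWithinAt
      have hxv : (x, c • v) ∈ Metric.ball (x₀, (0 : E)) r₁ := by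
        rw [Metric.mem_ball, Prod.dist_eq, max_lt_iff]
        exact ⟨lt_of_lt_of_le hx (min_le_left _ _), by
          simpa using lt_of_lt_of_le hcv (min_le_left _ _)⟩
      exact contDiffAt_snd.comp x (ContDiffAt.comp x (f := fun x => (x, c • v))
        ((hΨ _ hxv).2 t (hτ1 ht)).2.2.1 (contDiffAt_id.prodMk contDiffAt_const))
    refine ⟨φ, r, lt_min hr₁ hr₂, τ, hτ, fun x hx => ⟨(hφ x (hrb hx)).1, fun t ht => ?_⟩⟩
    obtain ⟨-, -, h2⟩ := hφ x (hrb hx)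
    refine ⟨(h2 t (hτ2 ht)).1.1, (h2 t (hτ2 ht)).2.2.1, ?_, ?_⟩
    · have hC : ContDiffOn ℝ (((k + 1 : ℕ) : ℕ∞ω) + 1) (fun y => φ y t) (Metric.ball x₀ r) := by
        rw [contDiffOn_succ_iff_hasFDerivWithinAt_of_uniqueDiffOn Metric.isOpen_ball.uniqueDiffOn]
        exact ⟨by simp, fun y => A y t, hAC t ht, fun y hy =>
          ((hφ y (hrb hy)).2.2 t (hτ2 ht)).2.2.2.2.1.hasFDerivWithinAt⟩
      exact_mod_cast (hC x hx).contDiffAt (Metric.isOpen_ball.mem_nhds hx)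
    · have hA : ∀ s ∈ Ioo (-τ) τ, fderiv ℝ (fun y => φ y s) x = A x s := fun s hs =>
        (h2 s (hτ2 hs)).2.2.2.2.1.fderiv
      rw [hA t ht]
      exact (h2 t (hτ2 ht)).2.2.2.1.congr_of_eventuallyEq
        (by filter_upwards [Ioo_mem_nhds ht.1 ht.2] with s hs using hA s hs)

end LocalFlow

/-! ### Vector fields in preferred charts, and completeness of the flow. -/

section Coordinates

variable {n : ℕ} {M : Type*} [TopologicalSpace M] [ChartedSpace (Model n) M]
  [IsManifold (𝓡 n) ∞ M]

/-- Coordinates of tangent vectors in the preferred chart centered at `c`. -/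
def coord (c x : M) : TangentSpace (𝓡 n) x →L[ℝ] Model n :=
  (trivializationAt (Model n) (TangentSpace (𝓡 n) : M → Type _) c).continuousLinearMapAt ℝ x

/-- The tangent vector with given coordinates in the preferred chart centered at `c`. -/
def uncoord (c x : M) : Model n →L[ℝ] TangentSpace (𝓡 n) x :=
  (trivializationAt (Model n) (TangentSpace (𝓡 n) : M → Type _) c).symmL ℝ x

theorem mem_baseSet {c x : M} (hx : x ∈ (chartAt (Model n) c).source) :
    x ∈ (trivializationAt (Model n) (TangentSpace (𝓡 n) : M → Type _) c).baseSet := by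
  simpa using hx

theorem coord_uncoord {c x : M} (hx : x ∈ (chartAt (Model n) c).source) (w : Model n) :
    coord c x (uncoord c x w) = w :=
  Trivialization.continuousLinearMapAt_symmL _ (mem_baseSet hx) w

theorem uncoord_coord {c x : M} (hx : x ∈ (chartAt (Model n) c).source)
    (v : TangentSpace (𝓡 n) x) : uncoord c x (coord c x v) = v :=
  Trivialization.symmL_continuousLinearMapAt _ (mem_baseSet hx) v

theorem coord_eq_trivialization {c x : M} (hx : x ∈ (chartAt (Model n) c).source)
    (v : TangentSpace (𝓡 n) x) :
    (trivializationAt (Model n) (TangentSpace (𝓡 n) : M → Type _) c ⟨x, v⟩).2 = coord c x v := by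
  rw [coord, Trivialization.continuousLinearMapAt_apply,
    Trivialization.coe_linearMapAt_of_mem _ (mem_baseSet hx)]

theorem hasMFDerivAt_chart {c x : M} (hx : x ∈ (chartAt (Model n) c).source) :
    HasMFDerivAt (𝓡 n) 𝓘(ℝ, Model n) (extChartAt (𝓡 n) c) x (coord c x) := by
  rw [coord, TangentBundle.continuousLinearMapAt_trivializationAt hx]
  exact (mdifferentiableAt_extChartAt hx).hasMFDerivAt

theorem hasMFDerivAt_chart_symm {c x : M} (hx : x ∈ (chartAt (Model n) c).source) :
    HasMFDerivAt 𝓘(ℝ, Model n) (𝓡 n) (extChartAt (𝓡 n) c).symm (extChartAt (𝓡 n) c x)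
      (uncoord c x) := by
  have h1 : extChartAt (𝓡 n) c x ∈ (extChartAt (𝓡 n) c).target :=
    (extChartAt (𝓡 n) c).map_source (by simpa using hx)
  have := mdifferentiableWithinAt_extChartAt_symm h1
  have h2 := this.hasMFDerivWithinAt
  rw [← TangentBundle.symmL_trivializationAt hx] at h2
  rw [ModelWithCorners.range_eq_univ] at h2
  exact hasMFDerivWithinAt_univ.1 h2

theorem mem_target {c x : M} (hx : x ∈ (chartAt (Model n) c).source) :
    extChartAt (𝓡 n) c x ∈ (extChartAt (𝓡 n) c).target :=
  (extChartAt (𝓡 n) c).map_source (by simpa using hx)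

theorem symm_mem_source {c : M} {z : Model n} (hz : z ∈ (extChartAt (𝓡 n) c).target) :
    (extChartAt (𝓡 n) c).symm z ∈ (chartAt (Model n) c).source := by
  simpa using (extChartAt (𝓡 n) c).map_target hz

theorem symm_chart {c x : M} (hx : x ∈ (chartAt (Model n) c).source) :
    (extChartAt (𝓡 n) c).symm (extChartAt (𝓡 n) c x) = x :=
  (extChartAt (𝓡 n) c).left_inv (by simpa using hx)

theorem chart_symm {c : M} {z : Model n} (hz : z ∈ (extChartAt (𝓡 n) c).target) :
    extChartAt (𝓡 n) c ((extChartAt (𝓡 n) c).symm z) = z :=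
  (extChartAt (𝓡 n) c).right_inv hz

theorem localRep_chart (X : VField n M) {c x : M} (hx : x ∈ (chartAt (Model n) c).source) :
    localRep X c (extChartAt (𝓡 n) c x) = coord c x (X x) := by
  unfold localRep
  rw [symm_chart hx, coord_eq_trivialization hx]

theorem uncoord_localRep (X : VField n M) {c x : M} (hx : x ∈ (chartAt (Model n) c).source) :
    uncoord c x (localRep X c (extChartAt (𝓡 n) c x)) = X x := by
  rw [localRep_chart X hx, uncoord_coord hx]

theorem isCk_iff_at {X : VField n M} {k : ℕ∞ω} [IsManifold (𝓡 n) k M]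
    [ContMDiffVectorBundle k (Model n) (TangentSpace (𝓡 n) : M → Type _) (𝓡 n)]
     {c x : M} (hx : x ∈ (chartAt (Model n) c).source) :
    ContMDiffAt (𝓡 n) (𝓡 n).tangent k (fun x => (⟨x, X x⟩ : TangentBundle (𝓡 n) M)) x ↔
    ContDiffAt ℝ k (localRep X c) (extChartAt (𝓡 n) c x) := by
  rw [ModelWithCorners.tangent,
    Trivialization.contMDiffAt_section_iff
    (trivializationAt (Model n) (TangentSpace (𝓡 n) : M → Type _) c) (mem_baseSet hx)]
  constructor
  · intro h
    rw [← contMDiffAt_iff_contDiffAt]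
    have h2 : ContMDiffAt 𝓘(ℝ, Model n) (𝓡 n) k (extChartAt (𝓡 n) c).symm
        (extChartAt (𝓡 n) c x) :=
      (contMDiffOn_extChartAt_symm c).contMDiffAt ((isOpen_extChartAt_target c).mem_nhds
        (mem_target hx))
    have h3 := ContMDiffAt.comp (extChartAt (𝓡 n) c x) (by rwa [symm_chart hx]) h2
    exact h3
  · intro h
    rw [← contMDiffAt_iff_contDiffAt] at h
    have h3 := ContMDiffAt.comp x h (contMDiffAt_extChartAt' hx)
    refine h3.congr_of_eventuallyEq ?_
    filter_upwards [(chartAt (Model n) c).open_source.mem_nhds hx] with y hy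
    simp only [Function.comp_apply]
    rw [localRep_chart X hy, coord_eq_trivialization hy]

theorem IsCk.contDiffAt_localRep {X : VField n M} {k : ℕ} (hX : IsCk k X) {c x : M}
    (hx : x ∈ (chartAt (Model n) c).source) :
    ContDiffAt ℝ k (localRep X c) (extChartAt (𝓡 n) c x) := by
  have : IsManifold (𝓡 n) ((k : ℕ∞ω) + 1) M := IsManifold.of_le (n := ∞) (by norm_cast; simp)
  have : ContMDiffVectorBundle k (Model n) (TangentSpace (𝓡 n) : M → Type _) (𝓡 n) :=
    TangentBundle.contMDiffVectorBundle
  exact (isCk_iff_at hx).1 (hX x)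

theorem IsCk.of_le {X : VField n M} {k l : ℕ∞ω} (hX : IsCk l X) (h : k ≤ l) : IsCk k X :=
  ContMDiff.of_le hX h

theorem hasMFDerivAt_symm_comp (X : VField n M) {γ : ℝ → Model n} {t : ℝ} {c : M}
    (hγ : HasDerivAt γ (localRep X c (γ t)) t) (ht : γ t ∈ (extChartAt (𝓡 n) c).target) :
    HasMFDerivAt 𝓘(ℝ, ℝ) (𝓡 n) ((extChartAt (𝓡 n) c).symm ∘ γ) t
      ((1 : ℝ →L[ℝ] ℝ).smulRight (X ((extChartAt (𝓡 n) c).symm (γ t)))) := by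
  have h1 := hasMFDerivAt_chart_symm (symm_mem_source ht)
  rw [chart_symm ht] at h1
  refine (h1.comp t hγ.hasFDerivAt.hasMFDerivAt).congr_mfderiv ?_
  ext
  have := uncoord_localRep X (symm_mem_source ht)
  rw [chart_symm ht] at this
  change uncoord c _ ((1 : ℝ) • localRep X c (γ t)) = (1 : ℝ) • X _
  rw [one_smul, one_smul]
  exact this

/-- A flow box: the flow of a `C^k` vector field in a preferred chart. -/
theorem exists_flow_box {X : VField n M} {k : ℕ} (hX : IsCk (k + 1 : ℕ) X) {c x₀ : M}
    (hx₀ : x₀ ∈ (chartAt (Model n) c).source) :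
    ∃ φ : Model n → ℝ → Model n, ∃ W ∈ 𝓝 x₀, ∃ τ > 0, ∀ x ∈ W,
      x ∈ (chartAt (Model n) c).source ∧
      φ (extChartAt (𝓡 n) c x) 0 = extChartAt (𝓡 n) c x ∧ ∀ t ∈ Ioo (-τ) τ,
        φ (extChartAt (𝓡 n) c x) t ∈ (extChartAt (𝓡 n) c).target ∧
        HasDerivAt (φ (extChartAt (𝓡 n) c x)) (localRep X c (φ (extChartAt (𝓡 n) c x) t)) t ∧
        ContDiffAt ℝ (k + 1 : ℕ) (fun y => φ y t) (extChartAt (𝓡 n) c x) ∧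
        HasDerivAt (fun s => fderiv ℝ (fun y => φ y s) (extChartAt (𝓡 n) c x))
          ((fderiv ℝ (localRep X c) (φ (extChartAt (𝓡 n) c x) t)).comp
            (fderiv ℝ (fun y => φ y t) (extChartAt (𝓡 n) c x))) t := by
  obtain ⟨φ, r, hr, τ, hτ, h⟩ := exists_local_flow k (hX.contDiffAt_localRep hx₀)
    ((isOpen_extChartAt_target c).mem_nhds (mem_target hx₀))
  refine ⟨φ, (chartAt (Model n) c).source ∩ extChartAt (𝓡 n) c ⁻¹' Metric.ball
    (extChartAt (𝓡 n) c x₀) r, inter_mem ((chartAt (Model n) c).open_source.mem_nhds hx₀)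
    ((continuousAt_extChartAt' (by simpa using hx₀)).preimage_mem_nhds (Metric.ball_mem_nhds _ hr)),
    τ, hτ, fun x hx => ⟨hx.1, h _ hx.2⟩⟩

variable [CompactSpace M] [T2Space M]

/-- Compactness turns the local existence times of the flow boxes into one uniform time, and a
uniform time suffices to continue integral curves forever. -/
theorem exists_integralCurve {X : VField n M} (hX : IsCk 1 X) (x : M) :
    ∃ γ : ℝ → M, γ 0 = x ∧ IsMIntegralCurve γ X := by
  have hX' : IsCk (0 + 1 : ℕ) X := by simpa using hX
  have hloc : ∀ x₀ : M, ∃ W ∈ 𝓝 x₀, ∃ τ > 0, ∀ x ∈ W, ∃ γ : ℝ → M, γ 0 = x ∧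
      IsMIntegralCurveOn γ X (Ioo (-τ) τ) := by
    intro x₀
    obtain ⟨φ, W, hW, τ, hτ, h⟩ := exists_flow_box hX' (mem_chart_source (Model n) x₀)
    refine ⟨W, hW, τ, hτ, fun x hx => ⟨(extChartAt (𝓡 n) x₀).symm ∘ φ (extChartAt (𝓡 n) x₀ x),
      ?_, fun t ht => ?_⟩⟩
    · rw [Function.comp_apply, (h x hx).2.1, symm_chart (h x hx).1]
    · exact (hasMFDerivAt_symm_comp X ((h x hx).2.2 t ht).2.1 ((h x hx).2.2 t ht).1).hasMFDerivWithinAt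
  choose W hW τ hτ h using hloc
  obtain ⟨s, hs⟩ := isCompact_univ.elim_nhds_subcover W fun x _ => hW x
  obtain ⟨ε, hε, hεs⟩ : ∃ ε > 0, ∀ y ∈ s, ε ≤ τ y := by
    rcases s.eq_empty_or_nonempty with rfl | hne
    · exact ⟨1, one_pos, by simp⟩
    · obtain ⟨y, hy, hmin⟩ := s.exists_min_image τ hne
      exact ⟨τ y, hτ y, hmin⟩
  refine exists_isMIntegralCurve_of_isMIntegralCurveOn hX hε (fun y => ?_) x
  obtain ⟨z, hz, hyz⟩ := mem_iUnion₂.1 (hs.2 (mem_univ y))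
  obtain ⟨γ, h0, h1⟩ := h z y hyz
  exact ⟨γ, h0, h1.mono (Ioo_subset_Ioo (neg_le_neg (hεs z hz)) (hεs z hz))⟩

theorem flow_zero {X : VField n M} (hX : IsCk 1 X) (x : M) : flow X 0 x = x := by
  unfold flow
  rw [dif_pos (exists_integralCurve hX x)]
  exact (exists_integralCurve hX x).choose_spec.1

theorem isMIntegralCurve_flow {X : VField n M} (hX : IsCk 1 X) (x : M) :
    IsMIntegralCurve (fun t => flow X t x) X := by
  have : (fun t => flow X t x) = (exists_integralCurve hX x).choose := by
    funext t
    unfold flow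
    rw [dif_pos (exists_integralCurve hX x)]
  rw [this]
  exact (exists_integralCurve hX x).choose_spec.2

theorem flow_eq_of_isMIntegralCurve {X : VField n M} (hX : IsCk 1 X) {γ : ℝ → M}
    (hγ : IsMIntegralCurve γ X) (t : ℝ) : flow X t (γ 0) = γ t :=
  congrFun (isMIntegralCurve_Ioo_eq_of_contMDiff_boundaryless (t₀ := 0) hX
    (isMIntegralCurve_flow hX (γ 0)) hγ (flow_zero hX _)) t

theorem flow_add {X : VField n M} (hX : IsCk 1 X) (s t : ℝ) (x : M) :
    flow X (s + t) x = flow X s (flow X t x) := by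
  have h := (isMIntegralCurve_flow hX x).comp_add t
  have := flow_eq_of_isMIntegralCurve hX h s
  simp only [Function.comp_apply, zero_add] at this
  exact this.symm

theorem flow_neg_flow {X : VField n M} (hX : IsCk 1 X) (t : ℝ) (x : M) :
    flow X (-t) (flow X t x) = x := by
  rw [← flow_add hX, neg_add_cancel, flow_zero hX]

theorem flow_neg_field {X : VField n M} (hX : IsCk 1 X) (t : ℝ) (x : M) :
    flow (fun y => -X y) t x = flow X (-t) x := by
  have h := (isMIntegralCurve_flow hX x).comp_mul (-1)
  have hX' : IsCk 1 (fun y => -X y) := ContMDiff.neg_section hX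
  have h' : IsMIntegralCurve ((fun t => flow X t x) ∘ (· * (-1))) (fun y => -X y) := by
    simpa using! h
  have := flow_eq_of_isMIntegralCurve hX' h' t
  simpa [flow_zero hX] using this

/-- The flow box computes the flow. -/
theorem flow_eq_flow_box {X : VField n M} (hX : IsCk 1 X) {c x : M} {φ : ℝ → Model n} {τ : ℝ}
    (hx : x ∈ (chartAt (Model n) c).source) (h0 : φ 0 = extChartAt (𝓡 n) c x)
    (h : ∀ t ∈ Ioo (-τ) τ, φ t ∈ (extChartAt (𝓡 n) c).target ∧
      HasDerivAt φ (localRep X c (φ t)) t) :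
    ∀ t ∈ Ioo (-τ) τ, flow X t x = (extChartAt (𝓡 n) c).symm (φ t) := by
  intro t ht
  have hτ : 0 < τ := by linarith [ht.1, ht.2]
  exact isMIntegralCurveOn_Ioo_eqOn_of_contMDiff_boundaryless (t₀ := 0) (a := -τ) (b := τ)
    ⟨by linarith, hτ⟩ hX
    ((isMIntegralCurve_flow hX x).isMIntegralCurveOn _)
    (fun s hs => (hasMFDerivAt_symm_comp X (h s hs).2 (h s hs).1).hasMFDerivWithinAt)
    (by
      show flow X 0 x = (extChartAt (𝓡 n) c).symm (φ 0)
      rw [flow_zero hX, h0, symm_chart hx]) ht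

end Coordinates

/-! ### Regularity and group laws of the flow, of its differential and of its cotangent lift. -/

section FlowSmooth

variable {n : ℕ} {M : Type*} [TopologicalSpace M] [ChartedSpace (Model n) M]
  [IsManifold (𝓡 n) ∞ M] [CompactSpace M] [T2Space M]

theorem IsCk.one {X : VField n M} {k : ℕ} (hX : IsCk (k + 1 : ℕ) X) : IsCk 1 X :=
  hX.of_le (by norm_cast; omega)

theorem IsCk.nat {X : VField n M} (hX : IsCk ∞ X) (k : ℕ) : IsCk k X :=
  hX.of_le (by norm_cast; simp)

theorem contMDiffAt_flow_small {X : VField n M} {k : ℕ} (hX : IsCk (k + 1 : ℕ) X) :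
    ∃ τ > 0, ∀ t ∈ Ioo (-τ) τ, ∀ x, ContMDiffAt (𝓡 n) (𝓡 n) (k + 1 : ℕ) (flow X t) x := by
  have hloc : ∀ x₀ : M, ∃ W ∈ 𝓝 x₀, ∃ τ > 0, ∀ x ∈ W, ∀ t ∈ Ioo (-τ) τ,
      ContMDiffAt (𝓡 n) (𝓡 n) (k + 1 : ℕ) (flow X t) x := by
    intro x₀
    obtain ⟨φ, W, hW, τ, hτ, h⟩ := exists_flow_box hX (mem_chart_source (Model n) x₀)
    obtain ⟨W', hW', hoW, hxW⟩ := mem_nhds_iff.1 hW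
    refine ⟨W', hoW.mem_nhds hxW, τ, hτ, fun x hx t ht => ?_⟩
    obtain ⟨hxs, h0, h1⟩ := h x (hW' hx)
    have heq : flow X t =ᶠ[𝓝 x] fun y => (extChartAt (𝓡 n) x₀).symm
        (φ (extChartAt (𝓡 n) x₀ y) t) := by
      filter_upwards [hoW.mem_nhds hx] with y hy
      obtain ⟨hys, g0, g1⟩ := h y (hW' hy)
      exact flow_eq_flow_box hX.one hys g0 (fun s hs => ⟨(g1 s hs).1, (g1 s hs).2.1⟩) t ht
    refine ContMDiffAt.congr_of_eventuallyEq ?_ heq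
    have a1 : ContMDiffAt (𝓡 n) 𝓘(ℝ, Model n) (k + 1 : ℕ) (extChartAt (𝓡 n) x₀) x :=
      contMDiffAt_extChartAt' hxs
    have a2 : ContMDiffAt 𝓘(ℝ, Model n) 𝓘(ℝ, Model n) (k + 1 : ℕ) (fun y => φ y t)
        (extChartAt (𝓡 n) x₀ x) := (h1 t ht).2.2.1.contMDiffAt
    have a3 : ContMDiffAt 𝓘(ℝ, Model n) (𝓡 n) (k + 1 : ℕ) (extChartAt (𝓡 n) x₀).symm
        (φ (extChartAt (𝓡 n) x₀ x) t) :=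
      (contMDiffOn_extChartAt_symm x₀).contMDiffAt
        ((isOpen_extChartAt_target x₀).mem_nhds (h1 t ht).1)
    exact ContMDiffAt.comp x (g := (extChartAt (𝓡 n) x₀).symm) a3
      (ContMDiffAt.comp x (g := fun y => φ y t) a2 a1)
  choose W hW τ hτ h using hloc
  obtain ⟨s, hs⟩ := isCompact_univ.elim_nhds_subcover W fun x _ => hW x
  obtain ⟨ε, hε, hεs⟩ : ∃ ε > 0, ∀ y ∈ s, ε ≤ τ y := by
    rcases s.eq_empty_or_nonempty with rfl | hne
    · exact ⟨1, one_pos, by simp⟩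
    · obtain ⟨y, hy, hmin⟩ := s.exists_min_image τ hne
      exact ⟨τ y, hτ y, hmin⟩
  refine ⟨ε, hε, fun t ht y => ?_⟩
  obtain ⟨z, hz, hyz⟩ := mem_iUnion₂.1 (hs.2 (mem_univ y))
  exact h z y hyz t (Ioo_subset_Ioo (neg_le_neg (hεs z hz)) (hεs z hz) ht)

/-- The flow of a `C^k` vector field on a compact manifold is `C^k`. -/
theorem contMDiff_flow {X : VField n M} {k : ℕ} (hX : IsCk (k + 1 : ℕ) X) (t : ℝ) :
    ContMDiff (𝓡 n) (𝓡 n) (k + 1 : ℕ) (flow X t) := by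
  obtain ⟨τ, hτ, h⟩ := contMDiffAt_flow_small hX
  have hN : ∀ N : ℕ, ∀ s ∈ Ioo (-τ) τ, ContMDiff (𝓡 n) (𝓡 n) (k + 1 : ℕ) (flow X (N * s)) := by
    intro N s hs
    induction N with
    | zero =>
      have : flow X ((0 : ℕ) * s) = id := by
        funext x
        simp [flow_zero hX.one]
      rw [this]
      exact contMDiff_id
    | succ N ih =>
      have : flow X ((N + 1 : ℕ) * s) = flow X s ∘ flow X (N * s) := by
        funext x
        rw [Function.comp_apply, ← flow_add hX.one]
        congr 1
        push_cast
        ring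
      rw [this]
      exact ContMDiff.comp (fun x => h s hs x) ih
  -- The time t is cut into N equal pieces shorter than the uniform time for which regularity is
  -- known.
  obtain ⟨N, hN1⟩ := exists_nat_gt (|t| / τ)
  have hN0 : (0 : ℝ) < N := lt_of_le_of_lt (by positivity) hN1
  have : t = N * (t / N) := by field_simp
  rw [this]
  refine hN N _ (abs_lt.1 ?_)
  rw [abs_div, Nat.abs_cast, div_lt_iff₀ hN0]
  rwa [div_lt_iff₀ hτ, mul_comm] at hN1

theorem hasMFDerivAt_flow {X : VField n M} (hX : IsCk 1 X) (t : ℝ) (x : M) :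
    HasMFDerivAt (𝓡 n) (𝓡 n) (flow X t) x (dflow X t x) := by
  have hX' : IsCk (0 + 1 : ℕ) X := by simpa using hX
  exact ((contMDiff_flow hX' t).mdifferentiable (by simp) x).hasMFDerivAt

/-- The identity is read in `Model n` because the two sides live in tangent spaces at points that
are equal but not definitionally so. The same device is used for all the identities that compare
fibres along an orbit. -/
theorem dflow_add_apply {X : VField n M} (hX : IsCk 1 X) (s t : ℝ) (x : M) (v : Model n) :
    (dflow X (s + t) x v : Model n) = dflow X s (flow X t x) (dflow X t x v) := by
  have h := (hasMFDerivAt_flow hX s (flow X t x)).comp x (hasMFDerivAt_flow hX t x)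
  have h2 : flow X s ∘ flow X t = flow X (s + t) := by
    funext y
    exact (flow_add hX s t y).symm
  rw [h2] at h
  have h3 := hasMFDerivAt_unique (hasMFDerivAt_flow hX (s + t) x) h
  exact congrArg (fun L : Model n →L[ℝ] Model n => L v) h3

theorem dflow_zero_apply {X : VField n M} (hX : IsCk 1 X) (x : M) (v : Model n) :
    (dflow X 0 x v : Model n) = v := by
  have h2 : flow X 0 = id := by
    funext y
    exact flow_zero hX y
  have h := hasMFDerivAt_flow hX 0 x
  have h3 : HasMFDerivAt (𝓡 n) (𝓡 n) (flow X 0) x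
      (ContinuousLinearMap.id ℝ (Model n)) := by
    rw [h2]; exact hasMFDerivAt_id x
  exact congrArg (fun L : Model n →L[ℝ] Model n => L v) (hasMFDerivAt_unique h h3)

theorem dflow_neg_dflow {X : VField n M} (hX : IsCk 1 X) (t : ℝ) (x : M) (v : Model n) :
    (dflow X (-t) (flow X t x) (dflow X t x v) : Model n) = v := by
  rw [← dflow_add_apply hX, neg_add_cancel, dflow_zero_apply hX]

theorem dflow_congr (X : VField n M) {s t : ℝ} {x y : M} (h : s = t) (h' : x = y) (v : Model n) :
    (dflow X s x v : Model n) = dflow X t y v := by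
  subst h h'; rfl

theorem field_congr (X : VField n M) {x y : M} (h : x = y) : (X x : Model n) = X y := by
  subst h; rfl

theorem dflow_dflow_neg {X : VField n M} (hX : IsCk 1 X) (t : ℝ) (x : M) (v : Model n) :
    (dflow X t x (dflow X (-t) (flow X t x) v) : Model n) = v := by
  have h := dflow_neg_dflow hX (-t) (flow X t x) v
  exact (dflow_congr X (neg_neg t).symm (flow_neg_flow hX t x).symm _).trans h

theorem isInvertible_dflow {X : VField n M} (hX : IsCk 1 X) (t : ℝ) (x : M) :
    (dflow X t x).IsInvertible :=
  ContinuousLinearMap.IsInvertible.of_inverse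
    (g := (dflow X (-t) (flow X t x) : Model n →L[ℝ] Model n))
    (ContinuousLinearMap.ext fun v => dflow_dflow_neg hX t x v)
    (ContinuousLinearMap.ext fun v => dflow_neg_dflow hX t x v)

theorem dflow_inverse_apply {X : VField n M} (hX : IsCk 1 X) (t : ℝ) (x : M) (v : Model n) :
    ((dflow X t x).inverse v : Model n) = dflow X (-t) (flow X t x) v := by
  have := ContinuousLinearMap.inverse_eq (f := dflow X t x)
    (g := (dflow X (-t) (flow X t x) : Model n →L[ℝ] Model n))
    (ContinuousLinearMap.ext fun v => dflow_dflow_neg hX t x v)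
    (ContinuousLinearMap.ext fun v => dflow_neg_dflow hX t x v)
  exact congrArg (fun L : Model n →L[ℝ] Model n => L v) this

theorem cotangent_ext {ξ η : Cotangent n M} (h : ξ.1 = η.1)
    (h2 : ∀ v : Model n, (ξ.2 v : ℝ) = (η.2 v : ℝ)) : ξ = η := by
  obtain ⟨x, p⟩ := ξ
  obtain ⟨y, q⟩ := η
  obtain rfl : x = y := h
  congr 1
  exact ContinuousLinearMap.ext h2

theorem lift_apply {X : VField n M} (hX : IsCk 1 X) (t : ℝ) (ξ : Cotangent n M) (v : Model n) :
    ((lift X t ξ).2 v : ℝ) = ξ.2 (dflow X (-t) (flow X t ξ.1) v : Model n) := by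
  rw [← dflow_inverse_apply hX]
  rfl

theorem lift_zero {X : VField n M} (hX : IsCk 1 X) (ξ : Cotangent n M) : lift X 0 ξ = ξ := by
  refine cotangent_ext (flow_zero hX _) fun v => ?_
  rw [lift_apply hX, neg_zero, dflow_zero_apply hX]

theorem lift_add {X : VField n M} (hX : IsCk 1 X) (s t : ℝ) (ξ : Cotangent n M) :
    lift X (s + t) ξ = lift X s (lift X t ξ) := by
  refine cotangent_ext (flow_add hX s t ξ.1) fun v => ?_
  refine (lift_apply hX _ ξ v).trans (Eq.trans ?_ ((lift_apply hX s (lift X t ξ) v).trans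
    (lift_apply hX t ξ _)).symm)
  refine congrArg (fun w : Model n => (ξ.2 w : ℝ)) ?_
  have h1 := dflow_add_apply hX (-t) (-s) (flow X (s + t) ξ.1) v
  have h0 : -(s + t) = -t + -s := by ring
  refine (dflow_congr X h0 rfl v).trans (Eq.trans h1 ?_)
  have h2 : flow X (-s) (flow X (s + t) ξ.1) = flow X t ξ.1 := by
    rw [flow_add hX, flow_neg_flow hX]
  exact (dflow_congr X rfl h2 _).trans
    (congrArg (fun w : Model n => (dflow X (-t) (flow X t ξ.1) w : Model n))
      (dflow_congr X rfl (flow_add hX s t ξ.1) v))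

/-- A source for X is a sink for -X; this identity lets every statement on sources be deduced from
the one on sinks. -/
theorem lift_neg_field {X : VField n M} (hX : IsCk 1 X) (t : ℝ) (ξ : Cotangent n M) :
    lift (fun y => -X y) t ξ = lift X (-t) ξ := by
  have h : flow (fun y => -X y) = fun t => flow X (-t) := by
    funext s y
    exact flow_neg_field hX s y
  unfold lift dflow
  rw [h]

theorem lift_ne_zero {X : VField n M} (hX : IsCk 1 X) (t : ℝ) {ξ : Cotangent n M}
    (hξ : ξ.2 ≠ 0) : (lift X t ξ).2 ≠ 0 := by
  intro h
  apply hξ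
  have h1 : lift X (-t) (lift X t ξ) = ξ := by
    rw [← lift_add hX, neg_add_cancel, lift_zero hX]
  refine ContinuousLinearMap.ext fun v : Model n => ?_
  have h2 : ξ.2 v = (lift X (-t) (lift X t ξ)).2 v := by rw [h1]
  rw [h2, lift_apply hX, h]
  rfl

theorem lift_scale (X : VField n M) (t r : ℝ) (ξ : Cotangent n M) :
    lift X t (scale r ξ) = scale r (lift X t ξ) := rfl

/-- The pull-back of a vector field by the flow. -/
def pullField (X : VField n M) (t : ℝ) (V : VField n M) : VField n M :=
  fun x => (dflow X t x).inverse (V (flow X t x))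

/-- The symbol of V at Φ_t ξ is the symbol of the pulled back field at ξ, so composition with the
lifted flow stays within symbols of vector fields. One derivative of X is lost, which costs nothing
when X is smooth. -/
theorem IsCk.pullField {X V : VField n M} {k : ℕ} (hX : IsCk (k + 1 : ℕ) X) (hV : IsCk k V)
    (t : ℝ) : IsCk k (pullField X t V) := by
  have : IsManifold (𝓡 n) (((k + 1 : ℕ) : ℕ∞ω) + 1) M := IsManifold.of_le (n := ∞) (by norm_cast; simp)
  have : IsManifold (𝓡 n) (((k : ℕ) : ℕ∞ω) + 1) M := IsManifold.of_le (n := ∞) (by norm_cast; simp)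
  exact ContMDiff.mpullback_vectorField hV (contMDiff_flow hX t)
    (fun x => isInvertible_dflow hX.one t x) (by norm_cast)

theorem isCk_infty_iff {X : VField n M} : IsCk ∞ X ↔ ∀ k : ℕ, IsCk k X :=
  contMDiff_infty

theorem IsCk.pullField_infty {X V : VField n M} (hX : IsCk ∞ X) (hV : IsCk ∞ V)
    (t : ℝ) : IsCk ∞ (AnosovWeight.pullField X t V) :=
  isCk_infty_iff.2 fun k => (hX.nat (k + 1)).pullField (hV.nat k) t

/-- The flow preserves its generator. -/
theorem dflow_neg_field {X : VField n M} (hX : IsCk 1 X) (t : ℝ) (x : M) :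
    (dflow X (-t) (flow X t x) (X (flow X t x)) : Model n) = X x := by
  have h1 := (isMIntegralCurve_flow hX (flow X t x)) 0
  have h2 := (hasMFDerivAt_flow hX (-t) (flow X t x))
  have h2' : HasMFDerivAt (𝓡 n) (𝓡 n) (flow X (-t)) (flow X 0 (flow X t x))
      (dflow X (-t) (flow X t x)) := by
    rw [flow_zero hX]; exact h2
  have h3 := h2'.comp (0 : ℝ) h1
  have h4 : flow X (-t) ∘ (fun s => flow X s (flow X t x)) = fun s => flow X s x := by
    funext s
    simp only [Function.comp_apply]
    rw [← flow_add hX, ← flow_add hX]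
    congr 1
    ring
  rw [h4] at h3
  have h5 := (isMIntegralCurve_flow hX x) 0
  have h6 := hasMFDerivAt_unique h3 h5
  have h7 := congrArg (fun L : ℝ →L[ℝ] Model n => L 1) h6
  have e1 : (dflow X (-t) (flow X t x) ((1 : ℝ) • (X (flow X 0 (flow X t x)) : Model n))
    : Model n) = (1 : ℝ) • (X (flow X 0 x) : Model n) := h7
  rw [one_smul, one_smul] at e1
  refine Eq.trans ?_ (e1.trans (field_congr X (flow_zero hX _)))
  exact congrArg (fun w : Model n => (dflow X (-t) (flow X t x) w : Model n))
    (field_congr X (flow_zero hX _).symm)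

theorem dflow_field {X : VField n M} (hX : IsCk 1 X) (t : ℝ) (x : M) :
    (dflow X t x (X x) : Model n) = X (flow X t x) :=
  (congrArg (fun w : Model n => (dflow X t x w : Model n)) (dflow_neg_field hX t x).symm).trans
    (dflow_dflow_neg hX t x _)

/-- The symbol of the generator is conserved by the lifted flow. -/
theorem symbol_self_lift {X : VField n M} (hX : IsCk 1 X) (t : ℝ) (ξ : Cotangent n M) :
    symbol X (lift X t ξ) = symbol X ξ :=
  (lift_apply hX t ξ _).trans
    (congrArg (fun w : Model n => (ξ.2 w : ℝ)) (dflow_neg_field hX t ξ.1))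

end FlowSmooth

/-! ### The Lie bracket as the derivative of symbols along the lifted flow. -/

section Bracket

variable {n : ℕ} {M : Type*} [TopologicalSpace M] [ChartedSpace (Model n) M]
  [IsManifold (𝓡 n) ∞ M]

theorem coord_congr (c : M) {x y : M} (h : x = y) (v : Model n) :
    coord c x v = coord c y v := by
  subst h; rfl

/-- The Lie bracket of two vector fields of a normed space. -/
def lieCoord (X V : Model n → Model n) (z : Model n) : Model n :=
  fderiv ℝ V z (X z) - fderiv ℝ X z (V z)

/-- The Lie bracket, at a point, computed in the preferred chart at this point. -/
def bracket (X V : VField n M) : VField n M := fun x =>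
  uncoord x x (lieCoord (localRep X x) (localRep V x) (extChartAt (𝓡 n) x x))

variable [CompactSpace M] [T2Space M]

/-- The flow and its differential in a preferred chart, for small times. -/
theorem exists_dflow_chart {X : VField n M} (hX : IsCk 1 X) {c x : M}
    (hx : x ∈ (chartAt (Model n) c).source) :
    ∃ φ : ℝ → Model n, ∃ A : ℝ → Model n →L[ℝ] Model n,
      φ 0 = extChartAt (𝓡 n) c x ∧ A 0 = ContinuousLinearMap.id ℝ _ ∧
      HasDerivAt φ (localRep X c (extChartAt (𝓡 n) c x)) 0 ∧
      HasDerivAt A (fderiv ℝ (localRep X c) (extChartAt (𝓡 n) c x)) 0 ∧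
      ∀ᶠ t in 𝓝 (0 : ℝ), flow X t x ∈ (chartAt (Model n) c).source ∧
        extChartAt (𝓡 n) c (flow X t x) = φ t ∧
        ∀ v, coord c (flow X t x) (dflow X t x v) = A t (coord c x v) := by
  have hX' : IsCk (0 + 1 : ℕ) X := by simpa using hX
  obtain ⟨φ, W, hW, τ, hτ, h⟩ := exists_flow_box hX' hx
  set z := extChartAt (𝓡 n) c x with hz
  obtain ⟨-, h0, h1⟩ := h x (mem_of_mem_nhds hW)
  have hI : (0 : ℝ) ∈ Ioo (-τ) τ := ⟨by linarith, hτ⟩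
  have hfl : ∀ y ∈ W, ∀ t ∈ Ioo (-τ) τ, flow X t y =
      (extChartAt (𝓡 n) c).symm (φ (extChartAt (𝓡 n) c y) t) := fun y hy t ht =>
    flow_eq_flow_box hX (h y hy).1 (h y hy).2.1
      (fun s hs => ⟨((h y hy).2.2 s hs).1, ((h y hy).2.2 s hs).2.1⟩) t ht
  have hmem : ∀ t ∈ Ioo (-τ) τ, flow X t x ∈ (chartAt (Model n) c).source := by
    intro t ht
    rw [hfl x (mem_of_mem_nhds hW) t ht]
    exact symm_mem_source (h1 t ht).1
  have hch : ∀ y ∈ W, ∀ t ∈ Ioo (-τ) τ, extChartAt (𝓡 n) c (flow X t y) =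
      φ (extChartAt (𝓡 n) c y) t := by
    intro y hy t ht
    rw [hfl y hy t ht, chart_symm ((h y hy).2.2 t ht).1]
  have hd : ∀ t ∈ Ioo (-τ) τ, ∀ v, coord c (flow X t x) (dflow X t x v) =
      fderiv ℝ (fun y => φ y t) z (coord c x v) := by
    intro t ht v
    have a1 := (hasMFDerivAt_chart (hmem t ht)).comp x (hasMFDerivAt_flow hX t x)
    have a2 : HasMFDerivAt 𝓘(ℝ, Model n) 𝓘(ℝ, Model n) (fun y => φ y t) z
        (fderiv ℝ (fun y => φ y t) z) :=
      ((h1 t ht).2.2.1.differentiableAt (by simp)).hasFDerivAt.hasMFDerivAt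
    have a3 := a2.comp x (hasMFDerivAt_chart hx)
    have a4 : extChartAt (𝓡 n) c ∘ flow X t =ᶠ[𝓝 x]
        (fun y => φ y t) ∘ extChartAt (𝓡 n) c := by
      filter_upwards [hW] with y hy
      exact hch y hy t ht
    have a5 := hasMFDerivAt_unique a1 (a3.congr_of_eventuallyEq a4)
    exact congrArg (fun L : Model n →L[ℝ] Model n => L v) a5
  have hA0 : fderiv ℝ (fun y => φ y 0) z = ContinuousLinearMap.id ℝ _ := by
    refine ContinuousLinearMap.ext fun w => ?_
    have e := hd 0 hI (uncoord c x w)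
    rw [coord_uncoord hx] at e
    rw [← e]
    refine (coord_congr c (flow_zero hX x) _).trans ?_
    refine (congrArg (fun u : Model n => coord c x u) (dflow_zero_apply hX x _)).trans ?_
    exact coord_uncoord hx w
  refine ⟨φ z, fun t => fderiv ℝ (fun y => φ y t) z, h0, hA0, ?_, ?_, ?_⟩
  · have := (h1 0 hI).2.1
    rwa [h0] at this
  · have := (h1 0 hI).2.2.2
    rw [hA0, h0] at this
    exact this
  · filter_upwards [Ioo_mem_nhds hI.1 hI.2] with t ht
    exact ⟨hmem t ht, hch x (mem_of_mem_nhds hW) t ht, hd t ht⟩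

/-- The derivative of the pull-back of a vector field by the flow is the Lie bracket. -/
theorem hasDerivAt_symbol_lift_chart {X V : VField n M} (hX : IsCk 1 X) (hV : IsCk 1 V)
    {c : M} {ξ : Cotangent n M} (hx : ξ.1 ∈ (chartAt (Model n) c).source) :
    HasDerivAt (fun t => symbol V (lift X t ξ))
      (ξ.2 (uncoord c ξ.1 (lieCoord (localRep X c) (localRep V c) (extChartAt (𝓡 n) c ξ.1))) : ℝ)
      0 := by
  obtain ⟨φ, A, hφ0, hA0, hφ, hA, hev⟩ := exists_dflow_chart hX hx
  set z := extChartAt (𝓡 n) c ξ.1 with hz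
  have hVd : HasFDerivAt (localRep V c) (fderiv ℝ (localRep V c) z) (φ 0) := by
    rw [hφ0]
    exact ((IsCk.contDiffAt_localRep (k := 1) (by simpa using hV) hx).differentiableAt
      (by simp)).hasFDerivAt
  have h1 : HasDerivAt (fun t => localRep V c (φ t)) (fderiv ℝ (localRep V c) z
    (localRep X c z)) 0 := hVd.comp_hasDerivAt 0 hφ
  have hu : IsUnit (A 0) := by rw [hA0]; exact isUnit_one
  -- In the chart the pull-back is A(t)⁻¹ V(φ(t)); inversion has derivative H ↦ -H at the identity,
  -- which produces the term -DX V of the bracket.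
  have h2 : HasDerivAt (fun t => Ring.inverse (A t)) (-fderiv ℝ (localRep X c) z) 0 := by
    obtain ⟨u, hu⟩ := hu
    have hi := hasFDerivAt_ringInverse (𝕜 := ℝ) u
    have hu1 : u = 1 := Units.ext (by rw [hu, hA0]; rfl)
    rw [hu] at hi
    refine (hi.comp_hasDerivAt 0 hA).congr_deriv ?_
    subst hu1
    rw [inv_one, Units.val_one, neg_apply,
      ContinuousLinearMap.mulLeftRight_apply, one_mul, mul_one]
  have h3 := h2.clm_apply h1
  have h4 : HasDerivAt (fun t => Ring.inverse (A t) (localRep V c (φ t)))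
      (lieCoord (localRep X c) (localRep V c) z) 0 := by
    refine h3.congr_deriv ?_
    have : Ring.inverse (A 0) = 1 := by rw [hA0]; exact Ring.inverse_one _
    rw [this, hφ0, lieCoord]
    simp
    abel
  let ℓ : Model n →L[ℝ] ℝ := (ξ.2 : Model n →L[ℝ] ℝ).comp (uncoord c ξ.1 : Model n →L[ℝ] Model n)
  have h5 := ℓ.hasFDerivAt.comp_hasDerivAt (0 : ℝ) h4
  refine h5.congr_of_eventuallyEq ?_
  have hunit : ∀ᶠ t in 𝓝 (0 : ℝ), IsUnit (A t) :=
    hA.continuousAt.eventually (Units.isOpen.mem_nhds hu)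
  filter_upwards [hev, hunit] with t ht hut
  obtain ⟨ht1, ht2, ht3⟩ := ht
  show (ξ.2 (pullField X t V ξ.1) : ℝ) = (ξ.2 : Model n →L[ℝ] ℝ) (uncoord c ξ.1 (Ring.inverse (A t) (localRep V c (φ t))))
  have e1 : dflow X t ξ.1 (pullField X t V ξ.1) = V (flow X t ξ.1) :=
    (isInvertible_dflow hX t ξ.1).self_apply_inverse _
  have e2 := ht3 (pullField X t V ξ.1)
  rw [e1, ← localRep_chart V ht1, ht2] at e2
  rw [e2]
  have e3 : Ring.inverse (A t) (A t (coord c ξ.1 (pullField X t V ξ.1))) =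
      coord c ξ.1 (pullField X t V ξ.1) := by
    rw [← mul_apply_eq_comp, Ring.inverse_mul_cancel _ hut]
    rfl
  rw [e3, uncoord_coord hx]

theorem hasDerivAt_symbol_lift {X V : VField n M} (hX : IsCk 1 X) (hV : IsCk 1 V)
    (ξ : Cotangent n M) :
    HasDerivAt (fun t => symbol V (lift X t ξ)) (symbol (bracket X V) ξ) 0 :=
  hasDerivAt_symbol_lift_chart hX hV (mem_chart_source (Model n) ξ.1)

/-- The bracket may be computed in any preferred chart. -/
theorem coord_bracket {X V : VField n M} (hX : IsCk 1 X) (hV : IsCk 1 V) {c x : M}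
    (hx : x ∈ (chartAt (Model n) c).source) :
    coord c x (bracket X V x) =
      lieCoord (localRep X c) (localRep V c) (extChartAt (𝓡 n) c x) := by
  -- Both brackets are the derivative at 0 of the same function of t, for every covector p at x, and
  -- covectors separate tangent vectors.
  have key : ∀ p : Model n →L[ℝ] ℝ, p (bracket X V x) =
      p (uncoord c x (lieCoord (localRep X c) (localRep V c) (extChartAt (𝓡 n) c x))) := by
    intro p
    let ξ : Cotangent n M := ⟨x, p⟩
    exact (hasDerivAt_symbol_lift hX hV ξ).unique
      (hasDerivAt_symbol_lift_chart hX hV (ξ := ξ) hx)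
  have : bracket X V x =
      uncoord c x (lieCoord (localRep X c) (localRep V c) (extChartAt (𝓡 n) c x)) := by
    refine ext_inner_left ℝ (E := Model n) fun w => ?_
    exact key (innerSL ℝ w)
  rw [this, coord_uncoord hx]

theorem localRep_bracket {X V : VField n M} (hX : IsCk 1 X) (hV : IsCk 1 V) {c : M} {z : Model n}
    (hz : z ∈ (extChartAt (𝓡 n) c).target) :
    localRep (bracket X V) c z = lieCoord (localRep X c) (localRep V c) z := by
  have h := symm_mem_source hz
  rw [← chart_symm hz, localRep_chart _ h, coord_bracket hX hV h]

/-- Since the bracket may be computed in a fixed chart near a point, its local representative is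
`lieCoord`, which loses one derivative of each field. -/
theorem IsCk.bracket {X V : VField n M} (hX : IsCk ∞ X) (hV : IsCk ∞ V) :
    IsCk ∞ (bracket X V) := by
  refine isCk_infty_iff.2 fun k => ?_
  intro x
  have : IsManifold (𝓡 n) ((k : ℕ∞ω) + 1) M := IsManifold.of_le (n := ∞) (by norm_cast; simp)
  have : ContMDiffVectorBundle k (Model n) (TangentSpace (𝓡 n) : M → Type _) (𝓡 n) :=
    TangentBundle.contMDiffVectorBundle
  have hx := mem_chart_source (Model n) x
  rw [isCk_iff_at hx]
  have e : localRep (AnosovWeight.bracket X V) x =ᶠ[𝓝 (extChartAt (𝓡 n) x x)]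
      lieCoord (localRep X x) (localRep V x) := by
    filter_upwards [(isOpen_extChartAt_target x).mem_nhds (mem_target hx)] with z hz
    exact localRep_bracket (by simpa using hX.nat 1) (by simpa using hV.nat 1) hz
  refine ContDiffAt.congr_of_eventuallyEq ?_ e
  have hX1 := (hX.nat (k + 1)).contDiffAt_localRep hx
  have hV1 := (hV.nat (k + 1)).contDiffAt_localRep hx
  have hX0 := (hX.nat k).contDiffAt_localRep hx
  have hV0 := (hV.nat k).contDiffAt_localRep hx
  exact ((hV1.fderiv_right (m := k) (by norm_cast)).clm_apply hX0).sub
    ((hX1.fderiv_right (m := k) (by norm_cast)).clm_apply hV0)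

end Bracket

/-! ### The Riemannian norm, its Gram matrix in charts and its derivative along the flow. -/

section MetricNorm

variable {n : ℕ} {M : Type*} [TopologicalSpace M] [ChartedSpace (Model n) M]
  [IsManifold (𝓡 n) ∞ M] (g : Metric n M)

theorem inner_self_nonneg {x : M} (v : TangentSpace (𝓡 n) x) : 0 ≤ g.inner x v v := by
  by_cases h : v = 0
  · simp [h]
  · exact (g.pos x v h).le

theorem vnorm_nonneg {x : M} (v : TangentSpace (𝓡 n) x) : 0 ≤ vnorm g v := Real.sqrt_nonneg _

theorem vnorm_sq {x : M} (v : TangentSpace (𝓡 n) x) : vnorm g v ^ 2 = g.inner x v v :=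
  Real.sq_sqrt (inner_self_nonneg g v)

theorem vnorm_pos {x : M} {v : TangentSpace (𝓡 n) x} (hv : v ≠ 0) : 0 < vnorm g v :=
  Real.sqrt_pos.2 (g.pos x v hv)

theorem vnorm_zero {x : M} : vnorm g (0 : TangentSpace (𝓡 n) x) = 0 := by simp [vnorm]

theorem vnorm_smul {x : M} (a : ℝ) (v : TangentSpace (𝓡 n) x) :
    vnorm g (a • v) = |a| * vnorm g v := by
  have h : g.inner x (a • v) (a • v) = a ^ 2 * g.inner x v v := by
    simp; ring
  rw [vnorm, h, Real.sqrt_mul (sq_nonneg a), Real.sqrt_sq_eq_abs, vnorm]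

theorem vnorm_neg {x : M} (v : TangentSpace (𝓡 n) x) : vnorm g (-v) = vnorm g v := by
  have := vnorm_smul g (-1) v
  simpa using this

theorem inner_le_vnorm {x : M} (v w : TangentSpace (𝓡 n) x) :
    g.inner x v w ≤ vnorm g v * vnorm g w := by
  by_cases hv : v = 0
  · simp [hv, vnorm_zero]
  by_cases hw : w = 0
  · simp [hw, vnorm_zero]
  have h1 := vnorm_pos g hv
  have h2 := vnorm_pos g hw
  have h := inner_self_nonneg g (vnorm g w • v - vnorm g v • w)
  have e : g.inner x (vnorm g w • v - vnorm g v • w) (vnorm g w • v - vnorm g v • w) =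
      vnorm g w ^ 2 * g.inner x v v + vnorm g v ^ 2 * g.inner x w w
      - 2 * (vnorm g v * vnorm g w) * g.inner x v w := by
    simp [g.symm x w v]; ring
  rw [e, ← vnorm_sq, ← vnorm_sq] at h
  have h3 : 0 < vnorm g v * vnorm g w := mul_pos h1 h2
  nlinarith

theorem vnorm_add_le {x : M} (v w : TangentSpace (𝓡 n) x) :
    vnorm g (v + w) ≤ vnorm g v + vnorm g w := by
  refine Real.sqrt_le_iff.2 ⟨add_nonneg (vnorm_nonneg g v) (vnorm_nonneg g w), ?_⟩
  have e : g.inner x (v + w) (v + w) = g.inner x v v + g.inner x w w + 2 * g.inner x v w := by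
    simp [g.symm x w v]; ring
  rw [e, ← vnorm_sq, ← vnorm_sq]
  nlinarith [inner_le_vnorm g v w]

theorem vnorm_congr {x y : M} (h : x = y) (v : Model n) :
    vnorm g (x := x) v = vnorm g (x := y) v := by subst h; rfl

/-- The local frame of coordinate vector fields of a preferred chart. -/
def frameField (c : M) (i : Fin n) : VField n M := fun x => uncoord c x (EuclideanSpace.single i 1)

theorem contMDiffAt_frameField {c x : M} (hx : x ∈ (chartAt (Model n) c).source) (i : Fin n) :
    ContMDiffAt (𝓡 n) (𝓡 n).tangent ∞
      (fun x => (⟨x, frameField c i x⟩ : TangentBundle (𝓡 n) M)) x := by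
  have : IsManifold (𝓡 n) ((∞ : ℕ∞ω) + 1) M := IsManifold.of_le (n := ∞) (by norm_cast)
  have : ContMDiffVectorBundle ∞ (Model n) (TangentSpace (𝓡 n) : M → Type _) (𝓡 n) :=
    TangentBundle.contMDiffVectorBundle
  rw [isCk_iff_at hx]
  refine (contDiffAt_const (c := EuclideanSpace.single i (1 : ℝ))).congr_of_eventuallyEq ?_
  filter_upwards [(isOpen_extChartAt_target c).mem_nhds (mem_target hx)] with z hz
  have h := symm_mem_source hz
  rw [← chart_symm hz, localRep_chart _ h, frameField, coord_uncoord h]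

theorem contMDiffAt_inner {V W : VField n M} {x : M}
    (hV : ContMDiffAt (𝓡 n) (𝓡 n).tangent ∞ (fun x => (⟨x, V x⟩ : TangentBundle (𝓡 n) M)) x)
    (hW : ContMDiffAt (𝓡 n) (𝓡 n).tangent ∞ (fun x => (⟨x, W x⟩ : TangentBundle (𝓡 n) M)) x) :
    ContMDiffAt (𝓡 n) 𝓘(ℝ, ℝ) ∞ (fun x => g.inner x (V x) (W x)) x := by
  have : IsManifold (𝓡 n) ((∞ : ℕ∞ω) + 1) M := IsManifold.of_le (n := ∞) (by norm_cast)
  have : ContMDiffVectorBundle ∞ (Model n) (TangentSpace (𝓡 n) : M → Type _) (𝓡 n) :=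
    TangentBundle.contMDiffVectorBundle
  have h := ContMDiffAt.clm_bundle_apply₂ (F₁ := Model n) (F₂ := Model n) (F₃ := ℝ)
    (E₁ := fun x : M => TangentSpace (𝓡 n) x) (E₂ := fun x : M => TangentSpace (𝓡 n) x)
    (E₃ := Bundle.Trivial M ℝ) (b := fun x : M => x) (ψ := fun x => g.inner x)
    (v := V) (w := W) (n := ∞) (g.contMDiff x) hV hW
  simp only [contMDiffAt_totalSpace] at h
  exact h.2

/-- The Gram matrix of the metric in a preferred chart. -/
def gramCoord (c : M) (z : Model n) : Matrix (Fin n) (Fin n) ℝ :=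
  Matrix.of fun i j => g.inner ((extChartAt (𝓡 n) c).symm z)
    (frameField c i ((extChartAt (𝓡 n) c).symm z)) (frameField c j ((extChartAt (𝓡 n) c).symm z))

theorem volDensity_eq {c : M} {z : Model n} (hz : z ∈ (extChartAt (𝓡 n) c).target) : volDensity g c z = √(gramCoord g c z).det := by
  have key : ∀ w : Model n, uncoord c ((extChartAt (𝓡 n) c).symm z) w =
      (trivializationAt (Model n) (TangentSpace (𝓡 n) : M → Type _) c).symm
        ((extChartAt (𝓡 n) c).symm z) w := fun w =>
    Trivialization.symmL_apply _ (mem_baseSet (symm_mem_source hz)) w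
  simp only [volDensity, gramCoord, frameField, key]

theorem contDiffAt_gramCoord {c x : M} (hx : x ∈ (chartAt (Model n) c).source) (i j : Fin n) :
    ContDiffAt ℝ ∞ (fun z => gramCoord g c z i j) (extChartAt (𝓡 n) c x) := by
  rw [← contMDiffAt_iff_contDiffAt]
  have h2 : ContMDiffAt 𝓘(ℝ, Model n) (𝓡 n) ∞ (extChartAt (𝓡 n) c).symm
      (extChartAt (𝓡 n) c x) :=
    (contMDiffOn_extChartAt_symm c).contMDiffAt ((isOpen_extChartAt_target c).mem_nhds
      (mem_target hx))
  exact ContMDiffAt.comp (extChartAt (𝓡 n) c x) (g := fun x => g.inner x (frameField c i x)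
    (frameField c j x)) (by
      rw [symm_chart hx]
      exact contMDiffAt_inner g (contMDiffAt_frameField hx i) (contMDiffAt_frameField hx j)) h2

/-- The bilinear form with a given matrix. -/
def matForm (G : Matrix (Fin n) (Fin n) ℝ) (v w : Model n) : ℝ :=
  ∑ i, ∑ j, G i j * v i * w j

theorem inner_uncoord (c x : M) (v w : Model n) :
    g.inner x (uncoord c x v) (uncoord c x w) =
      ∑ i, ∑ j, g.inner x (frameField c i x) (frameField c j x) * v i * w j := by
  have hv : ∀ v : Model n, uncoord c x v = ∑ i, v i • frameField c i x := by
    intro v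
    conv_lhs => rw [← (EuclideanSpace.basisFun (Fin n) ℝ).sum_repr v]
    rw [map_sum]
    refine Finset.sum_congr rfl fun i _ => ?_
    simp [frameField]
  rw [hv v, hv w]
  simp only [map_sum, map_smul, sum_apply, smul_apply, smul_eq_mul, Finset.mul_sum]
  rw [Finset.sum_comm]
  refine Finset.sum_congr rfl fun i _ => Finset.sum_congr rfl fun j _ => ?_
  ring

theorem inner_eq_matForm {c x : M} (hx : x ∈ (chartAt (Model n) c).source)
    (v w : TangentSpace (𝓡 n) x) :
    g.inner x v w = matForm (gramCoord g c (extChartAt (𝓡 n) c x)) (coord c x v) (coord c x w) := by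
  conv_lhs => rw [← uncoord_coord hx v, ← uncoord_coord hx w]
  rw [inner_uncoord, matForm]
  simp only [gramCoord, Matrix.of_apply]
  rw [symm_chart hx]

variable [CompactSpace M] [T2Space M]

/-- The derivative of the Gram matrix of the metric along a vector field. -/
def gramRate (X : VField n M) (c : M) (z : Model n) : Matrix (Fin n) (Fin n) ℝ :=
  Matrix.of fun i j => fderiv ℝ (fun z => gramCoord g c z i j) z (localRep X c z)

/-- The derivative, in coordinates, of the metric along the flow. -/
def metricRate (X : VField n M) (c : M) (z v w : Model n) : ℝ :=
  matForm (gramRate g X c z) v w + matForm (gramCoord g c z) (fderiv ℝ (localRep X c) z v) w +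
    matForm (gramCoord g c z) v (fderiv ℝ (localRep X c) z w)

/-- In a chart the inner product is a sum of terms G_ij(φ(t)) (A(t) v)_i (A(t) w)_j; the three terms
of `metricRate` are the three terms of the product rule. -/
theorem hasDerivAt_inner_dflow {X : VField n M} (hX : IsCk 1 X) {c x : M}
    (hx : x ∈ (chartAt (Model n) c).source) (v w : TangentSpace (𝓡 n) x) :
    HasDerivAt (fun t => g.inner (flow X t x) (dflow X t x v) (dflow X t x w))
      (metricRate g X c (extChartAt (𝓡 n) c x) (coord c x v) (coord c x w)) 0 := by
  obtain ⟨φ, A, hφ0, hA0, hφ, hA, hev⟩ := exists_dflow_chart hX hx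
  set z := extChartAt (𝓡 n) c x with hz
  have hG : ∀ i j, HasDerivAt (fun t => gramCoord g c (φ t) i j) (gramRate g X c z i j) 0 := by
    intro i j
    have h1 : HasFDerivAt (fun z => gramCoord g c z i j)
        (fderiv ℝ (fun z => gramCoord g c z i j) z) (φ 0) := by
      rw [hφ0]
      exact ((contDiffAt_gramCoord g hx i j).differentiableAt (by simp)).hasFDerivAt
    exact h1.comp_hasDerivAt 0 hφ
  have hAv : ∀ (v : Model n) (i : Fin n), HasDerivAt (fun t => A t v i)
      (fderiv ℝ (localRep X c) z v i) 0 := by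
    intro v i
    have h1 := hA.clm_apply (hasDerivAt_const (0 : ℝ) v)
    have h2 := (EuclideanSpace.proj (𝕜 := ℝ) i : Model n →L[ℝ] ℝ).hasFDerivAt.comp_hasDerivAt
      (0 : ℝ) h1
    exact h2.congr_deriv (by simp)
  have h := HasDerivAt.fun_sum (u := Finset.univ) fun i _ =>
    HasDerivAt.fun_sum (u := Finset.univ) fun j _ =>
      ((hG i j).mul (hAv (coord c x v) i)).mul (hAv (coord c x w) j)
  refine (h.congr_deriv ?_).congr_of_eventuallyEq ?_
  · simp only [metricRate, matForm, ← Finset.sum_add_distrib]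
    refine Finset.sum_congr rfl fun i _ => Finset.sum_congr rfl fun j _ => ?_
    simp only [hφ0, hA0, Pi.mul_apply, ContinuousLinearMap.id_apply]
    ring
  · filter_upwards [hev] with t ht
    rw [inner_eq_matForm g ht.1, ht.2.1, ht.2.2, ht.2.2]
    rfl

end MetricNorm

/-- Used to replace constants found in each chart of a finite cover by a single one. -/
theorem Finset.exists_uniform_bound {α : Type*} (s : Finset α) {P : α → ℝ → Prop}
    (hmono : ∀ a κ κ', κ ≤ κ' → P a κ → P a κ') (h : ∀ a ∈ s, ∃ κ, P a κ) :
    ∃ κ, 1 ≤ κ ∧ ∀ a ∈ s, P a κ := by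
  choose! κ hκ using h
  obtain ⟨m, hm⟩ := Finset.exists_le (insert 1 (s.image κ))
  exact ⟨m, hm 1 (Finset.mem_insert_self _ _), fun a ha => hmono a _ _
    (hm _ (Finset.mem_insert_of_mem (Finset.mem_image_of_mem κ ha))) (hκ a ha)⟩

/-! ### The dual norm, uniform bounds over a finite chart cover, and a global frame. -/

section Conorm

variable {n : ℕ} {M : Type*} [TopologicalSpace M] [ChartedSpace (Model n) M]
  [IsManifold (𝓡 n) ∞ M] (g : Metric n M)

/-- The pointwise bound comes from compactness of the unit sphere. It is needed because the supremum
defining `conorm` has its usual meaning only for a bounded family. -/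
theorem exists_norm_le_vnorm (x : M) :
    ∃ κ, ∀ v : Model n, ‖v‖ ≤ κ * vnorm g (x := x) v := by
  let q : Model n → ℝ := fun v => vnorm g (x := x) v
  have hq : Continuous q := by
    have : Continuous fun v : Model n => (g.inner x : Model n →L[ℝ] Model n →L[ℝ] ℝ) v v :=
      (g.inner x : Model n →L[ℝ] Model n →L[ℝ] ℝ).continuous.clm_apply continuous_id
    exact this.sqrt
  rcases (Metric.sphere (0 : Model n) 1).eq_empty_or_nonempty with he | hne
  · refine ⟨0, fun v => ?_⟩
    by_cases hv : v = 0
    · simp [hv]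
    · have : (‖v‖⁻¹ • v) ∈ Metric.sphere (0 : Model n) 1 := by
        simp [norm_smul, hv]
      rw [he] at this
      exact this.elim
  · obtain ⟨w, hw, hmin⟩ := (isCompact_sphere (0 : Model n) 1).exists_isMinOn hne hq.continuousOn
    have hw0 : w ≠ 0 := by
      rintro rfl
      simp at hw
    have hpos : 0 < q w := vnorm_pos g (x := x) hw0
    refine ⟨(q w)⁻¹, fun v => ?_⟩
    by_cases hv : v = 0
    · subst hv
      rw [norm_zero]
      exact mul_nonneg (inv_nonneg.2 hpos.le) (vnorm_nonneg g (x := x) _)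
    · have hs : (‖v‖⁻¹ • v) ∈ Metric.sphere (0 : Model n) 1 := by
        simp [norm_smul, hv]
      have h1 : q w ≤ q (‖v‖⁻¹ • v) := hmin hs
      have h2 : q (‖v‖⁻¹ • v) = ‖v‖⁻¹ * q v := by
        have := vnorm_smul g (x := x) ‖v‖⁻¹ v
        rwa [abs_of_nonneg (by positivity)] at this
      have h3 : 0 < ‖v‖ := norm_pos_iff.2 hv
      rw [h2] at h1
      change ‖v‖ ≤ (q w)⁻¹ * q v
      rw [inv_mul_eq_div, le_div_iff₀ hpos]
      calc ‖v‖ * q w ≤ ‖v‖ * (‖v‖⁻¹ * q v) := by gcongr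
        _ = q v := by field_simp

theorem bddAbove_conorm (ξ : Cotangent n M) :
    BddAbove (range fun v : {v : TangentSpace (𝓡 n) ξ.1 // vnorm g v ≤ 1} => |(ξ.2 v.1 : ℝ)|) := by
  obtain ⟨κ, hκ⟩ := exists_norm_le_vnorm g ξ.1
  let ℓ : Model n →L[ℝ] ℝ := ξ.2
  refine ⟨‖ℓ‖ * |κ|, ?_⟩
  rintro _ ⟨v, rfl⟩
  refine (ℓ.le_opNorm v.1).trans ?_
  gcongr
  refine (hκ v.1).trans ?_
  have h1 := v.2
  have h0 := vnorm_nonneg g v.1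
  calc κ * vnorm g v.1 ≤ |κ| * vnorm g v.1 := by gcongr; exact le_abs_self κ
    _ ≤ |κ| * 1 := by gcongr
    _ = |κ| := mul_one _

theorem conorm_nonneg (ξ : Cotangent n M) : 0 ≤ conorm g ξ :=
  Real.iSup_nonneg fun _ => abs_nonneg _

theorem abs_apply_le (ξ : Cotangent n M) (v : TangentSpace (𝓡 n) ξ.1) :
    |(ξ.2 v : ℝ)| ≤ conorm g ξ * vnorm g v := by
  by_cases hv : v = 0
  · simp [hv, vnorm_zero]
  have h := vnorm_pos g hv
  have h1 : vnorm g ((vnorm g v)⁻¹ • v) ≤ 1 := by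
    rw [vnorm_smul, abs_of_pos (inv_pos.2 h), inv_mul_cancel₀ h.ne']
  have h2 : |(ξ.2 ((vnorm g v)⁻¹ • v) : ℝ)| ≤ conorm g ξ := le_ciSup (bddAbove_conorm g ξ)
    (⟨_, h1⟩ : {v : TangentSpace (𝓡 n) ξ.1 // vnorm g v ≤ 1})
  rw [map_smul, smul_eq_mul, abs_mul, abs_of_pos (inv_pos.2 h), inv_mul_eq_div, div_le_iff₀ h] at h2
  exact h2

theorem conorm_le {ξ : Cotangent n M} {a : ℝ} (ha : 0 ≤ a)
    (h : ∀ v : TangentSpace (𝓡 n) ξ.1, |(ξ.2 v : ℝ)| ≤ a * vnorm g v) : conorm g ξ ≤ a := by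
  have : Nonempty {v : TangentSpace (𝓡 n) ξ.1 // vnorm g v ≤ 1} :=
    ⟨⟨0, by rw [vnorm_zero]; exact zero_le_one⟩⟩
  refine ciSup_le fun v => (h v.1).trans ?_
  have := v.2
  nlinarith

theorem conorm_pos {ξ : Cotangent n M} (hξ : ξ.2 ≠ 0) : 0 < conorm g ξ := by
  refine lt_of_le_of_ne (conorm_nonneg g ξ) fun h => hξ ?_
  refine ContinuousLinearMap.ext fun v => ?_
  have := abs_apply_le g ξ v
  rw [← h, zero_mul] at this
  exact abs_eq_zero.1 (le_antisymm this (abs_nonneg _))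

theorem conorm_eq_zero {ξ : Cotangent n M} (hξ : ξ.2 = 0) : conorm g ξ = 0 := by
  refine le_antisymm (conorm_le g le_rfl fun v => ?_) (conorm_nonneg g ξ)
  rw [hξ]
  simp

theorem abs_symbol_le (V : VField n M) (ξ : Cotangent n M) :
    |symbol V ξ| ≤ conorm g ξ * vnorm g (V ξ.1) := abs_apply_le g ξ _

theorem symbol_scale (V : VField n M) (r : ℝ) (ξ : Cotangent n M) :
    symbol V (scale r ξ) = r * symbol V ξ := rfl

theorem symbol_sub (V W : VField n M) (ξ : Cotangent n M) :
    symbol (fun x => V x - W x) ξ = symbol V ξ - symbol W ξ :=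
  map_sub (ξ.2 : Model n →L[ℝ] ℝ) (V ξ.1) (W ξ.1)

theorem localRep_eq (X : VField n M) {c : M} {z : Model n} (hz : z ∈ (extChartAt (𝓡 n) c).target) :
    localRep X c z = coord c ((extChartAt (𝓡 n) c).symm z) (X ((extChartAt (𝓡 n) c).symm z)) := by
  conv_lhs => rw [← chart_symm hz]
  rw [localRep_chart X (symm_mem_source hz)]

theorem localRep_sub (X Y : VField n M) {c : M} {z : Model n}
    (hz : z ∈ (extChartAt (𝓡 n) c).target) :
    localRep (fun x => X x - Y x) c z = localRep X c z - localRep Y c z := by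
  simp only [localRep_eq _ hz, map_sub]

variable [CompactSpace M] [T2Space M] (𝒜 : ChartCover n M)

theorem isCompact_chart_image {c : M} (hc : c ∈ 𝒜.centers) :
    IsCompact (extChartAt (𝓡 n) c '' 𝒜.K c) :=
  (𝒜.isCompact c hc).image_of_continuousOn ((continuousOn_extChartAt c).mono (by
    simpa using 𝒜.subset_source c hc))

/-- A function which is continuous near the images of the compact sets of a chart cover is
bounded there. -/
theorem exists_bound_of_continuousAt {F : Type*} [NormedAddCommGroup F] (f : M → Model n → F)
    (hf : ∀ c ∈ 𝒜.centers, ∀ x ∈ 𝒜.K c, ContinuousAt (f c) (extChartAt (𝓡 n) c x)) :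
    ∃ B, 1 ≤ B ∧ ∀ c ∈ 𝒜.centers, ∀ x ∈ 𝒜.K c, ‖f c (extChartAt (𝓡 n) c x)‖ ≤ B := by
  refine Finset.exists_uniform_bound 𝒜.centers
    (P := fun c B => ∀ x ∈ 𝒜.K c, ‖f c (extChartAt (𝓡 n) c x)‖ ≤ B)
    (fun a κ κ' h hP x hx => (hP x hx).trans h) fun c hc => ?_
  have : ContinuousOn (f c) (extChartAt (𝓡 n) c '' 𝒜.K c) := by
    rintro _ ⟨x, hx, rfl⟩
    exact (hf c hc x hx).continuousWithinAt
  obtain ⟨B, hB⟩ := (isCompact_chart_image 𝒜 hc).exists_bound_of_continuousOn this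
  exact ⟨B, fun x hx => hB _ (mem_image_of_mem _ hx)⟩

theorem IsCk.exists_bound {V : VField n M} (hV : IsCk 1 V) :
    ∃ B, 1 ≤ B ∧ ∀ c ∈ 𝒜.centers, ∀ x ∈ 𝒜.K c,
      ‖localRep V c (extChartAt (𝓡 n) c x)‖ ≤ B ∧
      ‖fderiv ℝ (localRep V c) (extChartAt (𝓡 n) c x)‖ ≤ B := by
  have hd : ∀ c ∈ 𝒜.centers, ∀ x ∈ 𝒜.K c,
      ContDiffAt ℝ (1 : ℕ) (localRep V c) (extChartAt (𝓡 n) c x) := fun c hc x hx =>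
    IsCk.contDiffAt_localRep (by simpa using hV) (𝒜.subset_source c hc hx)
  obtain ⟨B₁, h1, hB₁⟩ := exists_bound_of_continuousAt 𝒜 (fun c => localRep V c)
    fun c hc x hx => (hd c hc x hx).continuousAt
  obtain ⟨B₂, h2, hB₂⟩ := exists_bound_of_continuousAt 𝒜 (fun c => fderiv ℝ (localRep V c))
    fun c hc x hx => ((hd c hc x hx).fderiv_right (m := 0) (by simp)).continuousAt
  exact ⟨max B₁ B₂, le_max_of_le_left h1, fun c hc x hx =>
    ⟨(hB₁ c hc x hx).trans (le_max_left _ _), (hB₂ c hc x hx).trans (le_max_right _ _)⟩⟩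

theorem localRep_lt_of_C1Norm_lt {V : VField n M} {η : ℝ} (h : C1Norm 𝒜 V < ENNReal.ofReal η)
    {c : M} (hc : c ∈ 𝒜.centers) {x : M} (hx : x ∈ 𝒜.K c) :
    ‖localRep V c (extChartAt (𝓡 n) c x)‖ + ‖fderiv ℝ (localRep V c) (extChartAt (𝓡 n) c x)‖ < η := by
  have h1 : (‖localRep V c (extChartAt (𝓡 n) c x)‖ₑ
      + ‖fderiv ℝ (localRep V c) (extChartAt (𝓡 n) c x)‖ₑ) ≤ C1Norm 𝒜 V :=
    le_iSup₂_of_le c hc (le_iSup₂_of_le x hx le_rfl)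
  have h2 := h1.trans_lt h
  rw [← ofReal_norm, ← ofReal_norm,
    ← ENNReal.ofReal_add (norm_nonneg _) (norm_nonneg _)] at h2
  exact (ENNReal.ofReal_lt_ofReal_iff_of_nonneg (by positivity)).1 h2

/-- On the compact sets of a chart cover the metric is comparable with the coordinates. -/
theorem exists_coord_bound : ∃ κ, 1 ≤ κ ∧ ∀ c ∈ 𝒜.centers, ∀ x ∈ 𝒜.K c,
    ∀ v : TangentSpace (𝓡 n) x, ‖coord c x v‖ ≤ κ * vnorm g v ∧ vnorm g v ≤ κ * ‖coord c x v‖ := by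
  refine Finset.exists_uniform_bound 𝒜.centers (P := fun c κ => ∀ x ∈ 𝒜.K c,
    ∀ v : TangentSpace (𝓡 n) x, ‖coord c x v‖ ≤ κ * vnorm g v ∧ vnorm g v ≤ κ * ‖coord c x v‖)
    (fun a κ κ' h hP x hx v => ⟨(hP x hx v).1.trans
      (mul_le_mul_of_nonneg_right h (vnorm_nonneg g v)), (hP x hx v).2.trans
      (mul_le_mul_of_nonneg_right h (norm_nonneg _))⟩) fun c hc => ?_
  have hsrc := fun x hx => 𝒜.subset_source c hc (a := x) hx
  let q : Model n × Model n → ℝ := fun p => √(matForm (gramCoord g c p.1) p.2 p.2)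
  have hcomp := (isCompact_chart_image 𝒜 hc).prod (isCompact_sphere (0 : Model n) 1)
  have hcont : ContinuousOn q ((extChartAt (𝓡 n) c '' 𝒜.K c) ×ˢ Metric.sphere (0 : Model n) 1) := by
    rintro ⟨_, w⟩ ⟨⟨x, hx, rfl⟩, hw⟩
    refine ContinuousAt.continuousWithinAt ?_
    refine (Real.continuous_sqrt.continuousAt).comp ?_
    unfold matForm
    refine tendsto_finsetSum _ fun i _ => tendsto_finsetSum _ fun j _ => ?_
    have h1 : ContinuousAt (fun z => gramCoord g c z i j) (extChartAt (𝓡 n) c x) :=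
      (contDiffAt_gramCoord g (hsrc x hx) i j).continuousAt
    have h2 : ContinuousAt (fun p : Model n × Model n => gramCoord g c p.1 i j)
      (extChartAt (𝓡 n) c x, w) := ContinuousAt.comp (f := Prod.fst) (g := fun z => gramCoord g c z i j) h1 continuousAt_fst
    have h3 : ∀ i, ContinuousAt (fun p : Model n × Model n => p.2 i) (extChartAt (𝓡 n) c x, w) :=
      fun i => by fun_prop
    exact (h2.mul (h3 i)).mul (h3 j)
  have hq : ∀ x ∈ 𝒜.K c, ∀ v : TangentSpace (𝓡 n) x,
      vnorm g v = q (extChartAt (𝓡 n) c x, coord c x v) := fun x hx v => by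
    simp only [q, vnorm, inner_eq_matForm g (hsrc x hx)]
  have hq' : ∀ x ∈ 𝒜.K c, ∀ w : Model n,
      q (extChartAt (𝓡 n) c x, w) = vnorm g (uncoord c x w) := fun x hx w => by
    rw [hq x hx, coord_uncoord (hsrc x hx)]
  obtain ⟨B, hB⟩ := hcomp.exists_bound_of_continuousOn hcont
  have hpos : ∀ p ∈ (extChartAt (𝓡 n) c '' 𝒜.K c) ×ˢ Metric.sphere (0 : Model n) 1, 0 < q p := by
    rintro ⟨_, w⟩ ⟨⟨x, hx, rfl⟩, hw⟩
    rw [hq' x hx]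
    refine vnorm_pos g fun h => ?_
    have := coord_uncoord (hsrc x hx) w
    rw [h, map_zero] at this
    rw [← this] at hw
    simp at hw
  obtain ⟨m, hm, hmq⟩ : ∃ m > 0, ∀ p ∈ (extChartAt (𝓡 n) c '' 𝒜.K c) ×ˢ
      Metric.sphere (0 : Model n) 1, m ≤ q p := by
    rcases ((extChartAt (𝓡 n) c '' 𝒜.K c) ×ˢ Metric.sphere (0 : Model n) 1).eq_empty_or_nonempty
      with he | hne
    · exact ⟨1, one_pos, fun p hp => by rw [he] at hp; exact hp.elim⟩
    · obtain ⟨p, hp, hmin⟩ := hcomp.exists_isMinOn hne hcont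
      exact ⟨q p, hpos p hp, fun p' hp' => hmin hp'⟩
  refine ⟨max m⁻¹ B, fun x hx v => ?_⟩
  set w := coord c x v with hw
  by_cases hw0 : w = 0
  · have : v = 0 := by rw [← uncoord_coord (hsrc x hx) v, ← hw, hw0, map_zero]
    rw [hw0, this, vnorm_zero]
    simp
  · have h3 : 0 < ‖w‖ := norm_pos_iff.2 hw0
    have hs : (‖w‖⁻¹ • w) ∈ Metric.sphere (0 : Model n) 1 := by
      simp [norm_smul, hw0]
    have hmem : (extChartAt (𝓡 n) c x, ‖w‖⁻¹ • w) ∈ (extChartAt (𝓡 n) c '' 𝒜.K c) ×ˢ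
      Metric.sphere (0 : Model n) 1 := ⟨mem_image_of_mem _ hx, hs⟩
    have e : q (extChartAt (𝓡 n) c x, ‖w‖⁻¹ • w) = ‖w‖⁻¹ * vnorm g v := by
      rw [hq' x hx, map_smul, hw, uncoord_coord (hsrc x hx), vnorm_smul,
        abs_of_nonneg (by positivity)]
    have h1 := hmq _ hmem
    have h2 := (le_abs_self _).trans (hB _ hmem)
    rw [e] at h1 h2
    rw [inv_mul_eq_div] at h1 h2
    rw [le_div_iff₀ h3] at h1
    rw [div_le_iff₀ h3] at h2
    constructor
    · calc ‖w‖ = m⁻¹ * (m * ‖w‖) := by field_simp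
        _ ≤ m⁻¹ * vnorm g v := by gcongr
        _ ≤ max m⁻¹ B * vnorm g v :=
          mul_le_mul_of_nonneg_right (le_max_left _ _) (vnorm_nonneg g v)
    · exact h2.trans (mul_le_mul_of_nonneg_right (le_max_right _ _) h3.le)

/-- Vector fields with bounded coordinates are bounded. -/
theorem exists_vnorm_le (𝒜 : ChartCover n M) {V : VField n M} (hV : IsCk 1 V) : ∃ B, 1 ≤ B ∧ ∀ x, vnorm g (V x) ≤ B := by
  obtain ⟨B, hB1, hB⟩ := IsCk.exists_bound 𝒜 hV
  obtain ⟨κ, hκ1, hκ⟩ := exists_coord_bound g 𝒜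
  refine ⟨κ * B, by nlinarith, fun x => ?_⟩
  obtain ⟨c, hc, hx⟩ := 𝒜.covers x
  refine (hκ c hc x hx _).2.trans ?_
  rw [← localRep_chart V (𝒜.subset_source c hc hx)]
  gcongr
  exact (hB c hc x hx).1

/-- The symbol of a vector field with small coordinates is small. -/
theorem exists_abs_symbol_le : ∃ κ, 1 ≤ κ ∧ ∀ (V : VField n M) (η : ℝ),
    C1Norm 𝒜 V < ENNReal.ofReal η → ∀ ξ : Cotangent n M, |symbol V ξ| ≤ κ * η * conorm g ξ := by
  obtain ⟨κ, hκ1, hκ⟩ := exists_coord_bound g 𝒜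
  refine ⟨κ, hκ1, fun V η hV ξ => ?_⟩
  obtain ⟨c, hc, hx⟩ := 𝒜.covers ξ.1
  refine (abs_symbol_le g V ξ).trans ?_
  rw [mul_comm]
  refine mul_le_mul_of_nonneg_right ?_ (conorm_nonneg g ξ)
  refine (hκ c hc _ hx _).2.trans ?_
  rw [← localRep_chart V (𝒜.subset_source c hc hx)]
  have := localRep_lt_of_C1Norm_lt 𝒜 hV hc hx
  gcongr
  linarith [norm_nonneg (fderiv ℝ (localRep V c) (extChartAt (𝓡 n) c ξ.1))]

/-- The bracket with a fixed vector field depends continuously on the other field. -/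
theorem exists_abs_symbol_bracket_sub_le {X₀ V : VField n M} (hX₀ : IsCk 1 X₀) (hV : IsCk 1 V) :
    ∃ κ, 1 ≤ κ ∧ ∀ (X : VField n M) (η : ℝ), IsCk 1 X →
      C1Norm 𝒜 (fun x => X x - X₀ x) < ENNReal.ofReal η → ∀ ξ : Cotangent n M,
        |symbol (bracket X V) ξ - symbol (bracket X₀ V) ξ| ≤ κ * η * conorm g ξ := by
  obtain ⟨κ, hκ1, hκ⟩ := exists_coord_bound g 𝒜
  obtain ⟨B, hB1, hB⟩ := IsCk.exists_bound 𝒜 hV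
  refine ⟨κ * B, by nlinarith, fun X η hX hη ξ => ?_⟩
  obtain ⟨c, hc, hx⟩ := 𝒜.covers ξ.1
  have hs := 𝒜.subset_source c hc hx
  rw [← symbol_sub]
  refine (abs_symbol_le g _ ξ).trans ?_
  rw [mul_comm]
  refine mul_le_mul_of_nonneg_right ?_ (conorm_nonneg g ξ)
  refine (hκ c hc _ hx _).2.trans ?_
  rw [mul_assoc]
  gcongr
  rw [map_sub, coord_bracket hX hV hs, coord_bracket hX₀ hV hs]
  set z := extChartAt (𝓡 n) c ξ.1 with hz
  have hzt : z ∈ (extChartAt (𝓡 n) c).target := mem_target hs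
  have e2 : localRep (fun x => X x - X₀ x) c =ᶠ[𝓝 z] fun z => localRep X c z - localRep X₀ c z := by
    filter_upwards [(isOpen_extChartAt_target c).mem_nhds hzt] with z hz using localRep_sub X X₀ hz
  have hd1 : DifferentiableAt ℝ (localRep X c) z :=
    (IsCk.contDiffAt_localRep (k := 1) (by simpa using hX) hs).differentiableAt (by simp)
  have hd2 : DifferentiableAt ℝ (localRep X₀ c) z :=
    (IsCk.contDiffAt_localRep (k := 1) (by simpa using hX₀) hs).differentiableAt (by simp)
  -- The bracket is linear in its first argument, so the difference is the bracket of X - X₀ with V: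
  -- only the C¹ size of X - X₀ enters, multiplied by C¹ bounds of the fixed field V.
  have e3 : lieCoord (localRep X c) (localRep V c) z - lieCoord (localRep X₀ c) (localRep V c) z =
      fderiv ℝ (localRep V c) z (localRep (fun x => X x - X₀ x) c z) -
        fderiv ℝ (localRep (fun x => X x - X₀ x) c) z (localRep V c z) := by
    rw [e2.fderiv_eq, localRep_sub X X₀ hzt, fderiv_fun_sub hd1 hd2, lieCoord, lieCoord, map_sub,
      sub_apply]
    abel
  rw [e3]
  have h1 := localRep_lt_of_C1Norm_lt 𝒜 hη hc hx
  obtain ⟨h2, h3⟩ := hB c hc _ hx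
  calc _ ≤ ‖fderiv ℝ (localRep V c) z‖ * ‖localRep (fun x => X x - X₀ x) c z‖ +
        ‖fderiv ℝ (localRep (fun x => X x - X₀ x) c) z‖ * ‖localRep V c z‖ :=
        (norm_sub_le _ _).trans (add_le_add (ContinuousLinearMap.le_opNorm _ _)
          (ContinuousLinearMap.le_opNorm _ _))
    _ ≤ B * ‖localRep (fun x => X x - X₀ x) c z‖ +
        ‖fderiv ℝ (localRep (fun x => X x - X₀ x) c) z‖ * B := by gcongr
    _ = B * (‖localRep (fun x => X x - X₀ x) c z‖ +
        ‖fderiv ℝ (localRep (fun x => X x - X₀ x) c) z‖) := by ring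
    _ ≤ B * η := by gcongr

/-- A finite family of smooth vector fields which contains, near each point, a coordinate frame. -/
theorem exists_frame : ∃ b : 𝒜.centers × Fin n → VField n M, (∀ i, IsCk ∞ (b i)) ∧
    ∀ c : 𝒜.centers, ∀ x ∈ 𝒜.K c, ∀ j, b (c, j) x = frameField c.1 j x := by
  have key : ∀ i : 𝒜.centers × Fin n, ∃ V : VField n M, IsCk ∞ V ∧
      ∀ x ∈ 𝒜.K i.1, V x = frameField i.1.1 i.2 x := by
    rintro ⟨⟨c, hc⟩, j⟩
    have hcl : IsClosed (𝒜.K c) := (𝒜.isCompact c hc).isClosed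
    -- A bump function equal to 1 on the compact set and vanishing outside U extends the coordinate
    -- field by 0. The closure of U inside the chart domain makes the extension smooth across the
    -- boundary of that domain.
    obtain ⟨U, hU, hKU, hUs⟩ := normal_exists_closure_subset hcl (chartAt (Model n) c).open_source
      (𝒜.subset_source c hc)
    obtain ⟨f, hf1, hf0, -⟩ := exists_contMDiffMap_one_nhds_of_subset_interior (𝓡 n) (n := ⊤)
      hcl (t := U) (by rwa [hU.interior_eq])
    refine ⟨fun x => f x • frameField c j x, fun x => ?_, fun x hx => ?_⟩
    · by_cases hx : x ∈ (chartAt (Model n) c).source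
      · exact ContMDiffAt.smul_section (f.contMDiff x) (contMDiffAt_frameField hx j)
      · have h0 : (fun y => f y • frameField c j y) =ᶠ[𝓝 x]
            fun y => (0 : TangentSpace (𝓡 n) y) := by
          have : x ∈ (closure U)ᶜ := fun h => hx (hUs h)
          filter_upwards [isClosed_closure.isOpen_compl.mem_nhds this] with y hy
          rw [hf0 y fun h => hy (subset_closure h), zero_smul]
        have hz : ContMDiffAt (𝓡 n) (𝓡 n).tangent ∞
            (fun y => (⟨y, (0 : TangentSpace (𝓡 n) y)⟩ : TangentBundle (𝓡 n) M)) x :=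
          contMDiff_zeroSection ℝ (TangentSpace (𝓡 n) : M → Type _) x
        refine hz.congr_of_eventuallyEq ?_
        filter_upwards [h0] with y hy
        rw [hy]
    · change f x • frameField c j x = frameField c j x
      rw [(hf1.self_of_nhdsSet x hx), one_smul]
  choose b hb using key
  exact ⟨b, fun i => (hb i).1, fun c x hx j => (hb (c, j)).2 x hx⟩

end Conorm

/-- The function exp(-a s) h(s) is nonincreasing; negative times follow by reversing time. -/
theorem le_exp_of_abs_deriv_le {h h' : ℝ → ℝ} {a : ℝ} (hd : ∀ t, HasDerivAt h (h' t) t)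
    (hb : ∀ t, |h' t| ≤ a * h t) (t : ℝ) : h t ≤ Real.exp (a * |t|) * h 0 := by
  have key : ∀ (h h' : ℝ → ℝ), (∀ t, HasDerivAt h (h' t) t) → (∀ t, |h' t| ≤ a * h t) →
      ∀ t, 0 ≤ t → h t ≤ Real.exp (a * t) * h 0 := by
    intro h h' hd hb t ht
    have h1 : ∀ s, HasDerivAt (fun s => Real.exp (-a * s) * h s)
        (Real.exp (-a * s) * (-a * 1) * h s + Real.exp (-a * s) * h' s) s := fun s =>
      ((((hasDerivAt_id s).const_mul (-a)).exp)).mul (hd s)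
    have h2 : Antitone (fun s => Real.exp (-a * s) * h s) := by
      refine antitone_of_hasDerivAt_nonpos h1 fun s => ?_
      have := (le_abs_self _).trans (hb s)
      have e : Real.exp (-a * s) * (-a * 1) * h s + Real.exp (-a * s) * h' s =
        Real.exp (-a * s) * (h' s - a * h s) := by ring
      change Real.exp (-a * s) * (-a * 1) * h s + Real.exp (-a * s) * h' s ≤ 0
      rw [e]
      exact mul_nonpos_of_nonneg_of_nonpos (Real.exp_pos _).le (by linarith)
    have h3 : Real.exp (-a * t) * h t ≤ Real.exp (-a * 0) * h 0 := h2 ht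
    rw [mul_zero, Real.exp_zero, one_mul] at h3
    calc h t = Real.exp (a * t) * (Real.exp (-a * t) * h t) := by
          rw [← mul_assoc, ← Real.exp_add]; simp
      _ ≤ _ := by gcongr
  rcases le_total 0 t with ht | ht
  · rw [abs_of_nonneg ht]
    exact key h h' hd hb t ht
  · rw [abs_of_nonpos ht]
    have := key (fun s => h (-s)) (fun s => -h' (-s))
      (fun s => ((hd (-s)).comp s (hasDerivAt_neg s)).congr_deriv (by ring)) (fun s => by
        simpa using hb (-s)) (-t) (by linarith)
    simpa using this

/-! ### Uniform growth rates for all vector fields C¹-close to a given one. -/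

section Growth

variable {n : ℕ} {M : Type*} [TopologicalSpace M] [ChartedSpace (Model n) M]
  [IsManifold (𝓡 n) ∞ M] (g : Metric n M)

theorem abs_matForm_le {G : Matrix (Fin n) (Fin n) ℝ} {B : ℝ} (hG : ∀ i j, |G i j| ≤ B)
    (v w : Model n) : |matForm G v w| ≤ (n : ℝ) ^ 2 * B * ‖v‖ * ‖w‖ := by
  have h1 : ∀ i j, |G i j * v i * w j| ≤ B * ‖v‖ * ‖w‖ := by
    intro i j
    have hv : |v i| ≤ ‖v‖ := by simpa using PiLp.norm_apply_le v i
    have hw : |w j| ≤ ‖w‖ := by simpa using PiLp.norm_apply_le w j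
    have hB : 0 ≤ B := (abs_nonneg _).trans (hG i j)
    rw [abs_mul, abs_mul]
    have := hG i j
    gcongr
  calc |matForm G v w| ≤ ∑ i, |∑ j, G i j * v i * w j| := Finset.abs_sum_le_sum_abs _ _
    _ ≤ ∑ _i : Fin n, ∑ _j : Fin n, B * ‖v‖ * ‖w‖ := Finset.sum_le_sum fun i _ =>
      (Finset.abs_sum_le_sum_abs _ _).trans (Finset.sum_le_sum fun j _ => h1 i j)
    _ = (n : ℝ) ^ 2 * B * ‖v‖ * ‖w‖ := by simp; ring

variable [CompactSpace M] [T2Space M] (𝒜 : ChartCover n M)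

theorem metricRate_eq {X : VField n M} (hX : IsCk 1 X) {c c' x : M}
    (hc : x ∈ (chartAt (Model n) c).source) (hc' : x ∈ (chartAt (Model n) c').source)
    (v w : TangentSpace (𝓡 n) x) :
    metricRate g X c (extChartAt (𝓡 n) c x) (coord c x v) (coord c x w) =
      metricRate g X c' (extChartAt (𝓡 n) c' x) (coord c' x v) (coord c' x w) :=
  (hasDerivAt_inner_dflow g hX hc v w).unique (hasDerivAt_inner_dflow g hX hc' v w)

/-- A uniform bound for the derivative of the metric along the flows of the vector fields near a
given one. -/
theorem exists_metricRate_le {X₀ : VField n M} (hX₀ : IsCk 1 X₀) : ∃ Λ, 1 ≤ Λ ∧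
    ∀ X : VField n M, IsCk 1 X → C1Norm 𝒜 (fun x => X x - X₀ x) < ENNReal.ofReal 1 →
      ∀ (c x : M) (_ : x ∈ (chartAt (Model n) c).source) (v : TangentSpace (𝓡 n) x),
        |metricRate g X c (extChartAt (𝓡 n) c x) (coord c x v) (coord c x v)| ≤
          2 * Λ * g.inner x v v := by
  obtain ⟨κ, hκ1, hκ⟩ := exists_coord_bound g 𝒜
  obtain ⟨B, hB1, hB⟩ := IsCk.exists_bound 𝒜 hX₀
  obtain ⟨D, hD1, hD⟩ := exists_bound_of_continuousAt 𝒜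
    (fun c z => (fun i j => gramCoord g c z i j : Fin n → Fin n → ℝ))
    fun c hc x hx => continuousAt_pi.2 fun i => continuousAt_pi.2 fun j =>
      (contDiffAt_gramCoord g (𝒜.subset_source c hc hx) i j).continuousAt
  obtain ⟨D', hD'1, hD'⟩ := exists_bound_of_continuousAt 𝒜
    (fun c z => (fun i j => fderiv ℝ (fun z => gramCoord g c z i j) z :
      Fin n → Fin n → Model n →L[ℝ] ℝ))
    fun c hc x hx => continuousAt_pi.2 fun i => continuousAt_pi.2 fun j =>
      ((contDiffAt_gramCoord g (𝒜.subset_source c hc hx) i j).fderiv_right (m := 0)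
        (by norm_cast)).continuousAt
  -- B + 1 bounds the first jet of every X within C¹ distance 1 of X₀, D and D' bound the Gram
  -- matrix and its derivative, and κ² converts coordinates into the metric.
  refine ⟨1 + (n : ℝ) ^ 2 * (D' * (B + 1)) * κ ^ 2 + 2 * ((n : ℝ) ^ 2 * D * (B + 1) * κ ^ 2), by
    have : 0 ≤ (n : ℝ) ^ 2 * (D' * (B + 1)) * κ ^ 2 := by positivity
    have : 0 ≤ (n : ℝ) ^ 2 * D * (B + 1) * κ ^ 2 := by positivity
    linarith, fun X hX hη c' x hc' v => ?_⟩
  obtain ⟨c, hc, hx⟩ := 𝒜.covers x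
  have hs := 𝒜.subset_source c hc hx
  -- The rate is independent of the chart, so the arbitrary chart c' can be exchanged for one of the
  -- cover, where uniform bounds hold.
  rw [metricRate_eq g hX hc' hs]
  have h1 := localRep_lt_of_C1Norm_lt 𝒜 hη hc hx
  obtain ⟨h2, h3⟩ := hB c hc _ hx
  set z := extChartAt (𝓡 n) c x with hz
  have hzt : z ∈ (extChartAt (𝓡 n) c).target := mem_target hs
  have e2 : localRep (fun x => X x - X₀ x) c =ᶠ[𝓝 z] fun z => localRep X c z - localRep X₀ c z := by
    filter_upwards [(isOpen_extChartAt_target c).mem_nhds hzt] with z hz using localRep_sub X X₀ hz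
  have hd1 : DifferentiableAt ℝ (localRep X c) z :=
    (IsCk.contDiffAt_localRep (k := 1) (by simpa using hX) hs).differentiableAt (by simp)
  have hd2 : DifferentiableAt ℝ (localRep X₀ c) z :=
    (IsCk.contDiffAt_localRep (k := 1) (by simpa using hX₀) hs).differentiableAt (by simp)
  rw [e2.fderiv_eq, localRep_sub X X₀ hzt, fderiv_fun_sub hd1 hd2] at h1
  have hXz : ‖localRep X c z‖ ≤ B + 1 := by
    have := norm_sub_norm_le (localRep X c z) (localRep X₀ c z)
    linarith [norm_nonneg (fderiv ℝ (localRep X c) z - fderiv ℝ (localRep X₀ c) z)]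
  have hDXz : ‖fderiv ℝ (localRep X c) z‖ ≤ B + 1 := by
    have := norm_sub_norm_le (fderiv ℝ (localRep X c) z) (fderiv ℝ (localRep X₀ c) z)
    linarith [norm_nonneg (localRep X c z - localRep X₀ c z)]
  have hG : ∀ i j, |gramCoord g c z i j| ≤ D := fun i j =>
    ((norm_le_pi_norm (fun j => gramCoord g c z i j) j).trans (norm_le_pi_norm
      (fun i j => gramCoord g c z i j) i)).trans (hD c hc x hx)
  have hG' : ∀ i j, |gramRate g X c z i j| ≤ D' * (B + 1) := by
    intro i j
    have := ((norm_le_pi_norm (fun j => fderiv ℝ (fun z => gramCoord g c z i j) z) j).trans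
      (norm_le_pi_norm (fun i j => fderiv ℝ (fun z => gramCoord g c z i j) z) i)).trans
      (hD' c hc x hx)
    exact (ContinuousLinearMap.le_opNorm _ _).trans (mul_le_mul this hXz (norm_nonneg _)
      (by linarith))
  set w := coord c x v with hw
  have hwv := (hκ c hc x hx v).1
  have hwv2 : ‖w‖ ^ 2 ≤ κ ^ 2 * g.inner x v v := by
    rw [← vnorm_sq, ← mul_pow]
    exact pow_le_pow_left₀ (norm_nonneg _) hwv 2
  have hDw : ‖fderiv ℝ (localRep X c) z w‖ ≤ (B + 1) * ‖w‖ :=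
    (ContinuousLinearMap.le_opNorm _ _).trans (mul_le_mul_of_nonneg_right hDXz (norm_nonneg _))
  have b1 := abs_matForm_le hG' w w
  have b2 := abs_matForm_le hG (fderiv ℝ (localRep X c) z w) w
  have b3 := abs_matForm_le hG w (fderiv ℝ (localRep X c) z w)
  have hgn := inner_self_nonneg g v
  have c1 : |matForm (gramRate g X c z) w w| ≤
      (n : ℝ) ^ 2 * (D' * (B + 1)) * κ ^ 2 * g.inner x v v := by
    refine b1.trans ?_
    calc _ = (n : ℝ) ^ 2 * (D' * (B + 1)) * ‖w‖ ^ 2 := by ring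
      _ ≤ (n : ℝ) ^ 2 * (D' * (B + 1)) * (κ ^ 2 * g.inner x v v) := by gcongr
      _ = _ := by ring
  have c2 : |matForm (gramCoord g c z) (fderiv ℝ (localRep X c) z w) w| ≤
      (n : ℝ) ^ 2 * D * (B + 1) * κ ^ 2 * g.inner x v v := by
    refine b2.trans ?_
    calc _ ≤ (n : ℝ) ^ 2 * D * ((B + 1) * ‖w‖) * ‖w‖ := by gcongr
      _ = (n : ℝ) ^ 2 * D * (B + 1) * ‖w‖ ^ 2 := by ring
      _ ≤ (n : ℝ) ^ 2 * D * (B + 1) * (κ ^ 2 * g.inner x v v) := by gcongr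
      _ = _ := by ring
  have c3 : |matForm (gramCoord g c z) w (fderiv ℝ (localRep X c) z w)| ≤
      (n : ℝ) ^ 2 * D * (B + 1) * κ ^ 2 * g.inner x v v := by
    refine b3.trans ?_
    calc _ ≤ (n : ℝ) ^ 2 * D * ‖w‖ * ((B + 1) * ‖w‖) := by gcongr
      _ = (n : ℝ) ^ 2 * D * (B + 1) * ‖w‖ ^ 2 := by ring
      _ ≤ (n : ℝ) ^ 2 * D * (B + 1) * (κ ^ 2 * g.inner x v v) := by gcongr
      _ = _ := by ring
  have t1 := abs_add_le (matForm (gramRate g X c z) w w +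
    matForm (gramCoord g c z) (fderiv ℝ (localRep X c) z w) w)
    (matForm (gramCoord g c z) w (fderiv ℝ (localRep X c) z w))
  have t2 := abs_add_le (matForm (gramRate g X c z) w w)
    (matForm (gramCoord g c z) (fderiv ℝ (localRep X c) z w) w)
  have p1 : 0 ≤ (n : ℝ) ^ 2 * (D' * (B + 1)) * κ ^ 2 * g.inner x v v := (abs_nonneg _).trans c1
  have p2 : 0 ≤ (n : ℝ) ^ 2 * D * (B + 1) * κ ^ 2 * g.inner x v v := (abs_nonneg _).trans c2
  change |matForm (gramRate g X c z) w w +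
    matForm (gramCoord g c z) (fderiv ℝ (localRep X c) z w) w +
    matForm (gramCoord g c z) w (fderiv ℝ (localRep X c) z w)| ≤ _
  nlinarith

/-- A bound for the derivative of the metric along the flow. -/
def HasMetricRate (X : VField n M) (Λ : ℝ) : Prop :=
  ∀ (c x : M) (_ : x ∈ (chartAt (Model n) c).source) (v : TangentSpace (𝓡 n) x),
    |metricRate g X c (extChartAt (𝓡 n) c x) (coord c x v) (coord c x v)| ≤ 2 * Λ * g.inner x v v

theorem vnorm_dflow_le {X : VField n M} (hX : IsCk 1 X) {Λ : ℝ} (hΛ : HasMetricRate g X Λ)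
    (t : ℝ) (x : M) (v : TangentSpace (𝓡 n) x) :
    vnorm g (dflow X t x v) ≤ Real.exp (Λ * |t|) * vnorm g v := by
  let h : ℝ → ℝ := fun t => g.inner (flow X t x) (dflow X t x v) (dflow X t x v)
  let h' : ℝ → ℝ := fun t => metricRate g X (flow X t x) (extChartAt (𝓡 n) (flow X t x) (flow X t x))
    (coord (flow X t x) (flow X t x) (dflow X t x v))
    (coord (flow X t x) (flow X t x) (dflow X t x v))
  have hinner : ∀ {x y : M} (_ : x = y) {v w : Model n} (_ : v = w),
      g.inner x v v = g.inner y w w := by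
    rintro x _ rfl v _ rfl; rfl
  -- The derivative is known only at time 0; the group law transports it to any time, using the
  -- chart at the moving point.
  have hd : ∀ t, HasDerivAt h (h' t) t := by
    intro t
    have h1 := hasDerivAt_inner_dflow g hX (mem_chart_source (Model n) (flow X t x))
      (dflow X t x v) (dflow X t x v)
    have h2 : HasDerivAt (fun s => s - t) 1 t := (hasDerivAt_id t).sub_const t
    rw [← sub_self t] at h1
    have h3 := HasDerivAt.comp (h := fun s => s - t) t h1 h2
    rw [mul_one] at h3
    refine h3.congr_of_eventuallyEq (Eventually.of_forall fun s => ?_)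
    have e : s = s - t + t := by ring
    have e1 : flow X s x = flow X (s - t) (flow X t x) := by
      rw [← flow_add hX, ← e]
    exact hinner e1 ((dflow_congr X e rfl v).trans (dflow_add_apply hX (s - t) t x v))
  have hb := le_exp_of_abs_deriv_le hd (fun t => hΛ _ _ (mem_chart_source (Model n) _) _) t
  have h0 : h 0 = g.inner x v v := hinner (flow_zero hX x) (dflow_zero_apply hX x v)
  rw [h0] at hb
  refine Real.sqrt_le_iff.2 ⟨mul_nonneg (Real.exp_pos _).le (vnorm_nonneg g v), ?_⟩
  rw [mul_pow, vnorm_sq, ← Real.exp_nat_mul]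
  refine hb.trans (le_of_eq ?_)
  congr 2
  push_cast
  ring

theorem conorm_lift_le {X : VField n M} (hX : IsCk 1 X) {t q : ℝ} (hq : 0 ≤ q) (ξ : Cotangent n M)
    (h : ∀ v : TangentSpace (𝓡 n) (flow X t ξ.1),
      vnorm g (dflow X (-t) (flow X t ξ.1) v) ≤ q * vnorm g v) :
    conorm g (lift X t ξ) ≤ q * conorm g ξ := by
  refine conorm_le g (mul_nonneg hq (conorm_nonneg g ξ)) fun v => ?_
  have e := lift_apply hX t ξ v
  have e2 : vnorm g (x := ξ.1) (dflow X (-t) (flow X t ξ.1) v : Model n) ≤ q * vnorm g v :=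
    (vnorm_congr g (flow_neg_flow hX t ξ.1).symm _).trans_le (h v)
  have e3 := abs_apply_le g ξ (dflow X (-t) (flow X t ξ.1) v : Model n)
  refine (congrArg abs e).trans_le (e3.trans ?_)
  calc _ ≤ conorm g ξ * (q * vnorm g v) := mul_le_mul_of_nonneg_left e2 (conorm_nonneg g ξ)
    _ = _ := by ring

theorem HasMetricRate.hasGrowthRate {X : VField n M} (hX : IsCk 1 X) {Λ : ℝ}
    (hΛ : HasMetricRate g X Λ) : HasGrowthRate g X Λ := by
  intro t ξ
  refine conorm_lift_le g hX (Real.exp_pos _).le ξ fun v => ?_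
  have := vnorm_dflow_le g hX hΛ (-t) (flow X t ξ.1) v
  rwa [abs_neg] at this

/-- Growth bounds in both time directions pinch the norm at time t between 1 - Λ|t| and 1 + 2Λ|t|
times its initial value, for Λ|t| ≤ 1. A bound on the increments controls `deriv` whether or not the
norm is differentiable. -/
theorem abs_normRate_le {X : VField n M} (hX : IsCk 1 X) {Λ : ℝ} (h0 : 0 < Λ)
    (hΛ : HasGrowthRate g X Λ) {ξ : Cotangent n M} (hξ : ξ.2 ≠ 0) :
    |normRate g X ξ| ≤ 2 * Λ := by
  have hc := conorm_pos g hξ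
  rw [normRate, abs_div, abs_of_pos hc, div_le_iff₀ hc]
  refine norm_deriv_le_of_lip' (𝕜 := ℝ) (F := ℝ) (f := fun t => conorm g (lift X t ξ)) (x₀ := 0)
    (C := 2 * Λ * conorm g ξ) (by positivity) ?_
  filter_upwards [Ioo_mem_nhds (show -Λ⁻¹ < 0 by simpa) (show 0 < Λ⁻¹ by simpa)] with t ht
  have ht1 : |Λ * (|t|)| ≤ 1 := by
    rw [abs_of_nonneg (by positivity)]
    have : |t| < Λ⁻¹ := abs_lt.2 ht
    calc Λ * |t| ≤ Λ * Λ⁻¹ := by gcongr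
      _ = 1 := mul_inv_cancel₀ h0.ne'
  have h1 := (le_abs_self _).trans (Real.abs_exp_sub_one_le ht1)
  rw [abs_of_nonneg (by positivity : 0 ≤ Λ * |t|)] at h1
  rw [lift_zero hX, sub_zero, Real.norm_eq_abs, Real.norm_eq_abs, abs_le]
  have h2 := hΛ t ξ
  have h3 := hΛ (-t) (lift X t ξ)
  rw [← lift_add hX, neg_add_cancel, lift_zero hX, abs_neg] at h3
  have h4 : 1 - Λ * |t| ≤ Real.exp (-(Λ * |t|)) := by
    linarith [Real.add_one_le_exp (-(Λ * |t|))]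
  have h5 : Real.exp (-(Λ * |t|)) * conorm g ξ ≤ conorm g (lift X t ξ) := by
    rw [Real.exp_neg, inv_mul_le_iff₀ (Real.exp_pos _)]
    exact h3
  have h6 : 0 ≤ Λ * |t| * conorm g ξ := by positivity
  constructor <;> nlinarith

end Growth

/-! ### Jacobi's formula at the identity, and the divergence as a trace. -/

theorem differentiable_det {ι : Type*} [Fintype ι] [DecidableEq ι] :
    Differentiable ℝ (fun A : ι → ι → ℝ => Matrix.det (Matrix.of A)) := by
  simp only [Matrix.det_apply', Matrix.of_apply]
  fun_prop

/-- The derivative of the determinant at the identity is the trace. -/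
theorem hasDerivAt_det_of_eq_one {ι : Type*} [Fintype ι] [DecidableEq ι]
    {P : ℝ → Matrix ι ι ℝ} {H : Matrix ι ι ℝ} {t : ℝ} (h1 : P t = 1)
    (hP : ∀ i j, HasDerivAt (fun s => P s i j) (H i j) t) :
    HasDerivAt (fun s => (P s).det) H.trace t := by
  let d : (ι → ι → ℝ) → ℝ := fun A => Matrix.det (Matrix.of A)
  let e : ι → ι → ℝ := fun i j => (1 : Matrix ι ι ℝ) i j
  have hd : HasFDerivAt d (fderiv ℝ d e) e := (differentiable_det e).hasFDerivAt
  have hcurve : HasDerivAt (fun s => (fun i j => P s i j : ι → ι → ℝ)) (fun i j => H i j) t :=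
    hasDerivAt_pi.2 fun i => hasDerivAt_pi.2 fun j => hP i j
  have hline : HasDerivAt (fun s : ℝ => (fun i j => (1 + s • H) i j : ι → ι → ℝ))
      (fun i j => H i j) 0 := by
    refine hasDerivAt_pi.2 fun i => hasDerivAt_pi.2 fun j => ?_
    simpa using ((hasDerivAt_id (0 : ℝ)).mul_const (H i j)).const_add ((1 : Matrix ι ι ℝ) i j)
  have e1 : (fun i j => P t i j : ι → ι → ℝ) = e := by rw [h1]
  have e2 : (fun i j => (1 + (0 : ℝ) • H) i j : ι → ι → ℝ) = e := by simp [e]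
  have hc1 := HasFDerivAt.comp_hasDerivAt t (by rw [e1]; exact hd) hcurve
  have hc2 := HasFDerivAt.comp_hasDerivAt (0 : ℝ) (by rw [e2]; exact hd) hline
  have hpoly : HasDerivAt (d ∘ fun s : ℝ => (fun i j => (1 + s • H) i j : ι → ι → ℝ)) H.trace 0 := by
    let q : Polynomial ℝ :=
      (1 + (Polynomial.X : Polynomial ℝ) • H.map ⇑Polynomial.C : Matrix ι ι _).det.divX.divX
    have : (d ∘ fun s : ℝ => (fun i j => (1 + s • H) i j : ι → ι → ℝ)) = fun s =>
        1 + H.trace * s + Polynomial.eval s q * s ^ 2 := by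
      funext s
      exact Matrix.det_one_add_smul s H
    rw [this]
    have h3 := (((hasDerivAt_id (0 : ℝ)).const_mul H.trace).const_add 1).add
      ((q.hasDerivAt (0 : ℝ)).mul
        ((hasDerivAt_id (0 : ℝ)).pow 2))
    exact h3.congr_deriv (by simp)
  rw [hc2.unique hpoly] at hc1
  exact hc1

-- Writing G = yᵀ y with y invertible, the inverse of y works. Its columns are an orthonormal basis
-- for the form with matrix G.
open scoped MatrixOrder Matrix.Norms.L2Operator in
theorem Matrix.PosDef.exists_transpose_mul_mul_eq_one {ι : Type*} [Fintype ι] [DecidableEq ι]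
    {G : Matrix ι ι ℝ} (hG : G.PosDef) : ∃ S : Matrix ι ι ℝ, S.transpose * G * S = 1 := by
  obtain ⟨y, hy, rfl⟩ := CStarAlgebra.isStrictlyPositive_iff_eq_star_mul_self.mp
    hG.isStrictlyPositive
  refine ⟨y⁻¹, ?_⟩
  have hy' : IsUnit y.det := (Matrix.isUnit_iff_isUnit_det y).1 hy
  have hy'' : IsUnit y.transpose.det := by rwa [Matrix.det_transpose]
  have : star y = y.transpose := by
    rw [Matrix.star_eq_conjTranspose, Matrix.conjTranspose_eq_transpose_of_trivial]
  rw [this, Matrix.transpose_nonsing_inv, ← mul_assoc, Matrix.nonsing_inv_mul _ hy'', one_mul,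
    Matrix.mul_nonsing_inv _ hy']

section Divergence

variable {n : ℕ} {M : Type*} [TopologicalSpace M] [ChartedSpace (Model n) M]
  [IsManifold (𝓡 n) ∞ M] (g : Metric n M)

theorem matForm_eq_dotProduct (G : Matrix (Fin n) (Fin n) ℝ) (v w : Model n) :
    matForm G v w = v.ofLp ⬝ᵥ G.mulVec w.ofLp := by
  simp only [matForm, dotProduct, Matrix.mulVec, Finset.mul_sum]
  refine Finset.sum_congr rfl fun i _ => Finset.sum_congr rfl fun j _ => ?_
  ring

theorem matForm_transpose (G : Matrix (Fin n) (Fin n) ℝ) (v w : Model n) :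
    matForm G.transpose v w = matForm G w v := by
  simp only [matForm, Matrix.transpose_apply]
  rw [Finset.sum_comm]
  refine Finset.sum_congr rfl fun i _ => Finset.sum_congr rfl fun j _ => ?_
  ring

theorem posDef_gramCoord {c x : M} (hx : x ∈ (chartAt (Model n) c).source) :
    (gramCoord g c (extChartAt (𝓡 n) c x)).PosDef := by
  refine Matrix.PosDef.of_dotProduct_mulVec_pos ?_ fun w hw => ?_
  · ext i j
    simp only [Matrix.conjTranspose_apply, star_trivial, gramCoord, Matrix.of_apply]
    exact g.symm _ _ _
  · rw [star_trivial]
    have h1 : uncoord c x (WithLp.toLp 2 w) ≠ 0 := by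
      intro h
      have := coord_uncoord hx (WithLp.toLp 2 w)
      rw [h, map_zero] at this
      exact hw (congrArg WithLp.ofLp this.symm)
    have h2 := g.pos x _ h1
    rw [inner_eq_matForm g hx, coord_uncoord hx, matForm_eq_dotProduct] at h2
    exact h2

variable [CompactSpace M] [T2Space M]

/-- The divergence is half the trace of the derivative of the metric along the flow. -/
theorem divergence_eq {X : VField n M} (hX : IsCk 1 X) (x : M) :
    ∃ v : Fin n → TangentSpace (𝓡 n) x, (∀ k, g.inner x (v k) (v k) = 1) ∧
      divergence g X x = 2⁻¹ * ∑ k, metricRate g X x (extChartAt (𝓡 n) x x)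
        (coord x x (v k)) (coord x x (v k)) := by
  have hx := mem_chart_source (Model n) x
  set z := extChartAt (𝓡 n) x x with hz
  have hzt : z ∈ (extChartAt (𝓡 n) x).target := mem_target hx
  have hpd := posDef_gramCoord g hx
  rw [← hz] at hpd
  -- The columns of S are the coordinates of the orthonormal vectors of the statement. The sum of
  -- the rates on them is tr(Sᵀ G' S) + 2 tr DX, since S Sᵀ G = 1.
  obtain ⟨S, hS⟩ := Matrix.PosDef.exists_transpose_mul_mul_eq_one hpd
  set G := gramCoord g x z with hG
  let N : Matrix (Fin n) (Fin n) ℝ := Matrix.of fun i j =>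
    fderiv ℝ (localRep X x) z (EuclideanSpace.single j 1) i
  set G' := gramRate g X x z with hG'
  let w : Fin n → Model n := fun k => WithLp.toLp 2 fun i => S i k
  have hSG : S * (S.transpose * G) = 1 := mul_eq_one_comm.1 hS
  have hGt : G.transpose = G := by
    have := hpd.1
    rwa [Matrix.IsHermitian, Matrix.conjTranspose_eq_transpose_of_trivial] at this
  have hdX : DifferentiableAt ℝ (localRep X x) z :=
    (IsCk.contDiffAt_localRep (k := 1) (by simpa using hX) hx).differentiableAt (by simp)
  have hform : ∀ (H : Matrix (Fin n) (Fin n) ℝ) k, matForm H (w k) (w k) = (S.transpose * H * S) k k := by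
    intro H k
    simp only [matForm, Matrix.mul_apply, Matrix.transpose_apply, Finset.sum_mul, w]
    rw [Finset.sum_comm]
    refine Finset.sum_congr rfl fun i _ => Finset.sum_congr rfl fun j _ => ?_
    ring
  have hNw : ∀ u : Model n, (fderiv ℝ (localRep X x) z u).ofLp = N.mulVec u.ofLp := by
    intro u
    conv_lhs => rw [← (EuclideanSpace.basisFun (Fin n) ℝ).sum_repr u]
    ext i
    simp only [map_sum, map_smul, N, Matrix.mulVec, dotProduct, Matrix.of_apply]
    simp [mul_comm]
  have hform3 : ∀ k, matForm G (w k) (fderiv ℝ (localRep X x) z (w k)) =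
      (S.transpose * (G * N) * S) k k := by
    intro k
    rw [← hform, matForm_eq_dotProduct, matForm_eq_dotProduct, hNw, ← Matrix.mulVec_mulVec]
  have hform2 : ∀ k, matForm G (fderiv ℝ (localRep X x) z (w k)) (w k) =
      (S.transpose * (G * N) * S) k k := by
    intro k
    rw [← hform3, ← matForm_transpose, hGt]
  have htr1 : (S.transpose * (G * N) * S).trace = N.trace := by
    rw [Matrix.trace_mul_comm, ← mul_assoc, ← mul_assoc, mul_assoc S, hSG, one_mul]
  refine ⟨fun k => uncoord x x (w k), fun k => ?_, ?_⟩
  · rw [inner_eq_matForm g hx, coord_uncoord hx, ← hz, ← hG, hform, hS, Matrix.one_apply_eq]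
  have hsum : ∑ k, metricRate g X x z (coord x x (uncoord x x (w k)))
      (coord x x (uncoord x x (w k))) = (S.transpose * G' * S).trace + 2 * N.trace := by
    rw [← htr1, two_mul, Matrix.trace, Matrix.trace, ← add_assoc, ← Finset.sum_add_distrib,
      ← Finset.sum_add_distrib]
    refine Finset.sum_congr rfl fun k _ => ?_
    rw [coord_uncoord hx, metricRate, ← hG, ← hG', hform, hform2, hform3]
    rfl
  rw [hsum]
  let Y := localRep X x z
  have hline : HasDerivAt (fun t : ℝ => z + t • Y) Y 0 := by
    simpa using ((hasDerivAt_id (0 : ℝ)).smul_const Y).const_add z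
  have hdG : ∀ i j, HasDerivAt (fun t : ℝ => gramCoord g x (z + t • Y) i j) (G' i j) 0 := by
    intro i j
    have h1 : HasFDerivAt (fun z => gramCoord g x z i j)
        (fderiv ℝ (fun z => gramCoord g x z i j) z) (z + (0 : ℝ) • Y) := by
      rw [zero_smul, add_zero]
      exact ((contDiffAt_gramCoord g hx i j).differentiableAt (by simp)).hasFDerivAt
    exact h1.comp_hasDerivAt 0 hline
  -- Conjugation by S reduces the logarithmic derivative of det G along X to the derivative of a
  -- determinant at the identity. As the density is √det G, its logarithmic derivative is half that
  -- trace.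
  have hdet := hasDerivAt_det_of_eq_one (t := 0)
    (P := fun t => S.transpose * gramCoord g x (z + t • Y) * S) (H := S.transpose * G' * S)
    (by simpa using hS) (fun i j => by
      simp only [Matrix.mul_apply, Matrix.transpose_apply, Finset.sum_mul]
      exact HasDerivAt.fun_sum fun a _ => HasDerivAt.fun_sum fun b _ =>
        ((hdG b a).const_mul _).mul_const _)
  simp only [Matrix.det_mul, Matrix.det_transpose] at hdet
  have hdS : S.det * G.det * S.det = 1 := by
    rw [← Matrix.det_one (n := Fin n) (R := ℝ), ← hS]
    simp only [Matrix.det_mul, Matrix.det_transpose]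
  have hGpos : 0 < G.det := hpd.det_pos
  have hS0 : S.det ≠ 0 := by rintro h; rw [h] at hdS; simp at hdS
  set τ := (S.transpose * G' * S).trace with hτ
  have hdetG : HasDerivAt (fun t : ℝ => (gramCoord g x (z + t • Y)).det) (G.det * τ) 0 := by
    have h1 := hdet.mul_const ((S.det * S.det)⁻¹)
    have e : (fun t : ℝ => S.det * (gramCoord g x (z + t • Y)).det * S.det * (S.det * S.det)⁻¹) =
        fun t : ℝ => (gramCoord g x (z + t • Y)).det := by
      funext t; field_simp
    rw [e] at h1
    refine h1.congr_deriv ?_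
    have : (S.det * S.det)⁻¹ = G.det := by
      rw [inv_eq_iff_eq_inv, ← one_div, eq_div_iff hGpos.ne']; linarith
    rw [this, mul_comm]
  have hev : volDensity g x =ᶠ[𝓝 z] fun z => √(gramCoord g x z).det := by
    filter_upwards [(isOpen_extChartAt_target x).mem_nhds hzt] with y hy using volDensity_eq g hy
  have hρd : DifferentiableAt ℝ (volDensity g x) z := by
    refine DifferentiableAt.congr_of_eventuallyEq ?_ hev
    refine DifferentiableAt.sqrt ?_ (by rw [← hG]; exact hGpos.ne')
    have : DifferentiableAt ℝ (fun z => (fun i j => gramCoord g x z i j : Fin n → Fin n → ℝ)) z :=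
      differentiableAt_pi.2 fun i => differentiableAt_pi.2 fun j =>
        (contDiffAt_gramCoord g hx i j).differentiableAt (by simp)
    exact DifferentiableAt.comp z (g := fun A : Fin n → Fin n → ℝ => Matrix.det (Matrix.of A))
      (differentiable_det _) this
  have hρz : volDensity g x z = √G.det := hev.self_of_nhds
  have hρpos : 0 < √G.det := Real.sqrt_pos.2 hGpos
  have hDρ : fderiv ℝ (volDensity g x) z Y = √G.det * τ / 2 := by
    have h1 : HasDerivAt (fun t : ℝ => volDensity g x (z + t • Y))
        (fderiv ℝ (volDensity g x) z Y) 0 :=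
      HasFDerivAt.comp_hasDerivAt (l := volDensity g x) (f := fun t : ℝ => z + t • Y) (0 : ℝ)
        (by rw [zero_smul, add_zero]; exact hρd.hasFDerivAt) hline
    have h2 := hdetG.sqrt (by simpa using hGpos.ne')
    have h3 : (fun t : ℝ => volDensity g x (z + t • Y)) =ᶠ[𝓝 0]
        fun t => √(gramCoord g x (z + t • Y)).det := by
      have : Tendsto (fun t : ℝ => z + t • Y) (𝓝 0) (𝓝 z) := by
        simpa using hline.continuousAt.tendsto
      exact this.eventually hev
    rw [h1.unique (h2.congr_of_eventuallyEq h3)]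
    simp only [zero_smul, add_zero, ← hG]
    rw [div_eq_div_iff (by positivity) two_ne_zero]
    linear_combination (-2 * τ) * Real.mul_self_sqrt hGpos.le
  have hterm : ∀ i : Fin n, fderiv ℝ (fun z => volDensity g x z * localRep X x z i) z
      (EuclideanSpace.single i 1) = √G.det * N i i +
        Y i * fderiv ℝ (volDensity g x) z (EuclideanSpace.single i 1) := by
    intro i
    have h1 : HasFDerivAt (fun z => localRep X x z i)
        ((EuclideanSpace.proj i : Model n →L[ℝ] ℝ).comp (fderiv ℝ (localRep X x) z)) z :=
      (EuclideanSpace.proj i : Model n →L[ℝ] ℝ).hasFDerivAt.comp z hdX.hasFDerivAt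
    rw [(hρd.hasFDerivAt.fun_mul h1).fderiv, hρz]
    simp [N, Y]
  rw [divergence, ← hz, Finset.sum_congr rfl fun i _ => hterm i, Finset.sum_add_distrib,
    ← Finset.mul_sum, hρz]
  have hY : ∑ i, Y i * fderiv ℝ (volDensity g x) z (EuclideanSpace.single i 1) =
      fderiv ℝ (volDensity g x) z Y := by
    conv_rhs => rw [← (EuclideanSpace.basisFun (Fin n) ℝ).sum_repr Y]
    simp [map_sum]
  rw [hY, hDρ]
  have : ∑ i, N i i = N.trace := rfl
  rw [this]
  field_simp
  ring

theorem abs_divergence_le {X : VField n M} (hX : IsCk 1 X) {Λ : ℝ} (hΛ : HasMetricRate g X Λ)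
    (x : M) : |divergence g X x| ≤ n * Λ := by
  obtain ⟨v, hv, e⟩ := divergence_eq g hX x
  rw [e, abs_mul, abs_of_pos (by norm_num : (0 : ℝ) < 2⁻¹)]
  have h1 : |∑ k, metricRate g X x (extChartAt (𝓡 n) x x) (coord x x (v k)) (coord x x (v k))| ≤
      ∑ _k : Fin n, 2 * Λ := by
    refine (Finset.abs_sum_le_sum_abs _ _).trans (Finset.sum_le_sum fun k _ => ?_)
    have := hΛ x x (mem_chart_source (Model n) x) (v k)
    rwa [hv k, mul_one] at this
  simp only [Finset.sum_const, Finset.card_univ, Fintype.card_fin, nsmul_eq_mul] at h1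
  linarith

end Divergence

/-! ### Functions of one real variable satisfying the trichotomy: convexity at the scale of a
window. -/

section Scalar

/-- `L` grows linearly after the time `t`, up to an error `e`. -/
def GrowsFrom (β e : ℝ) (L : ℝ → ℝ) (t : ℝ) : Prop :=
  ∀ t' t'', t ≤ t' → t' ≤ t'' → L t' + β * (t'' - t') - e ≤ L t''

/-- At each time `L` grows linearly in the future, or in the past, or is almost minimal. -/
def Trichotomy (β e : ℝ) (L : ℝ → ℝ) : Prop :=
  ∀ t, GrowsFrom β e L t ∨ GrowsFrom β e (fun s => L (-s)) (-t) ∨ ∀ r, L t - e ≤ L r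

theorem Trichotomy.neg {β e : ℝ} {L : ℝ → ℝ} (h : Trichotomy β e L) :
    Trichotomy β e (fun s => L (-s)) := by
  intro t
  rcases h (-t) with h | h | h
  · exact Or.inr (Or.inl (by simpa using h))
  · exact Or.inl (by simpa using h)
  · exact Or.inr (Or.inr fun r => h (-r))

/-- The odd average of `L` over the times `± (i + 1) Δ`, `i < J`. -/
def oddMean (L : ℝ → ℝ) (J : ℕ) (Δ : ℝ) : ℝ :=
  (J : ℝ)⁻¹ * ∑ i ∈ Finset.range J, (L ((i + 1) * Δ) - L (-((i + 1) * Δ)))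

theorem oddMean_neg (L : ℝ → ℝ) (J : ℕ) (Δ : ℝ) :
    oddMean (fun s => L (-s)) J Δ = -oddMean L J Δ := by
  simp only [oddMean, neg_neg, ← mul_neg, ← Finset.sum_neg_distrib, neg_sub]

variable {β e Δ : ℝ} {L : ℝ → ℝ} {J : ℕ}

theorem exists_le_of_le_mean {f : ℕ → ℝ} {c : ℝ} (hJ : 0 < J)
    (h : c ≤ (J : ℝ)⁻¹ * ∑ i ∈ Finset.range J, f i) : ∃ i < J, c ≤ f i := by
  have hJ' : (0 : ℝ) < J := by exact_mod_cast hJ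
  have h1 : ∑ _i ∈ Finset.range J, c ≤ ∑ i ∈ Finset.range J, f i := by
    rw [Finset.sum_const, Finset.card_range, nsmul_eq_mul]
    rwa [inv_mul_eq_div, le_div_iff₀ hJ', mul_comm] at h
  obtain ⟨i, hi, h2⟩ := Finset.exists_le_of_sum_le (Finset.nonempty_range_iff.2 hJ.ne') h1
  exact ⟨i, Finset.mem_range.1 hi, h2⟩

theorem sum_range_add_one_mul (J : ℕ) (Δ : ℝ) :
    ∑ i ∈ Finset.range J, ((i : ℝ) + 1) * Δ = J * (J + 1) / 2 * Δ := by
  rw [← Finset.sum_mul]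
  congr 1
  induction J with
  | zero => simp
  | succ J ih => rw [Finset.sum_range_succ, ih]; push_cast; ring

theorem time_mem (hΔ : 0 ≤ Δ) {i : ℕ} (hi : i < J) :
    0 ≤ ((i : ℝ) + 1) * Δ ∧ ((i : ℝ) + 1) * Δ ≤ J * Δ := by
  have : ((i : ℝ) + 1) ≤ J := by exact_mod_cast hi
  exact ⟨by positivity, by gcongr⟩

/-- Growth in the past from t, or almost minimality at t, would each give L t - e ≤ L s. -/
theorem growsFrom_of_lt (hβ : 0 < β) (hT : Trichotomy β e L) {s t : ℝ} (hst : s ≤ t)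
    (h : L s + e < L t) : GrowsFrom β e L t := by
  rcases hT t with h1 | h1 | h1
  · exact h1
  · have := h1 (-t) (-s) le_rfl (by linarith)
    simp only [neg_neg] at this
    have h2 : 0 ≤ β * (-s - -t) := mul_nonneg hβ.le (by linarith)
    linarith
  · linarith [h1 s]

/-- If the odd mean is large, then `L` grows in the future. -/
theorem growsFrom_of_le_oddMean (hβ : 0 < β) (he : 0 ≤ e) (hΔ : 0 ≤ Δ) (hJ : 0 < J)
    (hT : Trichotomy β e L) (h : 3 * e + 1 ≤ oddMean L J Δ) :
    ∃ τ, 0 ≤ τ ∧ τ ≤ J * Δ ∧ GrowsFrom β e L τ ∧ L (-τ) + (3 * e + 1) ≤ L τ := by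
  obtain ⟨i, hi, h1⟩ := exists_le_of_le_mean hJ h
  obtain ⟨h2, h3⟩ := time_mem hΔ hi
  exact ⟨_, h2, h3, growsFrom_of_lt hβ hT (s := -(((i : ℝ) + 1) * Δ)) (by linarith)
    (by linarith), by linarith⟩

/-- Convexity of `L` at the time `0` when `L` grows in the future and the odd mean is not large. -/
theorem one_le_of_growsFrom_zero (hβ : 0 < β) (he : 0 ≤ e) (hΔ : 0 ≤ Δ) (hJ : 0 < J)
    (hS : 14 * e + 6 ≤ β * (J * Δ)) (hT : Trichotomy β e L) (h0 : GrowsFrom β e L 0)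
    (h : oddMean L J Δ ≤ 3 * e + 2) : 1 ≤ L (J * Δ) - 2 * L 0 + L (-(J * Δ)) := by
  have hJ' : (0 : ℝ) < J := by exact_mod_cast hJ
  have hJΔ : 0 ≤ (J : ℝ) * Δ := by positivity
  have h1 : ∀ i ∈ Finset.range J, L 0 + β * ((i + 1) * Δ) - e - L (-((i + 1) * Δ)) ≤
      L ((i + 1) * Δ) - L (-((i + 1) * Δ)) := by
    intro i hi
    have := h0 0 _ le_rfl (time_mem hΔ (Finset.mem_range.1 hi)).1
    rw [sub_zero] at this
    linarith
  -- Growth from 0 makes the average of L over the positive times at least L 0 + β J Δ / 2 - e. As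
  -- the odd mean is at most 3 e + 2, the average over the negative times is large too, so L has
  -- already climbed at some negative time, and from there it grows in the past.
  have h2 : L 0 + β * (J * Δ) / 2 - e - (3 * e + 2) ≤
      (J : ℝ)⁻¹ * ∑ i ∈ Finset.range J, L (-((i + 1) * Δ)) := by
    have h3 := Finset.sum_le_sum h1
    rw [Finset.sum_sub_distrib, Finset.sum_sub_distrib, Finset.sum_add_distrib, ← Finset.mul_sum,
      sum_range_add_one_mul] at h3
    simp only [Finset.sum_const, Finset.card_range, nsmul_eq_mul] at h3
    rw [oddMean, inv_mul_eq_div, div_le_iff₀ hJ'] at h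
    rw [inv_mul_eq_div, le_div_iff₀ hJ']
    have h4 : 0 ≤ β * (J * Δ) / 2 := by positivity
    nlinarith
  obtain ⟨i, hi, h3⟩ := exists_le_of_le_mean hJ h2
  obtain ⟨h4, h5⟩ := time_mem hΔ hi
  set τ := ((i : ℝ) + 1) * Δ
  have h6 : GrowsFrom β e (fun s => L (-s)) τ :=
    growsFrom_of_lt hβ hT.neg (s := 0) h4 (by simp only [neg_zero]; linarith)
  have h7 := h6 τ (J * Δ) le_rfl h5
  have h8 := h0 0 (J * Δ) le_rfl hJΔ
  have h9 : 0 ≤ β * (J * Δ - τ) := mul_nonneg hβ.le (by linarith)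
  simp only at h7
  linarith

/-- Convexity of `L` at the time `0` when the odd mean is in a suitable interval. -/
theorem one_le_of_oddMean_mem (hβ : 0 < β) (he : 0 ≤ e) (hΔ : 0 ≤ Δ) (hJ : 0 < J)
    (hS : 14 * e + 6 ≤ β * (J * Δ)) (hT : Trichotomy β e L) (h1 : 3 * e + 1 ≤ oddMean L J Δ)
    (h2 : oddMean L J Δ ≤ 3 * e + 2) : 1 ≤ L (J * Δ) - 2 * L 0 + L (-(J * Δ)) := by
  obtain ⟨τ, hτ0, hτS, hg, hL⟩ := growsFrom_of_le_oddMean hβ he hΔ hJ hT h1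
  have h3 := hg τ (J * Δ) le_rfl hτS
  have h4 : 0 ≤ β * (J * Δ - τ) := mul_nonneg hβ.le (by linarith)
  have h5 : 0 ≤ β * τ := by positivity
  rcases hT 0 with h0 | h0 | h0
  · exact one_le_of_growsFrom_zero hβ he hΔ hJ hS hT h0 h2
  · have a1 := h0 0 τ (by simp) hτ0
    have a2 := h0 0 (J * Δ) (by simp) (by linarith)
    simp only [neg_zero, sub_zero] at a1 a2
    linarith
  -- The threshold 3 e + 1 is exactly used here: one e is lost by the growth after τ, one in
  -- comparing L 0 with L (-τ), one in comparing L 0 with L (-(J Δ)), and 1 remains.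
  · linarith [h0 (-τ), h0 (-(J * Δ))]

/-- One of the terms U, S, N is at least w / (3 K) at time t. If it is U, then U expands while S
decays and N is constant, so U keeps controlling w at all later times and w grows like U. The case
of S is the same in reversed time. If it is N, constancy of N bounds w t by a multiple of w at every
other time. -/
theorem trichotomy_of_bounds {U S w : ℝ → ℝ} {N K : ℝ} (hK : 1 ≤ K) (hβ : 0 < β)
    (hw : ∀ t, 0 < w t) (hU0 : ∀ t, 0 ≤ U t) (hS0 : ∀ t, 0 ≤ S t)
    (hwK : ∀ t, w t ≤ K * (U t + S t + N)) (hUw : ∀ t, U t ≤ K * w t) (hSw : ∀ t, S t ≤ K * w t)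
    (hNw : ∀ t, N ≤ K * w t)
    (hU : ∀ t t', t ≤ t' → U t ≤ K * Real.exp (-β * (t' - t)) * U t')
    (hS : ∀ t t', t ≤ t' → S t' ≤ K * Real.exp (-β * (t' - t)) * S t) :
    ∀ t, GrowsFrom β (Real.log (7 * K ^ 7)) (fun t => Real.log (w t)) t ∨
      GrowsFrom β (Real.log (7 * K ^ 7)) (fun t => Real.log (w (-t))) (-t) ∨
      ((∀ r, Real.log (w t) - Real.log (7 * K ^ 7) ≤ Real.log (w r)) ∧ w t ≤ 3 * K * N) := by
  have hK0 : 0 < K := by linarith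
  have key : ∀ (U S w : ℝ → ℝ), (∀ t, 0 < w t) → (∀ t, 0 ≤ U t) → (∀ t, 0 ≤ S t) →
      (∀ t, w t ≤ K * (U t + S t + N)) → (∀ t, U t ≤ K * w t) → (∀ t, S t ≤ K * w t) →
      (∀ t, N ≤ K * w t) →
      (∀ t t', t ≤ t' → U t ≤ K * Real.exp (-β * (t' - t)) * U t') →
      (∀ t t', t ≤ t' → S t' ≤ K * Real.exp (-β * (t' - t)) * S t) →
      ∀ t, w t ≤ 3 * K * U t → GrowsFrom β (Real.log (7 * K ^ 7)) (fun t => Real.log (w t)) t := by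
    intro U S w hw hU0 hS0 hwK hUw hSw hNw hU hS t ht t' t'' h1 h2
    have hexp : Real.exp (-β * (t' - t)) ≤ 1 := by
      rw [Real.exp_le_one_iff]
      nlinarith
    have a1 : U t ≤ K * U t' := by
      refine (hU t t' h1).trans ?_
      have := hU0 t'
      calc _ ≤ K * 1 * U t' := by gcongr
        _ = _ := by ring
    have a2 : S t' ≤ K * S t := by
      refine (hS t t' h1).trans ?_
      have := hS0 t
      calc _ ≤ K * 1 * S t := by gcongr
        _ = _ := by ring
    have a3 : w t ≤ 3 * K ^ 2 * U t' := by
      calc w t ≤ 3 * K * U t := ht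
        _ ≤ 3 * K * (K * U t') := by gcongr
        _ = _ := by ring
    have a4 : S t' ≤ 3 * K ^ 4 * U t' := by
      calc S t' ≤ K * (K * w t) := a2.trans (by gcongr; exact hSw t)
        _ ≤ K * (K * (3 * K ^ 2 * U t')) := by gcongr
        _ = _ := by ring
    have a5 : N ≤ 3 * K ^ 4 * U t' := by
      calc N ≤ K * w t := hNw t
        _ ≤ K * (3 * K ^ 2 * U t') := by gcongr
        _ = 3 * K ^ 3 * U t' := by ring
        _ ≤ 3 * K ^ 4 * U t' := by
          have := hU0 t'
          have : K ^ 3 ≤ K ^ 4 := pow_le_pow_right₀ hK (by norm_num)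
          gcongr
    -- The 7 is 1 + 3 + 3, from the shares of U, S and N. Two more factors K come from the expansion
    -- of U and from U ≤ K w, whence 7 K ^ 7.
    have a6 : w t' ≤ 7 * K ^ 5 * U t' := by
      have h7 : U t' ≤ K ^ 4 * U t' := le_mul_of_one_le_left (hU0 t') (one_le_pow₀ hK)
      calc w t' ≤ K * (U t' + S t' + N) := hwK t'
        _ ≤ K * (K ^ 4 * U t' + 3 * K ^ 4 * U t' + 3 * K ^ 4 * U t') := by gcongr
        _ = _ := by ring
    have a7 : w t' ≤ 7 * K ^ 7 * Real.exp (-β * (t'' - t')) * w t'' := by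
      calc w t' ≤ 7 * K ^ 5 * (K * Real.exp (-β * (t'' - t')) * (K * w t'')) := by
            refine a6.trans ?_
            gcongr
            refine (hU t' t'' h2).trans ?_
            gcongr
            exact hUw t''
        _ = _ := by ring
    have a8 := Real.log_le_log (hw t') a7
    rw [Real.log_mul (by positivity) (hw t'').ne', Real.log_mul (by positivity) (Real.exp_pos _).ne',
      Real.log_exp] at a8
    change Real.log (w t') + β * (t'' - t') - Real.log (7 * K ^ 7) ≤ Real.log (w t'')
    linarith
  intro t
  by_cases c1 : w t ≤ 3 * K * U t
  · exact Or.inl (key U S w hw hU0 hS0 hwK hUw hSw hNw hU hS t c1)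
  by_cases c2 : w t ≤ 3 * K * S t
  · refine Or.inr (Or.inl (key (fun t => S (-t)) (fun t => U (-t)) (fun t => w (-t))
      (fun t => hw _) (fun t => hS0 _) (fun t => hU0 _) (fun t => ?_) (fun t => hSw _)
      (fun t => hUw _) (fun t => hNw _) (fun t t' h => ?_) (fun t t' h => ?_) (-t) (by simpa using c2)))
    · linarith [hwK (-t)]
    · have := hS (-t') (-t) (by linarith)
      rwa [show -t - -t' = t' - t by ring] at this
    · have := hU (-t') (-t) (by linarith)
      rwa [show -t - -t' = t' - t by ring] at this
  · have c3 : w t ≤ 3 * K * N := by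
      push Not at c1 c2
      have := hwK t
      nlinarith
    refine Or.inr (Or.inr ⟨fun r => ?_, c3⟩)
    have h1 : w t ≤ 7 * K ^ 7 * w r := by
      have h2 : K ^ 2 ≤ K ^ 7 := pow_le_pow_right₀ hK (by norm_num)
      have h3 := (hw r).le
      calc w t ≤ 3 * K * (K * w r) := c3.trans (by gcongr; exact hNw r)
        _ = 3 * K ^ 2 * w r := by ring
        _ ≤ 7 * K ^ 7 * w r := by gcongr; norm_num
    have h4 := Real.log_le_log (hw t) h1
    rw [Real.log_mul (by positivity) (hw r).ne'] at h4
    linarith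

end Scalar

/-! ### Restriction of covectors to the Anosov splitting. -/

section Splitting

variable {n : ℕ} {M : Type*} [TopologicalSpace M] [ChartedSpace (Model n) M]
  [IsManifold (𝓡 n) ∞ M] (g : Metric n M)

/-- The norm of the restriction of a covector to a field of subspaces. -/
def subnorm (E : (x : M) → Submodule ℝ (TangentSpace (𝓡 n) x)) (ξ : Cotangent n M) : ℝ :=
  ⨆ v : {v : TangentSpace (𝓡 n) ξ.1 // v ∈ E ξ.1 ∧ vnorm g v ≤ 1}, |(ξ.2 v.1 : ℝ)|

variable {E : (x : M) → Submodule ℝ (TangentSpace (𝓡 n) x)}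

theorem bddAbove_subnorm (ξ : Cotangent n M) : BddAbove (range fun v :
    {v : TangentSpace (𝓡 n) ξ.1 // v ∈ E ξ.1 ∧ vnorm g v ≤ 1} => |(ξ.2 v.1 : ℝ)|) := by
  obtain ⟨B, hB⟩ := bddAbove_conorm g ξ
  refine ⟨B, ?_⟩
  rintro _ ⟨v, rfl⟩
  exact hB ⟨⟨v.1, v.2.2⟩, rfl⟩

theorem subnorm_nonneg (ξ : Cotangent n M) : 0 ≤ subnorm g E ξ :=
  Real.iSup_nonneg fun _ => abs_nonneg _

theorem abs_apply_le_subnorm (ξ : Cotangent n M) {v : TangentSpace (𝓡 n) ξ.1} (hv : v ∈ E ξ.1) :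
    |(ξ.2 v : ℝ)| ≤ subnorm g E ξ * vnorm g v := by
  by_cases h0 : v = 0
  · simp [h0, vnorm_zero]
  have h := vnorm_pos g h0
  have h1 : vnorm g ((vnorm g v)⁻¹ • v) ≤ 1 := by
    rw [vnorm_smul, abs_of_pos (inv_pos.2 h), inv_mul_cancel₀ h.ne']
  have h2 : |(ξ.2 ((vnorm g v)⁻¹ • v) : ℝ)| ≤ subnorm g E ξ := le_ciSup (bddAbove_subnorm g ξ)
    (⟨_, Submodule.smul_mem _ _ hv, h1⟩ :
      {v : TangentSpace (𝓡 n) ξ.1 // v ∈ E ξ.1 ∧ vnorm g v ≤ 1})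
  rw [map_smul, smul_eq_mul, abs_mul, abs_of_pos (inv_pos.2 h), inv_mul_eq_div, div_le_iff₀ h] at h2
  exact h2

theorem subnorm_le {ξ : Cotangent n M} {a : ℝ} (ha : 0 ≤ a)
    (h : ∀ v ∈ E ξ.1, |(ξ.2 v : ℝ)| ≤ a * vnorm g v) : subnorm g E ξ ≤ a := by
  have : Nonempty {v : TangentSpace (𝓡 n) ξ.1 // v ∈ E ξ.1 ∧ vnorm g v ≤ 1} :=
    ⟨⟨0, Submodule.zero_mem _, by rw [vnorm_zero]; exact zero_le_one⟩⟩
  refine ciSup_le fun v => (h v.1 v.2.1).trans ?_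
  have := v.2.2
  nlinarith

theorem subnorm_le_conorm (ξ : Cotangent n M) : subnorm g E ξ ≤ conorm g ξ :=
  subnorm_le g (conorm_nonneg g ξ) fun v _ => abs_apply_le g ξ v

variable [CompactSpace M] [T2Space M]

theorem lift_apply_dflow {X : VField n M} (hX : IsCk 1 X) (t : ℝ) (ξ : Cotangent n M)
    (v : TangentSpace (𝓡 n) ξ.1) : ((lift X t ξ).2 (dflow X t ξ.1 v) : ℝ) = ξ.2 v :=
  (lift_apply hX t ξ _).trans
    (congrArg (fun w : Model n => (ξ.2 w : ℝ)) (dflow_neg_dflow hX t ξ.1 v))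

/-- Duality: the lifted covector takes on dφ_t v the value of ξ on v, so contraction of vectors of E
means expansion of the restriction to E. -/
theorem subnorm_le_lift {X : VField n M} (hX : IsCk 1 X) {t q : ℝ} (hq : 0 ≤ q) (ξ : Cotangent n M)
    (hE : ∀ v ∈ E ξ.1, dflow X t ξ.1 v ∈ E (flow X t ξ.1))
    (h : ∀ v ∈ E ξ.1, vnorm g (dflow X t ξ.1 v) ≤ q * vnorm g v) :
    subnorm g E ξ ≤ q * subnorm g E (lift X t ξ) := by
  refine subnorm_le g (mul_nonneg hq (subnorm_nonneg g _)) fun v hv => ?_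
  have h1 : |((lift X t ξ).2 (dflow X t ξ.1 v) : ℝ)| ≤
      subnorm g E (lift X t ξ) * vnorm g (dflow X t ξ.1 v) :=
    abs_apply_le_subnorm g (lift X t ξ) (hE v hv)
  rw [lift_apply_dflow hX] at h1
  refine h1.trans ?_
  calc _ ≤ subnorm g E (lift X t ξ) * (q * vnorm g v) :=
        mul_le_mul_of_nonneg_left (h v hv) (subnorm_nonneg g _)
    _ = _ := by ring

theorem exists_vnorm_field_bounds [Nonempty M] {X : VField n M} (hX : IsCk ∞ X)
    (h0 : ∀ x, X x ≠ 0) : ∃ a b, 0 < a ∧ ∀ x, a ≤ vnorm g (X x) ∧ vnorm g (X x) ≤ b := by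
  have hc : Continuous fun x => vnorm g (X x) := by
    have : Continuous fun x => g.inner x (X x) (X x) :=
      continuous_iff_continuousAt.2 fun x => (contMDiffAt_inner g (hX x) (hX x)).continuousAt
    exact this.sqrt
  obtain ⟨x, -, hx⟩ := isCompact_univ.exists_isMinOn univ_nonempty hc.continuousOn
  obtain ⟨y, -, hy⟩ := isCompact_univ.exists_isMaxOn univ_nonempty hc.continuousOn
  exact ⟨_, _, vnorm_pos g (h0 x), fun z => ⟨hx (mem_univ z), hy (mem_univ z)⟩⟩

/-- The components of a vector in an Anosov splitting are bounded. -/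
theorem IsAnosov.exists_splitting_bound [Nonempty M] {X : VField n M} (hX : IsCk ∞ X)
    {Eu Es : (x : M) → Submodule ℝ (TangentSpace (𝓡 n) x)} {C β Λ : ℝ}
    (hA : IsAnosov g X Eu Es C β) (hΛ : HasMetricRate g X Λ) :
    ∃ K, 1 ≤ K ∧ ∀ (x : M) (v : TangentSpace (𝓡 n) x), ∃ (a : ℝ) (u s : TangentSpace (𝓡 n) x),
      u ∈ Eu x ∧ s ∈ Es x ∧ v = a • X x + u + s ∧ |a| ≤ K * vnorm g v ∧
      vnorm g u ≤ K * vnorm g v ∧ vnorm g s ≤ K * vnorm g v := by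
  have hX1 : IsCk 1 X := hX.of_le (by norm_cast)
  obtain ⟨m, b, hm, hmb⟩ := exists_vnorm_field_bounds g hX hA.ne_zero
  obtain ⟨x₀⟩ := (inferInstance : Nonempty M)
  have hb : 0 < b := hm.trans_le ((hmb x₀).1.trans (hmb x₀).2)
  set ρ := b / m with hρ
  have hρ0 : 0 < ρ := by positivity
  have hC := hA.C_pos
  -- No continuity of the splitting is assumed, so its angles are bounded dynamically. The time t is
  -- taken so long that the contraction factor q absorbs all the cross terms below.
  obtain ⟨t, ht0, htq⟩ : ∃ t, 0 ≤ t ∧ C * Real.exp (-β * t) < min 1 (2 * (2 * ρ + 1))⁻¹ := by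
    have h1 : Tendsto (fun t => C * Real.exp (-β * t)) atTop (𝓝 (C * 0)) := by
      refine (Real.tendsto_exp_atBot.comp ?_).const_mul C
      exact tendsto_id.const_mul_atTop_of_neg (neg_lt_zero.2 hA.beta_pos)
    rw [mul_zero] at h1
    have h2 : 0 < min 1 (2 * (2 * ρ + 1))⁻¹ := by positivity
    obtain ⟨t, h3, h4⟩ := ((h1.eventually (gt_mem_nhds h2)).and (eventually_ge_atTop 0)).exists
    exact ⟨t, h4, h3⟩
  set q := C * Real.exp (-β * t) with hq
  have hq0 : 0 < q := by positivity
  have hq1 : q ≤ 1 := htq.le.trans (min_le_left _ _)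
  have hq2 : q * (2 * ρ + 1) ≤ 1 / 2 := by
    have h1 := htq.le.trans (min_le_right _ _)
    rw [le_inv_comm₀ hq0 (by positivity), ← one_div, le_div_iff₀ hq0] at h1
    linarith
  set E := Real.exp (Λ * t) with hE
  have hE0 : 0 < E := Real.exp_pos _
  refine ⟨1 + 4 * E + 4 * ρ + m⁻¹ * (1 + 4 * E + 4 * ρ), ?_, fun x v => ?_⟩
  · have : 0 < m⁻¹ * (1 + 4 * E + 4 * ρ) := by positivity
    linarith
  obtain ⟨y, hy, s, hs, hys⟩ := Submodule.mem_sup.1 ((hA.spanning x).symm ▸ Submodule.mem_top :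
    v ∈ Submodule.span ℝ {X x} ⊔ Eu x ⊔ Es x)
  obtain ⟨z, hz, u, hu, hzu⟩ := Submodule.mem_sup.1 hy
  obtain ⟨a, rfl⟩ := Submodule.mem_span_singleton.1 hz
  have hv : v = a • X x + u + s := by rw [hzu, hys]
  have hflowX : ∀ r, vnorm g (dflow X r x (X x)) ≤ b := by
    intro r
    have e : vnorm g (dflow X r x (X x)) = vnorm g (X (flow X r x)) :=
      congrArg (fun w : Model n => vnorm g (x := flow X r x) w) (dflow_field hX1 r x)
    exact e.trans_le (hmb _).2
  have hEr : ∀ r, |r| = t → vnorm g (dflow X r x v) ≤ E * vnorm g v := by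
    intro r hr
    have := vnorm_dflow_le g hX1 hΛ r x v
    rwa [hr] at this
  have hback : ∀ r (w : TangentSpace (𝓡 n) x), vnorm g w =
      vnorm g (dflow X (-r) (flow X r x) (dflow X r x w)) := by
    intro r w
    have h1 : vnorm g w = vnorm g (x := x) (dflow X (-r) (flow X r x) (dflow X r x w) : Model n) :=
      congrArg (fun w : Model n => vnorm g (x := x) w) (dflow_neg_dflow hX1 r x w).symm
    exact h1.trans (vnorm_congr g (flow_neg_flow hX1 r x).symm _)
  have hsplit : ∀ r, |r| = t → ∀ u s : TangentSpace (𝓡 n) x, v = a • X x + u + s →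
      vnorm g (dflow X r x u) ≤ E * vnorm g v + |a| * b + vnorm g (dflow X r x s) := by
    intro r hr u s huv
    have h1 : dflow X r x u = dflow X r x v + (-(a • dflow X r x (X x)) + -dflow X r x s) := by
      rw [huv, map_add, map_add, map_smul]
      abel
    rw [h1]
    refine (vnorm_add_le g _ _).trans ?_
    have h2 := vnorm_add_le g (-(a • dflow X r x (X x))) (-dflow X r x s)
    rw [vnorm_neg, vnorm_neg, vnorm_smul] at h2
    have h3 := hEr r hr
    have h4 : |a| * vnorm g (dflow X r x (X x)) ≤ |a| * b :=
      mul_le_mul_of_nonneg_left (hflowX r) (abs_nonneg a)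
    linarith
  -- Transport by t expresses the image of u through those of v, X and s. Going back gains a factor
  -- q, and the image of s carries another q.
  have hu1 : vnorm g u ≤ q * (E * vnorm g v + |a| * b + q * vnorm g s) := by
    rw [hback t u]
    refine (hA.contract_u t ht0 _ _ (hA.invariant_u t x u hu)).trans ?_
    refine mul_le_mul_of_nonneg_left ((hsplit t (abs_of_nonneg ht0) u s hv).trans ?_) hq0.le
    have := hA.contract_s t ht0 x s hs
    linarith
  have hs1 : vnorm g s ≤ q * (E * vnorm g v + |a| * b + q * vnorm g u) := by
    rw [hback (-t) s, neg_neg]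
    refine (hA.contract_s t ht0 _ _ (hA.invariant_s (-t) x s hs)).trans ?_
    refine mul_le_mul_of_nonneg_left ((hsplit (-t) (by rw [abs_neg, abs_of_nonneg ht0]) s u
      (by rw [hv]; abel)).trans ?_) hq0.le
    have := hA.contract_u t ht0 x u hu
    linarith
  have ha1 : |a| * m ≤ vnorm g v + (vnorm g u + vnorm g s) := by
    have h1 : a • X x = v + (-u + -s) := by rw [hv]; abel
    have h2 := vnorm_add_le g v (-u + -s)
    have h3 := vnorm_add_le g (-u) (-s)
    rw [vnorm_neg, vnorm_neg] at h3
    rw [← h1, vnorm_smul] at h2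
    have h4 : |a| * m ≤ |a| * vnorm g (X x) := mul_le_mul_of_nonneg_left (hmb x).1 (abs_nonneg a)
    linarith
  have hv0 := vnorm_nonneg g v
  have hu0 := vnorm_nonneg g u
  have hs0 := vnorm_nonneg g s
  set Z := vnorm g u + vnorm g s with hZ
  have hab : |a| * b ≤ ρ * (vnorm g v + Z) := by
    have e : |a| * b = ρ * (|a| * m) := by rw [hρ]; field_simp
    rw [e]
    gcongr
  -- Adding the estimates for u and s, and inserting the one for a, leaves at most Z / 2 on the
  -- right because q (2 ρ + 1) ≤ 1 / 2.
  have hZ1 : Z ≤ (4 * E + 4 * ρ) * vnorm g v := by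
    have h1 : Z ≤ q * (2 * E * vnorm g v + 2 * (ρ * (vnorm g v + Z)) + q * Z) := by
      have h0 : q * (|a| * b) ≤ q * (ρ * (vnorm g v + Z)) := by gcongr
      nlinarith
    have h2 : q * (q * Z) ≤ q * (1 * Z) := by gcongr
    have h3 : q * (2 * ρ + 1) * Z ≤ 1 / 2 * Z := by gcongr
    have h4 : q * ((2 * E + 2 * ρ) * vnorm g v) ≤ 1 * ((2 * E + 2 * ρ) * vnorm g v) := by gcongr
    nlinarith
  have hp : 0 ≤ m⁻¹ * (1 + 4 * E + 4 * ρ) * vnorm g v := by positivity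
  refine ⟨a, u, s, hu, hs, hv, ?_, ?_, ?_⟩
  · have h1 : |a| ≤ m⁻¹ * ((1 + 4 * E + 4 * ρ) * vnorm g v) := by
      rw [inv_mul_eq_div, le_div_iff₀ hm]
      linarith
    have h2 : 0 ≤ (1 + 4 * E + 4 * ρ) * vnorm g v := by positivity
    nlinarith
  · nlinarith
  · nlinarith

end Splitting

/-! ### A smooth norm on covectors given by a family of vector fields, and its trichotomy. -/

section Family

variable {n : ℕ} {M : Type*} [TopologicalSpace M] [ChartedSpace (Model n) M]
  [IsManifold (𝓡 n) ∞ M] (g : Metric n M) {ι : Type*} [Fintype ι]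

/-- The sum of the squares of the symbols of a family of vector fields. -/
def sqSum (b : ι → VField n M) (ξ : Cotangent n M) : ℝ := ∑ i, symbol (b i) ξ ^ 2

/-- The logarithm of the norm on covectors defined by a family of vector fields. -/
def logSum (b : ι → VField n M) (ξ : Cotangent n M) : ℝ := 2⁻¹ * Real.log (sqSum b ξ)

theorem sqSum_nonneg (b : ι → VField n M) (ξ : Cotangent n M) : 0 ≤ sqSum b ξ :=
  Finset.sum_nonneg fun _ _ => sq_nonneg _

theorem abs_symbol_le_sqrt (b : ι → VField n M) (ξ : Cotangent n M) (i : ι) :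
    |symbol (b i) ξ| ≤ √(sqSum b ξ) :=
  Real.abs_le_sqrt (Finset.single_le_sum (f := fun i => symbol (b i) ξ ^ 2)
    (fun _ _ => sq_nonneg _) (Finset.mem_univ i))

theorem logSum_eq (b : ι → VField n M) (ξ : Cotangent n M) :
    logSum b ξ = Real.log (√(sqSum b ξ)) := by
  rw [logSum, Real.log_sqrt (sqSum_nonneg b ξ)]
  ring

/-- The norm of a family of vector fields is comparable with the dual norm. -/
def IsFrame (b : ι → VField n M) (K : ℝ) : Prop :=
  ∀ ξ, conorm g ξ ≤ K * √(sqSum b ξ) ∧ √(sqSum b ξ) ≤ K * conorm g ξ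

variable [CompactSpace M] [T2Space M] (𝒜 : ChartCover n M)

theorem exists_isFrame : ∃ (b : 𝒜.centers × Fin n → VField n M) (K : ℝ),
    (∀ i, IsCk ∞ (b i)) ∧ 1 ≤ K ∧ IsFrame g b K := by
  obtain ⟨b, hb, hbf⟩ := exists_frame 𝒜
  obtain ⟨κ, hκ1, hκ⟩ := exists_coord_bound g 𝒜
  obtain ⟨B, hB1, hB⟩ := Finset.exists_uniform_bound (Finset.univ : Finset (𝒜.centers × Fin n))
    (P := fun i B => ∀ x, vnorm g (b i x) ≤ B) (fun i B B' h hP x => (hP x).trans h)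
    (fun i _ => by
      obtain ⟨B, -, hB⟩ := exists_vnorm_le g 𝒜 ((hb i).of_le (by norm_cast))
      exact ⟨B, hB⟩)
  set m := (Fintype.card (𝒜.centers × Fin n) : ℝ)
  refine ⟨b, n * κ + m * B + 1, hb, ?_, fun ξ => ⟨?_, ?_⟩⟩
  · have : 0 ≤ n * κ := by positivity
    have : 0 ≤ m * B := by positivity
    linarith
  · have hsq := Real.sqrt_nonneg (sqSum b ξ)
    refine conorm_le g (by positivity) fun v => ?_
    obtain ⟨c, hc, hx⟩ := 𝒜.covers ξ.1
    have hs := 𝒜.subset_source c hc hx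
    set w := coord c ξ.1 v with hw
    have hv : v = ∑ j, w j • b (⟨c, hc⟩, j) ξ.1 := by
      conv_lhs => rw [← uncoord_coord hs v, ← hw, ← (EuclideanSpace.basisFun (Fin n) ℝ).sum_repr w]
      rw [map_sum]
      refine Finset.sum_congr rfl fun j _ => ?_
      rw [hbf ⟨c, hc⟩ ξ.1 hx j]
      simp [frameField]
    have h1 : (ξ.2 v : ℝ) = ∑ j, w j * symbol (b (⟨c, hc⟩, j)) ξ := by
      let ℓ : Model n →L[ℝ] ℝ := ξ.2
      have e : ℓ v = ∑ j, w j * ℓ (b (⟨c, hc⟩, j) ξ.1) := by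
        conv_lhs => rw [hv]
        exact (map_sum ℓ _ _).trans (Finset.sum_congr rfl fun j _ => map_smul ℓ _ _)
      exact e
    have h2 : ∀ j, |w j * symbol (b (⟨c, hc⟩, j)) ξ| ≤ κ * vnorm g v * √(sqSum b ξ) := by
      intro j
      rw [abs_mul]
      have : |w j| ≤ ‖w‖ := by simpa using PiLp.norm_apply_le w j
      have h3 := (hκ c hc _ hx v).1
      have h4 := abs_symbol_le_sqrt b ξ (⟨c, hc⟩, j)
      exact mul_le_mul (this.trans h3) h4 (abs_nonneg _)
        (mul_nonneg (by linarith) (vnorm_nonneg g v))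
    have hv0 := vnorm_nonneg g v
    rw [h1]
    calc _ ≤ ∑ _j : Fin n, κ * vnorm g v * √(sqSum b ξ) :=
          (Finset.abs_sum_le_sum_abs _ _).trans (Finset.sum_le_sum fun j _ => h2 j)
      _ = n * κ * (√(sqSum b ξ) * vnorm g v) := by simp; ring
      _ ≤ (n * κ + m * B + 1) * (√(sqSum b ξ) * vnorm g v) := by
          have : 0 ≤ m * B := by positivity
          gcongr
          linarith
      _ = _ := by ring
  · have hc0 := conorm_nonneg g ξ
    have h1 : ∀ i, |symbol (b i) ξ| ≤ B * conorm g ξ := by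
      intro i
      refine (abs_symbol_le g (b i) ξ).trans ?_
      rw [mul_comm]
      exact mul_le_mul_of_nonneg_right (hB i (Finset.mem_univ i) _) hc0
    have h2 : √(sqSum b ξ) ≤ ∑ i, |symbol (b i) ξ| := by
      refine Real.sqrt_le_iff.2 ⟨Finset.sum_nonneg fun _ _ => abs_nonneg _, ?_⟩
      have := Finset.sum_sq_le_sq_sum_of_nonneg (s := Finset.univ) (f := fun i => |symbol (b i) ξ|)
        (fun _ _ => abs_nonneg _)
      simpa [sqSum, sq_abs] using this
    refine h2.trans ((Finset.sum_le_sum fun i _ => h1 i).trans ?_)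
    simp only [Finset.sum_const, Finset.card_univ, nsmul_eq_mul]
    calc m * (B * conorm g ξ) = (m * B) * conorm g ξ := by ring
      _ ≤ (n * κ + m * B + 1) * conorm g ξ := by
        have : 0 ≤ n * κ := by positivity
        gcongr
        linarith

theorem IsFrame.sqSum_pos {b : ι → VField n M} {K : ℝ} (hb : IsFrame g b K)
    {ξ : Cotangent n M} (hξ : ξ.2 ≠ 0) : 0 < sqSum b ξ := by
  refine lt_of_le_of_ne (sqSum_nonneg b ξ) fun h => ?_
  have := (hb ξ).1
  rw [← h, Real.sqrt_zero, mul_zero] at this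
  exact absurd (conorm_pos g hξ) (not_lt.2 this)

/-- The behaviour of the norm along the orbits of the lifted flow of an Anosov field. -/
theorem IsAnosov.exists_trichotomy [Nonempty M] {X : VField n M} (hX : IsCk ∞ X)
    {Eu Es : (x : M) → Submodule ℝ (TangentSpace (𝓡 n) x)} {C β Λ : ℝ}
    (hA : IsAnosov g X Eu Es C β) (hΛ : HasMetricRate g X Λ)
    {b : ι → VField n M} {K₀ : ℝ} (hK₀ : 1 ≤ K₀) (hb : IsFrame g b K₀) :
    ∃ e ν, 0 ≤ e ∧ 0 < ν ∧ ∀ ξ : Cotangent n M, ξ.2 ≠ 0 →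
      Trichotomy β e (fun t => logSum b (lift X t ξ)) ∧
      (|symbol X ξ| < ν * conorm g ξ → GrowsFrom β e (fun t => logSum b (lift X t ξ)) 0 ∨
        GrowsFrom β e (fun t => logSum b (lift X (-t) ξ)) 0) := by
  have hX1 : IsCk 1 X := hX.of_le (by norm_cast)
  obtain ⟨K₁, hK₁, hsplit⟩ := hA.exists_splitting_bound g hX hΛ
  obtain ⟨m, B, hm, hmB⟩ := exists_vnorm_field_bounds g hX hA.ne_zero
  obtain ⟨x₀⟩ := (inferInstance : Nonempty M)
  have hB : 0 < B := hm.trans_le ((hmB x₀).1.trans (hmB x₀).2)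
  have hC := hA.C_pos
  set K := K₀ * (K₁ + B + 1) + C with hK
  have hp1 : 0 ≤ K₀ * (K₁ + B) := by positivity
  have hp2 : 0 ≤ K₀ * (B + 1) := by positivity
  have hp3 : 0 ≤ K₀ * (K₁ + 1) := by positivity
  have hKC : C ≤ K := by nlinarith
  have hK1 : 1 ≤ K := by nlinarith
  have hKK : K₀ * K₁ ≤ K := by nlinarith
  have hKK0 : K₀ ≤ K := by nlinarith
  have hKB : K₀ * B ≤ K := by nlinarith
  -- If N dominates at time 0, then the norm of ξ is at most K w 0 ≤ 3 K² |p|. Below the threshold ν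
  -- = 1 / (3 K²) this alternative is therefore excluded.
  refine ⟨Real.log (7 * K ^ 7), (3 * K * K)⁻¹, ?_, by positivity, fun ξ hξ => ?_⟩
  · refine Real.log_nonneg ?_
    have : 1 ≤ K ^ 7 := one_le_pow₀ hK1
    linarith
  let w : ℝ → ℝ := fun t => √(sqSum b (lift X t ξ))
  -- The roles are exchanged by duality: the restriction to the stable bundle is what expands in the
  -- future.
  let U : ℝ → ℝ := fun t => subnorm g Es (lift X t ξ)
  let S : ℝ → ℝ := fun t => subnorm g Eu (lift X t ξ)
  have hw0 : ∀ t, 0 < w t := fun t =>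
    Real.sqrt_pos.2 (hb.sqSum_pos g (lift_ne_zero hX1 t hξ))
  have hcw : ∀ t, conorm g (lift X t ξ) ≤ K₀ * w t := fun t => (hb _).1
  have hsub : ∀ (E : (x : M) → Submodule ℝ (TangentSpace (𝓡 n) x)) t,
      subnorm g E (lift X t ξ) ≤ K * w t := fun E t =>
    (subnorm_le_conorm g _).trans ((hcw t).trans
      (mul_le_mul_of_nonneg_right hKK0 (hw0 t).le))
  have hN : ∀ t, symbol X (lift X t ξ) = symbol X ξ := fun t => symbol_self_lift hX1 t ξ
  have htri := trichotomy_of_bounds (U := U) (S := S) (w := w) (N := |symbol X ξ|) (K := K) (β := β)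
    hK1 hA.beta_pos hw0 (fun t => subnorm_nonneg g _) (fun t => subnorm_nonneg g _)
    (fun t => by
      have h1 : conorm g (lift X t ξ) ≤ K₁ * (U t + S t + |symbol X ξ|) := by
        refine conorm_le g (mul_nonneg (by linarith) (add_nonneg (add_nonneg
          (subnorm_nonneg g _) (subnorm_nonneg g _)) (abs_nonneg _))) fun v => ?_
        obtain ⟨a, u, s, hu, hs, hv, h1, h2, h3⟩ := hsplit _ v
        have e : ((lift X t ξ).2 v : ℝ) = a * symbol X (lift X t ξ) + (lift X t ξ).2 u +
            (lift X t ξ).2 s := by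
          let ℓ : Model n →L[ℝ] ℝ := (lift X t ξ).2
          have : ℓ v = a * ℓ (X (lift X t ξ).1) + ℓ u + ℓ s := by
            conv_lhs => rw [hv]
            exact (map_add ℓ _ _).trans (congrArg (· + ℓ s) ((map_add ℓ _ _).trans
              (congrArg (· + ℓ u) (map_smul ℓ a _))))
          exact this
        have h4 : |((lift X t ξ).2 u : ℝ)| ≤ S t * vnorm g u := abs_apply_le_subnorm g _ hu
        have h5 : |((lift X t ξ).2 s : ℝ)| ≤ U t * vnorm g s := abs_apply_le_subnorm g _ hs
        have h6 : S t * vnorm g u ≤ S t * (K₁ * vnorm g v) :=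
          mul_le_mul_of_nonneg_left h2 (subnorm_nonneg g _)
        have h7 : U t * vnorm g s ≤ U t * (K₁ * vnorm g v) :=
          mul_le_mul_of_nonneg_left h3 (subnorm_nonneg g _)
        have h8 : |a| * |symbol X ξ| ≤ K₁ * vnorm g v * |symbol X ξ| :=
          mul_le_mul_of_nonneg_right h1 (abs_nonneg _)
        refine (congrArg abs e).trans_le ?_
        have t1 := abs_add_le (a * symbol X (lift X t ξ) + (lift X t ξ).2 u : ℝ) ((lift X t ξ).2 s)
        have t2 := abs_add_le (a * symbol X (lift X t ξ)) ((lift X t ξ).2 u : ℝ)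
        rw [abs_mul, hN t] at t2
        refine t1.trans ?_
        rw [hN t]
        linarith
      have h2 := (hb (lift X t ξ)).2
      have h3 : 0 ≤ U t + S t + |symbol X ξ| := add_nonneg (add_nonneg
          (subnorm_nonneg g _) (subnorm_nonneg g _)) (abs_nonneg _)
      calc w t ≤ K₀ * (K₁ * (U t + S t + |symbol X ξ|)) := h2.trans (by gcongr)
        _ = K₀ * K₁ * (U t + S t + |symbol X ξ|) := by ring
        _ ≤ _ := by gcongr)
    (fun t => hsub Es t) (fun t => hsub Eu t)
    (fun t => by
      have h1 := abs_symbol_le g X (lift X t ξ)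
      rw [hN t] at h1
      have h2 := hcw t
      have h3 : vnorm g (X (lift X t ξ).1) ≤ B := (hmB _).2
      have hw := (hw0 t).le
      calc |symbol X ξ| ≤ (K₀ * w t) * B := h1.trans (mul_le_mul h2 h3 (vnorm_nonneg g _)
            (mul_nonneg (by linarith) hw))
        _ = K₀ * B * w t := by ring
        _ ≤ K * w t := by gcongr)
    (fun t t' h => by
      have h1 := subnorm_le_lift g (E := Es) hX1 (t := t' - t) (q := C * Real.exp (-β * (t' - t)))
        (by positivity) (lift X t ξ) (hA.invariant_s _ _) (hA.contract_s _ (by linarith) _)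
      rw [← lift_add hX1, sub_add_cancel] at h1
      refine h1.trans (mul_le_mul_of_nonneg_right ?_ (subnorm_nonneg g _))
      gcongr)
    (fun t t' h => by
      have h1 := subnorm_le_lift g (E := Eu) hX1 (t := -(t' - t))
        (q := C * Real.exp (-β * (t' - t)))
        (by positivity) (lift X t' ξ) (hA.invariant_u _ _) (hA.contract_u _ (by linarith) _)
      rw [← lift_add hX1, neg_sub, sub_add_cancel] at h1
      refine h1.trans (mul_le_mul_of_nonneg_right ?_ (subnorm_nonneg g _))
      gcongr)
  simp only [Trichotomy, logSum_eq]
  refine ⟨fun t => ?_, fun h => ?_⟩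
  · rcases htri t with h | h | h
    · exact Or.inl h
    · exact Or.inr (Or.inl h)
    · exact Or.inr (Or.inr h.1)
  · have h0 := htri 0
    rw [neg_zero] at h0
    rcases h0 with h' | h' | h'
    · exact Or.inl h'
    · exact Or.inr h'
    · exfalso
      have h1 := h'.2
      have h2 := hcw 0
      rw [lift_zero hX1] at h2
      have h3 : conorm g ξ ≤ K * w 0 := h2.trans (mul_le_mul_of_nonneg_right hKK0 (hw0 0).le)
      have h4 : conorm g ξ ≤ 3 * K * K * |symbol X ξ| := by nlinarith
      rw [inv_mul_eq_div, lt_div_iff₀ (by positivity)] at h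
      linarith

end Family

/-! ### Regularity of symbols on the cotangent bundle. -/

section Smooth

variable {n : ℕ} {M : Type*} [TopologicalSpace M] [ChartedSpace (Model n) M]
  [IsManifold (𝓡 n) ∞ M]

/-- The symbol of a vector field is as regular as the vector field. -/
theorem IsCk.contMDiff_symbol {V : VField n M} (hV : IsCk ∞ V) :
    ContMDiff ((𝓡 n).prod 𝓘(ℝ, Model n →L[ℝ] ℝ)) 𝓘(ℝ, ℝ) ∞ (symbol V) := by
  have : IsManifold (𝓡 n) ((∞ : ℕ∞ω) + 1) M := IsManifold.of_le (n := ∞) (by norm_cast)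
  have : ContMDiffVectorBundle ∞ (Model n) (TangentSpace (𝓡 n) : M → Type _) (𝓡 n) :=
    TangentBundle.contMDiffVectorBundle
  intro ξ₀
  have hp : ContMDiffAt ((𝓡 n).prod 𝓘(ℝ, Model n →L[ℝ] ℝ)) (𝓡 n) ∞
      (fun ξ : Cotangent n M => ξ.1) ξ₀ := contMDiffAt_proj _
  have h := ContMDiffAt.clm_bundle_apply (F₁ := Model n) (F₂ := ℝ)
    (E₁ := fun x : M => TangentSpace (𝓡 n) x)
    (E₂ := Bundle.Trivial M ℝ) (b := fun ξ : Cotangent n M => ξ.1) (ϕ := fun ξ => ξ.2)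
    (v := fun ξ => V ξ.1) (n := ∞) contMDiffAt_id (ContMDiffAt.comp ξ₀ (hV ξ₀.1) hp)
  simp only [contMDiffAt_totalSpace] at h
  exact h.2

theorem IsCk.continuous_symbol {V : VField n M} (hV : IsCk 0 V) :
    Continuous (symbol V : Cotangent n M → ℝ) := by
  have : IsManifold (𝓡 n) ((0 : ℕ∞ω) + 1) M := IsManifold.of_le (n := ∞) (by norm_cast)
  have : ContMDiffVectorBundle 0 (Model n) (TangentSpace (𝓡 n) : M → Type _) (𝓡 n) :=
    TangentBundle.contMDiffVectorBundle
  rw [continuous_iff_continuousAt]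
  intro ξ₀
  have hp : ContMDiffAt ((𝓡 n).prod 𝓘(ℝ, Model n →L[ℝ] ℝ)) (𝓡 n) 0
      (fun ξ : Cotangent n M => ξ.1) ξ₀ := contMDiffAt_proj _
  have h := ContMDiffAt.clm_bundle_apply (F₁ := Model n) (F₂ := ℝ)
    (E₁ := fun x : M => TangentSpace (𝓡 n) x)
    (E₂ := Bundle.Trivial M ℝ) (b := fun ξ : Cotangent n M => ξ.1) (ϕ := fun ξ => ξ.2)
    (v := fun ξ => V ξ.1) (n := 0) contMDiffAt_id (ContMDiffAt.comp ξ₀ (hV ξ₀.1) hp)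
  simp only [contMDiffAt_totalSpace] at h
  exact h.2.continuousAt

end Smooth

/-! ### Derivative of the logarithmic norm along the lifted flow, and its stability in X. -/

section Rate

variable {n : ℕ} {M : Type*} [TopologicalSpace M] [ChartedSpace (Model n) M]
  [IsManifold (𝓡 n) ∞ M] (g : Metric n M) {ι : Type*} [Fintype ι]

/-- The derivative of `logSum b` along the lifted flow. -/
def rate (X : VField n M) (b : ι → VField n M) (ξ : Cotangent n M) : ℝ :=
  (∑ i, symbol (b i) ξ * symbol (bracket X (b i)) ξ) / sqSum b ξ

/-- The pull-back of a family of vector fields by the flow. -/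
def pullFamily (X : VField n M) (b : ι → VField n M) (t : ℝ) : ι → VField n M :=
  fun i => pullField X t (b i)

theorem sqSum_pullFamily (X : VField n M) (b : ι → VField n M) (t : ℝ) (ξ : Cotangent n M) :
    sqSum (pullFamily X b t) ξ = sqSum b (lift X t ξ) := rfl

theorem sqSum_scale (b : ι → VField n M) (r : ℝ) (ξ : Cotangent n M) :
    sqSum b (scale r ξ) = r ^ 2 * sqSum b ξ := by
  simp only [sqSum, symbol_scale, mul_pow, Finset.mul_sum]

theorem logSum_scale {b : ι → VField n M} {r : ℝ} (hr : 0 < r) {ξ : Cotangent n M}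
    (hξ : 0 < sqSum b ξ) : logSum b (scale r ξ) = Real.log r + logSum b ξ := by
  rw [logSum, sqSum_scale, Real.log_mul (by positivity) hξ.ne', Real.log_pow, logSum]
  push_cast
  ring

variable [CompactSpace M] [T2Space M]

theorem hasDerivAt_logSum {X : VField n M} (hX : IsCk 1 X) {b : ι → VField n M}
    (hb : ∀ i, IsCk 1 (b i)) {ξ : Cotangent n M} (hξ : 0 < sqSum b ξ) :
    HasDerivAt (fun t => logSum b (lift X t ξ)) (rate X b ξ) 0 := by
  have h1 : HasDerivAt (fun t => sqSum b (lift X t ξ))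
      (∑ i, 2 * (symbol (b i) ξ * symbol (bracket X (b i)) ξ)) 0 := by
    refine HasDerivAt.fun_sum fun i _ => ?_
    have := (hasDerivAt_symbol_lift hX (hb i) ξ).fun_pow 2
    refine this.congr_deriv ?_
    rw [lift_zero hX]
    push_cast
    ring
  have h2 := (h1.log (by rw [lift_zero hX]; exact hξ.ne')).const_mul (2⁻¹ : ℝ)
  refine h2.congr_deriv ?_
  rw [lift_zero hX, ← Finset.mul_sum, rate]
  ring

theorem IsCk.continuous_sqSum_lift {X : VField n M} (hX : IsCk 1 X) {b : ι → VField n M}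
    (hb : ∀ i, IsCk 0 (b i)) (t : ℝ) : Continuous fun ξ => sqSum b (lift X t ξ) := by
  refine continuous_finsetSum _ fun i _ => Continuous.pow ?_ 2
  have hX' : IsCk (0 + 1 : ℕ) X := by simpa using hX
  have h := IsCk.pullField (k := 0) hX' (by simpa using hb i) t
  exact IsCk.continuous_symbol (by simpa using h)

/-- The field X enters the rate only through the brackets with the fixed fields of the family, and
these depend on X in a C¹-Lipschitz way. Division by `sqSum` removes the dependence on the size of
the covector. -/
theorem abs_rate_sub_le (𝒜 : ChartCover n M) {X₀ : VField n M} (hX₀ : IsCk 1 X₀)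
    {b : ι → VField n M} (hb : ∀ i, IsCk 1 (b i)) {K : ℝ} (hK : 1 ≤ K) (hf : IsFrame g b K) :
    ∃ κ, 0 ≤ κ ∧ ∀ (X : VField n M) (η : ℝ), IsCk 1 X →
      C1Norm 𝒜 (fun x => X x - X₀ x) < ENNReal.ofReal η → ∀ ξ : Cotangent n M, ξ.2 ≠ 0 →
        |rate X b ξ - rate X₀ b ξ| ≤ κ * η := by
  choose κ hκ1 hκ using fun i => exists_abs_symbol_bracket_sub_le g 𝒜 hX₀ (hb i)
  refine ⟨∑ i, κ i * K, Finset.sum_nonneg fun i _ => by have := hκ1 i; positivity,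
    fun X η hX hη ξ hξ => ?_⟩
  have hη0 : 0 < η := by
    by_contra h
    rw [ENNReal.ofReal_of_nonpos (not_lt.1 h)] at hη
    exact absurd hη (by simp)
  have hQ := hf.sqSum_pos g hξ
  have hs := Real.sqrt_nonneg (sqSum b ξ)
  rw [rate, rate, ← sub_div, ← Finset.sum_sub_distrib, abs_div, abs_of_pos hQ, div_le_iff₀ hQ]
  have h1 : ∀ i, |symbol (b i) ξ * symbol (bracket X (b i)) ξ -
      symbol (b i) ξ * symbol (bracket X₀ (b i)) ξ| ≤ κ i * K * η * sqSum b ξ := by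
    intro i
    rw [← mul_sub, abs_mul]
    have h2 := hκ i X η hX hη ξ
    have h3 := abs_symbol_le_sqrt b ξ i
    have h4 := (hf ξ).1
    have h5 := hκ1 i
    calc _ ≤ √(sqSum b ξ) * (κ i * η * (K * √(sqSum b ξ))) := by
          refine mul_le_mul h3 (h2.trans ?_) (abs_nonneg _) hs
          gcongr
      _ = κ i * K * η * (√(sqSum b ξ) * √(sqSum b ξ)) := by ring
      _ = _ := by rw [Real.mul_self_sqrt hQ.le]
  refine (Finset.abs_sum_le_sum_abs _ _).trans ((Finset.sum_le_sum fun i _ => h1 i).trans ?_)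
  rw [← Finset.sum_mul, ← Finset.sum_mul]

/-- The rate along the orbits is uniformly Lipschitz, with a bounded derivative. -/
theorem exists_rate_bound (𝒜 : ChartCover n M) {X : VField n M} (hX : IsCk ∞ X)
    {b : ι → VField n M} (hb : ∀ i, IsCk ∞ (b i)) {K : ℝ} (hK : 1 ≤ K) (hf : IsFrame g b K) :
    ∃ B, 0 < B ∧ ∀ ξ : Cotangent n M, ξ.2 ≠ 0 → |rate X b ξ| ≤ B ∧
      ∃ d, HasDerivAt (fun t => rate X b (lift X t ξ)) d 0 ∧ |d| ≤ B := by
  have hX1 : IsCk 1 X := hX.of_le (by norm_cast)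
  have hb1 : ∀ i, IsCk 1 (b i) := fun i => (hb i).of_le (by norm_cast)
  have hbr : ∀ i, IsCk ∞ (bracket X (b i)) := fun i => hX.bracket (hb i)
  have hbr1 : ∀ i, IsCk 1 (bracket X (b i)) := fun i => (hbr i).of_le (by norm_cast)
  have hbb1 : ∀ i, IsCk 1 (bracket X (bracket X (b i))) := fun i =>
    (hX.bracket (hbr i)).of_le (by norm_cast)
  choose B₁ hB₁1 hB₁ using fun i => exists_vnorm_le g 𝒜 (hbr1 i)
  choose B₂ hB₂1 hB₂ using fun i => exists_vnorm_le g 𝒜 (hbb1 i)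
  set R := ∑ i, B₁ i * K with hR
  set R₂ := ∑ i, ((B₁ i * K) ^ 2 + B₂ i * K) with hR₂
  have hR0 : 0 ≤ R := Finset.sum_nonneg fun i _ => by have := hB₁1 i; positivity
  have hR₂0 : 0 ≤ R₂ := Finset.sum_nonneg fun i _ => by
    have := hB₁1 i; have := hB₂1 i; positivity
  have hsym : ∀ {W : VField n M} {B : ℝ}, 1 ≤ B → (∀ x, vnorm g (W x) ≤ B) →
      ∀ ξ : Cotangent n M, |symbol W ξ| ≤ B * K * √(sqSum b ξ) := by
    intro W B hB1 hB ξ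
    have h1 := (hf ξ).1
    have := Real.sqrt_nonneg (sqSum b ξ)
    calc _ ≤ conorm g ξ * vnorm g (W ξ.1) := abs_symbol_le g W ξ
      _ ≤ (K * √(sqSum b ξ)) * B := mul_le_mul h1 (hB _) (vnorm_nonneg g _) (by positivity)
      _ = _ := by ring
  have hnum : ∀ ξ : Cotangent n M,
      |∑ i, symbol (b i) ξ * symbol (bracket X (b i)) ξ| ≤ R * sqSum b ξ := by
    intro ξ
    rw [hR, Finset.sum_mul]
    refine (Finset.abs_sum_le_sum_abs _ _).trans (Finset.sum_le_sum fun i _ => ?_)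
    rw [abs_mul]
    have := Real.sqrt_nonneg (sqSum b ξ)
    calc _ ≤ √(sqSum b ξ) * (B₁ i * K * √(sqSum b ξ)) :=
          mul_le_mul (abs_symbol_le_sqrt b ξ i) (hsym (hB₁1 i) (hB₁ i) ξ) (abs_nonneg _) this
      _ = B₁ i * K * (√(sqSum b ξ) * √(sqSum b ξ)) := by ring
      _ = _ := by rw [Real.mul_self_sqrt (sqSum_nonneg b ξ)]
  refine ⟨R + (R₂ + 2 * R ^ 2) + 1, by positivity, fun ξ hξ => ?_⟩
  have hQ := hf.sqSum_pos g hξ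
  have hrate : |rate X b ξ| ≤ R := by
    rw [rate, abs_div, abs_of_pos hQ, div_le_iff₀ hQ]
    exact hnum ξ
  refine ⟨hrate.trans (by nlinarith), ?_⟩
  have h1 : HasDerivAt (fun t => sqSum b (lift X t ξ))
      (∑ i, 2 * (symbol (b i) ξ * symbol (bracket X (b i)) ξ)) 0 := by
    refine HasDerivAt.fun_sum fun i _ => ?_
    have := (hasDerivAt_symbol_lift hX1 (hb1 i) ξ).fun_pow 2
    refine this.congr_deriv ?_
    rw [lift_zero hX1]
    push_cast
    ring
  have h2 : HasDerivAt (fun t => ∑ i, symbol (b i) (lift X t ξ) *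
      symbol (bracket X (b i)) (lift X t ξ)) (∑ i, (symbol (bracket X (b i)) ξ ^ 2 +
        symbol (b i) ξ * symbol (bracket X (bracket X (b i))) ξ)) 0 := by
    refine HasDerivAt.fun_sum fun i _ => ?_
    have := (hasDerivAt_symbol_lift hX1 (hb1 i) ξ).fun_mul
      (hasDerivAt_symbol_lift hX1 (hbr1 i) ξ)
    refine this.congr_deriv ?_
    rw [lift_zero hX1]
    ring
  have h3 := h2.fun_div h1 (by rw [lift_zero hX1]; exact hQ.ne')
  rw [lift_zero hX1] at h3
  refine ⟨_, h3, ?_⟩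
  set Q := sqSum b ξ
  set N := ∑ i, symbol (b i) ξ * symbol (bracket X (b i)) ξ with hN
  set N₂ := ∑ i, (symbol (bracket X (b i)) ξ ^ 2 +
        symbol (b i) ξ * symbol (bracket X (bracket X (b i))) ξ) with hN₂
  have hN2 : |N₂| ≤ R₂ * Q := by
    rw [hN₂, hR₂, Finset.sum_mul]
    refine (Finset.abs_sum_le_sum_abs _ _).trans (Finset.sum_le_sum fun i _ => ?_)
    have hsq := Real.sqrt_nonneg (sqSum b ξ)
    have hss : √(sqSum b ξ) * √(sqSum b ξ) = Q := Real.mul_self_sqrt (sqSum_nonneg b ξ)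
    have e1 : |symbol (bracket X (b i)) ξ ^ 2| ≤ (B₁ i * K) ^ 2 * Q := by
      rw [abs_pow]
      calc _ ≤ (B₁ i * K * √(sqSum b ξ)) ^ 2 :=
            pow_le_pow_left₀ (abs_nonneg _) (hsym (hB₁1 i) (hB₁ i) ξ) 2
        _ = (B₁ i * K) ^ 2 * (√(sqSum b ξ) * √(sqSum b ξ)) := by ring
        _ = _ := by rw [hss]
    have e2 : |symbol (b i) ξ * symbol (bracket X (bracket X (b i))) ξ| ≤ B₂ i * K * Q := by
      rw [abs_mul]
      calc _ ≤ √(sqSum b ξ) * (B₂ i * K * √(sqSum b ξ)) :=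
            mul_le_mul (abs_symbol_le_sqrt b ξ i) (hsym (hB₂1 i) (hB₂ i) ξ) (abs_nonneg _) hsq
        _ = B₂ i * K * (√(sqSum b ξ) * √(sqSum b ξ)) := by ring
        _ = _ := by rw [hss]
    exact (abs_add_le _ _).trans (by linarith)
  have hN1 : |N| ≤ R * Q := hnum ξ
  rw [← Finset.mul_sum, ← hN, abs_div, abs_of_pos (by positivity : 0 < Q ^ 2),
    div_le_iff₀ (by positivity)]
  -- Numerator of the quotient rule for N / Q, where the derivative of Q is 2 N and that of N is N₂;
  -- the second bracket with X in N₂ is where smoothness of X is used.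
  have e3 : |N₂ * Q - N * (2 * N)| ≤ |N₂| * Q + 2 * |N| ^ 2 := by
    refine (abs_sub _ _).trans (le_of_eq ?_)
    rw [abs_mul, abs_mul, abs_mul, abs_of_pos hQ, abs_two]
    ring
  have e4 : |N| ^ 2 ≤ (R * Q) ^ 2 := pow_le_pow_left₀ (abs_nonneg _) hN1 2
  have e5 : |N₂| * Q ≤ R₂ * Q * Q := by gcongr
  have e6 : 0 ≤ R * Q ^ 2 := by positivity
  nlinarith [sq_nonneg Q]

/-- The growth bound in both directions makes the norm at Φ_t ξ comparable with the norm at ξ, so a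
pulled back frame is again a frame with a worse constant. -/
theorem IsFrame.pullFamily {X : VField n M} (hX : IsCk 1 X) {Λ : ℝ} (hΛ : HasGrowthRate g X Λ)
    {b : ι → VField n M} {K : ℝ} (hK : 0 ≤ K) (hf : IsFrame g b K) (t : ℝ) :
    IsFrame g (pullFamily X b t) (K * Real.exp (Λ * |t|)) := by
  intro ξ
  rw [sqSum_pullFamily]
  have h1 := hΛ t ξ
  have h2 := hΛ (-t) (lift X t ξ)
  rw [← lift_add hX, neg_add_cancel, lift_zero hX, abs_neg] at h2
  have h3 := hf (lift X t ξ)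
  have hE := (Real.exp_pos (Λ * |t|)).le
  constructor
  · calc _ ≤ Real.exp (Λ * |t|) * conorm g (lift X t ξ) := h2
      _ ≤ Real.exp (Λ * |t|) * (K * √(sqSum b (lift X t ξ))) := by gcongr; exact h3.1
      _ = _ := by ring
  · calc _ ≤ K * conorm g (lift X t ξ) := h3.2
      _ ≤ K * (Real.exp (Λ * |t|) * conorm g ξ) := by gcongr
      _ = _ := by ring

/-- The rate of the pulled back family is the derivative along the orbit. -/
theorem rate_pullFamily {X : VField n M} (hX : IsCk ∞ X) {b : ι → VField n M}
    (hb : ∀ i, IsCk ∞ (b i)) {K : ℝ} (hf : IsFrame g b K) (t : ℝ) {ξ : Cotangent n M}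
    (hξ : ξ.2 ≠ 0) : rate X (pullFamily X b t) ξ = rate X b (lift X t ξ) := by
  have hX1 : IsCk 1 X := hX.of_le (by norm_cast)
  have hpos := hf.sqSum_pos g (lift_ne_zero hX1 t hξ)
  have h1 := hasDerivAt_logSum hX1 (b := pullFamily X b t)
    (fun i => (hX.pullField_infty (hb i) t).of_le (by norm_cast)) (ξ := ξ) hpos
  have h2 := hasDerivAt_logSum hX1 (fun i => (hb i).of_le (by norm_cast)) hpos
  refine h1.unique (h2.congr_of_eventuallyEq (Eventually.of_forall fun s => ?_))
  change logSum b (lift X t (lift X s ξ)) = logSum b (lift X s (lift X t ξ))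
  rw [← lift_add hX1, ← lift_add hX1, add_comm]

end Rate

/-! ### Riemann sums of a derivative against the slope. -/

section Mean

/-- The average of `f` over the times `(i + 1) Δ`, `i < J`. -/
def mean (f : ℝ → ℝ) (J : ℕ) (Δ : ℝ) : ℝ := (J : ℝ)⁻¹ * ∑ i ∈ Finset.range J, f ((i + 1) * Δ)

theorem oddMean_eq (f : ℝ → ℝ) (J : ℕ) (Δ : ℝ) :
    oddMean f J Δ = mean f J Δ - mean f J (-Δ) := by
  simp only [oddMean, mean, Finset.sum_sub_distrib, mul_sub, mul_neg]

theorem mean_add_const (f : ℝ → ℝ) {J : ℕ} (hJ : 0 < J) (Δ a : ℝ) :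
    mean (fun t => a + f t) J Δ = a + mean f J Δ := by
  have hJ' : (J : ℝ) ≠ 0 := by exact_mod_cast hJ.ne'
  simp only [mean, Finset.sum_add_distrib, Finset.sum_const, Finset.card_range, nsmul_eq_mul]
  generalize ∑ x ∈ Finset.range J, f ((x + 1) * Δ) = S
  field_simp

theorem abs_mean_le {f : ℝ → ℝ} {J : ℕ} (hJ : 0 < J) {Δ a : ℝ}
    (h : ∀ i < J, |f ((i + 1) * Δ)| ≤ a) : |mean f J Δ| ≤ a := by
  have hJ' : (0 : ℝ) < J := by exact_mod_cast hJ
  rw [mean, abs_mul, abs_of_pos (inv_pos.2 hJ'), inv_mul_eq_div, div_le_iff₀ hJ']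
  refine (Finset.abs_sum_le_sum_abs _ _).trans ((Finset.sum_le_sum fun i hi =>
    h i (Finset.mem_range.1 hi)).trans ?_)
  simp [mul_comm]

theorem mean_sub (f f' : ℝ → ℝ) (J : ℕ) (Δ : ℝ) :
    mean (fun t => f t - f' t) J Δ = mean f J Δ - mean f' J Δ := by
  simp only [mean, Finset.sum_sub_distrib, mul_sub]

/-- This is the mean value inequality for r ↦ L'(s) r - L(r), whose derivative is small near s by
the Lipschitz bound on L'. -/
theorem abs_sub_sub_mul_le {L L' : ℝ → ℝ} {B : ℝ} (hL : ∀ t, HasDerivAt L (L' t) t)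
    (hB0 : 0 ≤ B) (hB : ∀ s t, |L' s - L' t| ≤ B * |s - t|) (t s : ℝ) :
    |L' s * (s - t) - (L s - L t)| ≤ B * |s - t| * |s - t| := by
  have h := Convex.norm_image_sub_le_of_norm_hasDerivWithin_le (𝕜 := ℝ) (s := uIcc t s)
    (f := fun r => L' s * r - L r) (f' := fun r => L' s * 1 - L' r) (C := B * |s - t|)
    (fun r _ => (((hasDerivAt_id r).const_mul (L' s)).sub (hL r)).hasDerivWithinAt)
    (fun r hr => by
      rw [mul_one, Real.norm_eq_abs]
      refine (hB s r).trans ?_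
      gcongr ?_ * ?_
      rw [abs_sub_comm s r, abs_sub_comm s t]
      rw [uIcc_comm] at hr
      rw [abs_sub_comm t s, abs_sub_comm r s]
      rcases le_total s t with h | h
      · rw [uIcc_of_le h] at hr
        rw [abs_of_nonpos (by linarith [hr.1]), abs_of_nonpos (by linarith)]
        linarith [hr.2]
      · rw [uIcc_of_ge h] at hr
        rw [abs_of_nonneg (by linarith [hr.2]), abs_of_nonneg (by linarith)]
        linarith [hr.1])
    (convex_uIcc t s) left_mem_uIcc right_mem_uIcc
  simp only [Real.norm_eq_abs] at h
  rw [show L' s * (s - t) - (L s - L t) = L' s * s - L s - (L' s * t - L t) by ring]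
  exact h

/-- The average of the derivative is close to the slope. -/
theorem abs_mean_deriv_sub_le {L L' : ℝ → ℝ} {B : ℝ} (hL : ∀ t, HasDerivAt L (L' t) t)
    (hB0 : 0 ≤ B) (hB : ∀ s t, |L' s - L' t| ≤ B * |s - t|) {J : ℕ} (hJ : 0 < J) {Δ : ℝ}
    (hΔ : Δ ≠ 0) : |mean L' J Δ - (L (J * Δ) - L 0) / (J * Δ)| ≤ B * |Δ| := by
  have hJ' : (0 : ℝ) < J := by exact_mod_cast hJ
  have h1 : L (J * Δ) - L 0 = ∑ i ∈ Finset.range J, (L ((i + 1) * Δ) - L (i * Δ)) := by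
    have := Finset.sum_range_sub (fun i : ℕ => L (i * Δ)) J
    simp only [Nat.cast_zero, zero_mul, Nat.cast_add, Nat.cast_one] at this
    exact this.symm
  have h2 : mean L' J Δ - (L (J * Δ) - L 0) / (J * Δ) =
      (J * Δ)⁻¹ * ∑ i ∈ Finset.range J, (L' ((i + 1) * Δ) * Δ - (L ((i + 1) * Δ) - L (i * Δ))) := by
    rw [Finset.sum_sub_distrib, ← h1, ← Finset.sum_mul, mean]
    generalize ∑ x ∈ Finset.range J, L' ((x + 1) * Δ) = S
    field_simp
  have h3 : ∀ i ∈ Finset.range J,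
      |L' ((i + 1) * Δ) * Δ - (L ((i + 1) * Δ) - L (i * Δ))| ≤ B * |Δ| * |Δ| := by
    intro i _
    have := abs_sub_sub_mul_le hL hB0 hB (i * Δ) ((i + 1) * Δ)
    rwa [show ((i : ℝ) + 1) * Δ - i * Δ = Δ by ring] at this
  rw [h2, abs_mul, abs_inv, abs_mul, abs_of_pos hJ', inv_mul_eq_div,
    div_le_iff₀ (by positivity)]
  refine (Finset.abs_sum_le_sum_abs _ _).trans ((Finset.sum_le_sum h3).trans (le_of_eq ?_))
  rw [Finset.sum_const, Finset.card_range, nsmul_eq_mul]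
  ring

end Mean

/-! ### Averaged logarithmic norms on the cotangent bundle. -/

section MeanSum

variable {n : ℕ} {M : Type*} [TopologicalSpace M] [ChartedSpace (Model n) M]
  [IsManifold (𝓡 n) ∞ M] (g : Metric n M) {ι : Type*} [Fintype ι]

/-- The average of `logSum b` along the orbits of the lifted flow of `X₀`. -/
def meanSum (X₀ : VField n M) (b : ι → VField n M) (J : ℕ) (Δ : ℝ) (ξ : Cotangent n M) : ℝ :=
  mean (fun t => logSum b (lift X₀ t ξ)) J Δ

/-- The derivative of `meanSum X₀ b J Δ` along the lifted flow of `X`. -/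
def meanRate (X X₀ : VField n M) (b : ι → VField n M) (J : ℕ) (Δ : ℝ) (ξ : Cotangent n M) : ℝ :=
  mean (fun t => rate X (pullFamily X₀ b t) ξ) J Δ

variable [CompactSpace M] [T2Space M] {X₀ : VField n M} {b : ι → VField n M}

/-- Each term is `logSum` of the family pulled back by the flow of X₀ at a fixed time, hence of a
smooth family; it can be differentiated along the lift of any C¹ field X. Averaging over finitely
many times avoids differentiation under an integral. -/
theorem hasDerivAt_meanSum (hX₀ : IsCk ∞ X₀) (hb : ∀ i, IsCk ∞ (b i)) {K : ℝ} (hf : IsFrame g b K)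
    {X : VField n M} (hX : IsCk 1 X) (J : ℕ) (Δ : ℝ) {ξ : Cotangent n M} (hξ : ξ.2 ≠ 0) :
    HasDerivAt (fun t => meanSum X₀ b J Δ (lift X t ξ)) (meanRate X X₀ b J Δ ξ) 0 := by
  have hX₁ : IsCk 1 X₀ := hX₀.of_le (by norm_cast)
  refine HasDerivAt.const_mul _ (HasDerivAt.fun_sum fun i _ => ?_)
  exact hasDerivAt_logSum hX (b := pullFamily X₀ b ((i + 1) * Δ))
    (fun j => (hX₀.pullField_infty (hb j) _).of_le (by norm_cast))
    (hf.sqSum_pos g (lift_ne_zero hX₁ _ hξ))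

theorem abs_meanRate_sub_le (𝒜 : ChartCover n M) (hX₀ : IsCk ∞ X₀) (hb : ∀ i, IsCk ∞ (b i))
    {K Λ : ℝ} (hK : 1 ≤ K) (hf : IsFrame g b K) (hΛ0 : 0 ≤ Λ) (hΛ : HasGrowthRate g X₀ Λ)
    {J : ℕ} (hJ : 0 < J) (Δ : ℝ) :
    ∃ κ, 0 ≤ κ ∧ ∀ (X : VField n M) (η : ℝ), IsCk 1 X →
      C1Norm 𝒜 (fun x => X x - X₀ x) < ENNReal.ofReal η → ∀ ξ : Cotangent n M, ξ.2 ≠ 0 →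
        |meanRate X X₀ b J Δ ξ - meanRate X₀ X₀ b J Δ ξ| ≤ κ * η := by
  have hX₁ : IsCk 1 X₀ := hX₀.of_le (by norm_cast)
  choose κ hκ0 hκ using fun i : ℕ => abs_rate_sub_le g 𝒜 hX₁
    (b := pullFamily X₀ b ((i + 1) * Δ))
    (fun j => (hX₀.pullField_infty (hb j) _).of_le (by norm_cast))
    (K := K * Real.exp (Λ * |((i : ℝ) + 1) * Δ|))
    (one_le_mul_of_one_le_of_one_le hK (Real.one_le_exp (by positivity)))
    (hf.pullFamily g hX₁ hΛ (by linarith) _)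
  refine ⟨∑ i ∈ Finset.range J, κ i, Finset.sum_nonneg fun i _ => hκ0 i,
    fun X η hX hη ξ hξ => ?_⟩
  have hη0 : 0 ≤ η := by
    by_contra h
    rw [ENNReal.ofReal_of_nonpos (not_le.1 h).le] at hη
    exact absurd hη (by simp)
  rw [meanRate, meanRate, ← mean_sub]
  refine abs_mean_le hJ fun i hi => (hκ i X η hX hη ξ hξ).trans ?_
  gcongr
  exact Finset.single_le_sum (fun j _ => hκ0 j) (Finset.mem_range.2 hi)

theorem hasDerivAt_comp_lift {X : VField n M} (hX : IsCk 1 X) {F : Cotangent n M → ℝ} {d t : ℝ}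
    {ξ : Cotangent n M} (h : HasDerivAt (fun s => F (lift X s (lift X t ξ))) d 0) :
    HasDerivAt (fun s => F (lift X s ξ)) d t := by
  rw [← sub_self t] at h
  have h3 := HasDerivAt.comp (h := fun s => s - t) t h ((hasDerivAt_id t).sub_const t)
  rw [mul_one] at h3
  refine h3.congr_of_eventuallyEq (Eventually.of_forall fun s => ?_)
  simp only [Function.comp_apply]
  rw [← lift_add hX, sub_add_cancel]

/-- Along X₀ itself the two flows commute, so the mean rate is a Riemann sum for the derivative of L
over the window J Δ. The uniform Lipschitz bound of `exists_rate_bound` makes its error proportional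
to the step Δ. -/
theorem abs_meanRate_sub_slope_le (𝒜 : ChartCover n M) (hX₀ : IsCk ∞ X₀)
    (hb : ∀ i, IsCk ∞ (b i)) {K : ℝ} (hK : 1 ≤ K) (hf : IsFrame g b K) :
    ∃ B, 0 < B ∧ ∀ ξ : Cotangent n M, ξ.2 ≠ 0 →
      (∀ s t, |logSum b (lift X₀ s ξ) - logSum b (lift X₀ t ξ)| ≤ B * |s - t|) ∧
      ∀ (J : ℕ) (Δ : ℝ), 0 < J → Δ ≠ 0 →
      |meanRate X₀ X₀ b J Δ ξ -
        (logSum b (lift X₀ (J * Δ) ξ) - logSum b ξ) / (J * Δ)| ≤ B * |Δ| := by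
  have hX₁ : IsCk 1 X₀ := hX₀.of_le (by norm_cast)
  obtain ⟨B, hB0, hB⟩ := exists_rate_bound g 𝒜 hX₀ hb hK hf
  refine ⟨B, hB0, fun ξ hξ => ?_⟩
  have hL : ∀ t, HasDerivAt (fun t => logSum b (lift X₀ t ξ)) (rate X₀ b (lift X₀ t ξ)) t :=
    fun t => hasDerivAt_comp_lift hX₁ (hasDerivAt_logSum hX₁ (fun i => (hb i).of_le (by norm_cast))
      (hf.sqSum_pos g (lift_ne_zero hX₁ t hξ)))
  have hlip : ∀ s t, |rate X₀ b (lift X₀ s ξ) - rate X₀ b (lift X₀ t ξ)| ≤ B * |s - t| := by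
    intro s t
    choose d hd hdB using fun t => (hB _ (lift_ne_zero hX₁ t hξ)).2
    exact Convex.norm_image_sub_le_of_norm_hasDerivWithin_le (𝕜 := ℝ) (s := univ)
      (f := fun r => rate X₀ b (lift X₀ r ξ)) (f' := d)
      (fun r _ => (hasDerivAt_comp_lift hX₁ (hd r)).hasDerivWithinAt) (fun r _ => hdB r) convex_univ
      (mem_univ t) (mem_univ s)
  refine ⟨fun s t => ?_, fun J Δ hJ hΔ => ?_⟩
  · exact Convex.norm_image_sub_le_of_norm_hasDerivWithin_le (𝕜 := ℝ) (s := univ)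
      (f := fun r => logSum b (lift X₀ r ξ)) (f' := fun r => rate X₀ b (lift X₀ r ξ))
      (fun r _ => (hL r).hasDerivWithinAt) (fun r _ => (hB _ (lift_ne_zero hX₁ r hξ)).1)
      convex_univ (mem_univ t) (mem_univ s)
  · have h := abs_mean_deriv_sub_le hL hB0.le hlip hJ hΔ
    rw [lift_zero hX₁] at h
    have e : meanRate X₀ X₀ b J Δ ξ = mean (fun t => rate X₀ b (lift X₀ t ξ)) J Δ := by
      simp only [meanRate]
      congr 1
      funext t
      exact rate_pullFamily g hX₀ hb hf t hξ
    rw [e]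
    exact h

theorem IsFrame.isOpen_ne_zero (hb : ∀ i, IsCk 0 (b i)) {K : ℝ} (hf : IsFrame g b K) :
    IsOpen {ξ : Cotangent n M | ξ.2 ≠ 0} := by
  have : {ξ : Cotangent n M | ξ.2 ≠ 0} = {ξ | 0 < sqSum b ξ} := by
    ext ξ
    refine ⟨fun h => hf.sqSum_pos g h, fun h h0 => ?_⟩
    have h1 := (hf ξ).2
    rw [conorm_eq_zero g h0, mul_zero] at h1
    exact absurd (Real.sqrt_pos.2 h) (not_lt.2 h1)
  rw [this]
  exact isOpen_lt continuous_const (continuous_finsetSum _ fun i _ =>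
    ((hb i).continuous_symbol).pow 2)

theorem continuousOn_meanSum_lift (hX₀ : IsCk ∞ X₀) (hb : ∀ i, IsCk ∞ (b i)) {K : ℝ}
    (hf : IsFrame g b K) {X : VField n M} (hX : IsCk 1 X) (J : ℕ) (Δ t : ℝ) :
    ContinuousOn (fun ξ => meanSum X₀ b J Δ (lift X t ξ)) {ξ : Cotangent n M | ξ.2 ≠ 0} := by
  have hX₁ : IsCk 1 X₀ := hX₀.of_le (by norm_cast)
  refine ContinuousOn.mul continuousOn_const (continuousOn_finsetSum _ fun i _ =>
    ContinuousOn.mul continuousOn_const (ContinuousOn.log ?_ fun ξ hξ => ?_))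
  · exact (IsCk.continuous_sqSum_lift hX (b := pullFamily X₀ b ((i + 1) * Δ))
      (fun j => (hX₀.pullField_infty (hb j) _).of_le (by norm_cast)) t).continuousOn
  · exact (hf.sqSum_pos g (lift_ne_zero hX₁ _ (lift_ne_zero hX t hξ))).ne'

/-- Away from the zero section it is a finite combination of logarithms of positive sums of squares
of symbols of smooth fields. -/
theorem contMDiffOn_meanSum (hX₀ : IsCk ∞ X₀) (hb : ∀ i, IsCk ∞ (b i)) {K : ℝ}
    (hf : IsFrame g b K) (J : ℕ) (Δ : ℝ) :
    ContMDiffOn ((𝓡 n).prod 𝓘(ℝ, Model n →L[ℝ] ℝ)) 𝓘(ℝ, ℝ) ∞ (meanSum X₀ b J Δ)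
      {ξ : Cotangent n M | ξ.2 ≠ 0} := by
  have hX₁ : IsCk 1 X₀ := hX₀.of_le (by norm_cast)
  intro ξ hξ
  refine ContMDiffAt.contMDiffWithinAt ?_
  have hsq : ∀ i : ℕ, ContMDiff ((𝓡 n).prod 𝓘(ℝ, Model n →L[ℝ] ℝ)) 𝓘(ℝ, ℝ) ∞
      (sqSum (pullFamily X₀ b ((i + 1) * Δ)) : Cotangent n M → ℝ) := fun i =>
    contMDiff_finsetSum fun j _ =>
      (IsCk.contMDiff_symbol (hX₀.pullField_infty (hb j) ((i + 1) * Δ))).pow 2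
  refine contMDiffAt_const.mul (contMDiffAt_finsetSum fun i _ => contMDiffAt_const.mul ?_)
  have h := (hf.sqSum_pos g (lift_ne_zero hX₁ ((i + 1) * Δ) hξ)).ne'
  exact ContDiffAt.comp_contMDiffAt (g := Real.log) (Real.contDiffAt_log.2 h) (hsq i ξ)

theorem meanSum_scale (hX₀ : IsCk ∞ X₀) {K : ℝ} (hf : IsFrame g b K) {J : ℕ} (hJ : 0 < J)
    (Δ : ℝ) {r : ℝ} (hr : 0 < r) {ξ : Cotangent n M} (hξ : ξ.2 ≠ 0) :
    meanSum X₀ b J Δ (scale r ξ) = Real.log r + meanSum X₀ b J Δ ξ := by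
  have hX₁ : IsCk 1 X₀ := hX₀.of_le (by norm_cast)
  rw [meanSum, meanSum, ← mean_add_const _ hJ]
  congr 1
  funext t
  rw [lift_scale, logSum_scale hr (hf.sqSum_pos g (lift_ne_zero hX₁ t hξ))]

theorem IsFrame.abs_logSum_sub_le {K : ℝ} (hK : 0 < K) (hf : IsFrame g b K)
    {ξ : Cotangent n M} (hξ : ξ.2 ≠ 0) : |logSum b ξ - Real.log (conorm g ξ)| ≤ Real.log K := by
  have h1 := conorm_pos g hξ
  have h2 := Real.sqrt_pos.2 (hf.sqSum_pos g hξ)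
  have h3 := Real.log_le_log h1 (hf ξ).1
  have h4 := Real.log_le_log h2 (hf ξ).2
  rw [Real.log_mul hK.ne' h2.ne'] at h3
  rw [Real.log_mul hK.ne' h1.ne'] at h4
  rw [logSum_eq, abs_le]
  constructor <;> linarith

/-- The times of the average are bounded, so it differs from the logarithm of the norm by a bounded
amount a. Comparison at both ends of an orbit yields the constant exp(2 a) of the sink. -/
theorem exists_abs_meanSum_sub_le (hX₀ : IsCk ∞ X₀) {K Λ : ℝ} (hK : 1 ≤ K) (hf : IsFrame g b K)
    (hΛ0 : 0 ≤ Λ) (hΛ : HasGrowthRate g X₀ Λ) {J : ℕ} (hJ : 0 < J) (Δ : ℝ) :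
    ∃ a, ∀ ξ : Cotangent n M, ξ.2 ≠ 0 → |meanSum X₀ b J Δ ξ - Real.log (conorm g ξ)| ≤ a := by
  have hX₁ : IsCk 1 X₀ := hX₀.of_le (by norm_cast)
  refine ⟨Real.log (K * Real.exp (Λ * |J * Δ|)), fun ξ hξ => ?_⟩
  have h := mean_add_const (fun t => logSum b (lift X₀ t ξ)) hJ Δ (-Real.log (conorm g ξ))
  rw [meanSum, show ∀ x y : ℝ, x - y = -y + x from fun x y => by ring, ← h]
  refine abs_mean_le hJ fun i hi => ?_
  have h1 := (hf.pullFamily g hX₁ hΛ (by linarith) ((i + 1) * Δ)).abs_logSum_sub_le g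
    (by positivity) hξ
  rw [show ∀ x y : ℝ, -y + x = x - y from fun x y => by ring]
  refine h1.trans (Real.log_le_log (by positivity) ?_)
  have h2 : |((i : ℝ) + 1) * Δ| ≤ |J * Δ| := by
    rw [abs_mul, abs_mul, abs_of_nonneg (by positivity : (0 : ℝ) ≤ i + 1), Nat.abs_cast]
    have : ((i : ℝ) + 1) ≤ J := by exact_mod_cast hi
    gcongr
  gcongr

/-- The unit cosphere bundle is compact. -/
theorem IsFrame.isCompact_sphere (𝒜 : ChartCover n M) (hb : ∀ i, IsCk 0 (b i)) {K : ℝ}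
    (hK : 0 ≤ K) (hf : IsFrame g b K) : IsCompact {ξ : Cotangent n M | sqSum b ξ = 1} := by
  obtain ⟨κ, hκ1, hκ⟩ := exists_coord_bound g 𝒜
  let e : M → Trivialization (Model n →L[ℝ] ℝ) (π (Model n →L[ℝ] ℝ)
      (fun x : M => TangentSpace (𝓡 n) x →L[ℝ] Bundle.Trivial M ℝ x)) := fun c =>
    trivializationAt (Model n →L[ℝ] ℝ)
      (fun x : M => TangentSpace (𝓡 n) x →L[ℝ] Bundle.Trivial M ℝ x) c
  have hbase : ∀ c ∈ 𝒜.centers, ∀ x ∈ 𝒜.K c, x ∈ (e c).baseSet := by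
    intro c hc x hx
    simp only [e, hom_trivializationAt_baseSet]
    exact ⟨mem_baseSet (𝒜.subset_source c hc hx), by simp⟩
  have hcomp : IsCompact (⋃ c ∈ 𝒜.centers, (e c).toOpenPartialHomeomorph.symm ''
      (𝒜.K c ×ˢ Metric.closedBall (0 : Model n →L[ℝ] ℝ) (K * κ))) := by
    -- The sphere lies in a finite union of images, under local trivializations, of compact sets
    -- times closed balls of covectors.
    refine 𝒜.centers.isCompact_biUnion fun c hc => ?_
    refine ((𝒜.isCompact c hc).prod (isCompact_closedBall _ _)).image_of_continuousOn
      ((e c).toOpenPartialHomeomorph.continuousOn_symm.mono fun p hp => ?_)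
    exact (e c).mem_target.2 (hbase c hc _ hp.1)
  refine hcomp.of_isClosed_subset (isClosed_eq (continuous_finsetSum _ fun i _ =>
    ((hb i).continuous_symbol).pow 2) continuous_const) fun ξ hξ => ?_
  obtain ⟨c, hc, hx⟩ := 𝒜.covers ξ.1
  have hs := 𝒜.subset_source c hc hx
  have hsrc : ξ ∈ (e c).source := (e c).mem_source.2 (hbase c hc _ hx)
  refine mem_biUnion hc ⟨e c ξ, ⟨?_, ?_⟩, (e c).toOpenPartialHomeomorph.left_inv hsrc⟩
  · rw [(e c).coe_fst hsrc]
    exact hx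
  · rw [mem_closedBall_zero_iff]
    refine ContinuousLinearMap.opNorm_le_bound _ (by positivity) fun w => ?_
    have h1 : (e c ξ).2 w = ξ.2 (uncoord c ξ.1 w) := by
      simp only [e]
      rw [hom_trivializationAt_apply]
      change ContinuousLinearMap.inCoordinates (Model n) (TangentSpace (𝓡 n)) ℝ
        (Bundle.Trivial M ℝ) c ξ.1 c ξ.1 ξ.2 w = _
      rw [ContinuousLinearMap.inCoordinates_eq (mem_baseSet hs) (by simp)]
      simp only [ContinuousLinearMap.comp_apply]
      have h : uncoord c ξ.1 w =
          (trivializationAt (Model n) (TangentSpace (𝓡 n) : M → Type _) c).symm ξ.1 w :=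
        Trivialization.symmL_apply (R := ℝ) _ (mem_baseSet hs) w
      rw [h]
      simp
    rw [h1]
    have hξ1 := (hf ξ).1
    have hξ' : sqSum b ξ = 1 := hξ
    rw [hξ', Real.sqrt_one, mul_one] at hξ1
    have h2 := (hκ c hc _ hx (uncoord c ξ.1 w)).2
    rw [coord_uncoord hs] at h2
    calc _ ≤ conorm g ξ * vnorm g (uncoord c ξ.1 w) := abs_apply_le g ξ _
      _ ≤ K * (κ * ‖w‖) := mul_le_mul hξ1 h2 (vnorm_nonneg g _) hK
      _ = _ := by ring

end MeanSum

/-- A function which increases whenever it takes the value `k` stays above `k`. -/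
theorem lt_of_deriv_pos_of_eq {f f' : ℝ → ℝ} {k : ℝ} (hf : ∀ t, HasDerivAt f (f' t) t)
    (h : ∀ t, f t = k → 0 < f' t) {s t : ℝ} (hst : s < t) (hs : k ≤ f s) : k < f t := by
  have key : ∀ {f f' : ℝ → ℝ} {k : ℝ}, (∀ t, HasDerivAt f (f' t) t) →
      (∀ t, f t = k → 0 < f' t) → ∀ s t, s ≤ t → k ≤ f s → k ≤ f t := by
    intro f f' k hf h s t hst hs
    have := image_le_of_deriv_right_lt_deriv_boundary (f := fun x => -f x) (f' := fun x => -f' x)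
      (a := s) (b := t) (B := fun _ => -k) (B' := fun _ => 0)
      (fun x _ => (hf x).neg.continuousAt.continuousWithinAt)
      (fun x _ => (hf x).neg.hasDerivWithinAt) (neg_le_neg hs)
      (fun x => hasDerivAt_const x _)
      (fun x _ hx => neg_lt_zero.2 (h x (neg_injective hx))) (right_mem_Icc.2 hst)
    linarith
  by_contra hcon
  -- If f t ≤ k, the barrier in reversed time forces f ≤ k before t. With the forward barrier, f is
  -- constantly k on an interval, where its derivative cannot be positive.
  have hrev : ∀ r ≤ t, f r ≤ k := by
    intro r hr
    have := key (f := fun x => -f (-x)) (f' := fun x => f' (-x)) (k := -k)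
      (fun x => (((hf (-x)).comp x (hasDerivAt_neg x)).neg).congr_deriv (by simp))
      (fun x hx => h _ (neg_injective hx)) (-t) (-r) (neg_le_neg hr)
      (by rw [neg_neg]; linarith)
    rw [neg_neg] at this
    linarith
  have hmid : f =ᶠ[𝓝 ((s + t) / 2)] fun _ => k := by
    filter_upwards [Ioo_mem_nhds (show s < (s + t) / 2 by linarith)
      (show (s + t) / 2 < t by linarith)] with r hr
    exact le_antisymm (hrev r hr.2.le) (key hf h s r hr.1.le hs)
  have h0 := (hf _).unique ((hasDerivAt_const _ k).congr_of_eventuallyEq hmid)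
  have h1 := h _ hmid.self_of_nhds
  rw [h0] at h1
  exact lt_irrefl _ h1

theorem le_sub_of_le_deriv {f f' : ℝ → ℝ} {δ s t : ℝ} (hf : ∀ t, HasDerivAt f (f' t) t)
    (hst : s ≤ t) (h : ∀ r, s ≤ r → r ≤ t → δ ≤ f' r) : δ * (t - s) ≤ f t - f s :=
  (convex_Icc s t).mul_sub_le_image_sub_of_le_deriv
    (fun x _ => (hf x).continuousAt.continuousWithinAt)
    (fun x _ => (hf x).differentiableAt.differentiableWithinAt)
    (fun x hx => by
      rw [interior_Icc] at hx
      rw [(hf x).deriv]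
      exact h x hx.1.le hx.2.le) s (left_mem_Icc.2 hst) t (right_mem_Icc.2 hst) hst

/-! ### Sinks as sets of trapped orbits. -/

section Sink

variable {n : ℕ} {M : Type*} [TopologicalSpace M] [ChartedSpace (Model n) M]
  [IsManifold (𝓡 n) ∞ M] (g : Metric n M) {ι : Type*} [Fintype ι]
  [CompactSpace M] [T2Space M] {b : ι → VField n M}

/-- The set of covectors which are either zero or whose orbit stays in `{k ≤ G}`. -/
def trapped (X : VField n M) (G : Cotangent n M → ℝ) (k : ℝ) : Set (Cotangent n M) :=
  {ξ | ξ.2 ≠ 0 → ∀ t, k ≤ G (lift X t ξ)}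

theorem lift_ne_zero_iff {X : VField n M} (hX : IsCk 1 X) (t : ℝ) (ξ : Cotangent n M) :
    (lift X t ξ).2 ≠ 0 ↔ ξ.2 ≠ 0 := by
  refine ⟨fun h h0 => h ?_, lift_ne_zero hX t⟩
  rw [lift, h0]
  exact ContinuousLinearMap.zero_comp _

theorem scale_ne_zero {r : ℝ} (hr : 0 < r) {ξ : Cotangent n M} : (scale r ξ).2 ≠ 0 ↔ ξ.2 ≠ 0 :=
  not_congr (smul_eq_zero_iff_right hr.ne')

theorem scale_scale (r r' : ℝ) (ξ : Cotangent n M) : scale r (scale r' ξ) = scale (r * r') ξ :=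
  congrArg (TotalSpace.mk ξ.1) (smul_smul r r' ξ.2)

theorem scale_one (ξ : Cotangent n M) : scale 1 ξ = ξ :=
  congrArg (TotalSpace.mk ξ.1) (one_smul ℝ ξ.2)

/-- The symbol of X is conserved, but it is bounded by the norm of the covector, which decays
exponentially in the past on the invariant set L. -/
theorem IsSink.symbol_eq_zero (𝒜 : ChartCover n M) {X : VField n M} (hX : IsCk 1 X)
    {L U : Set (Cotangent n M)} {C β : ℝ} (h : IsSink g (lift X) L U C β) {ξ : Cotangent n M}
    (hξ : ξ ∈ L) : symbol X ξ = 0 := by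
  by_cases h0 : ξ.2 = 0
  · rw [symbol, h0]
    rfl
  obtain ⟨B, hB1, hB⟩ := exists_vnorm_le g 𝒜 hX
  have hC := h.C_pos
  have hle : ∀ t : ℝ, 0 < t →
      |symbol X ξ| ≤ B * C * conorm g ξ * Real.exp (-(β * t)) := by
    intro t ht
    have h1 := h.growth (lift X (-t) ξ) (h.nhd.2 _ (h.invariant _ _ hξ) (lift_ne_zero hX _ h0))
      t ht
    rw [← lift_add hX, add_neg_cancel, lift_zero hX] at h1
    have h2 : conorm g (lift X (-t) ξ) ≤ C * conorm g ξ * Real.exp (-(β * t)) := by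
      rw [Real.exp_neg, ← div_eq_mul_inv, le_div_iff₀ (Real.exp_pos _)]
      rw [one_div, mul_assoc, inv_mul_le_iff₀ hC] at h1
      linarith
    rw [← symbol_self_lift hX (-t) ξ]
    refine (abs_symbol_le g X _).trans ?_
    calc _ ≤ (C * conorm g ξ * Real.exp (-(β * t))) * B :=
          mul_le_mul h2 (hB _) (vnorm_nonneg g _) ((conorm_nonneg g _).trans h2)
      _ = _ := by ring
  have hlim : Tendsto (fun t : ℝ => B * C * conorm g ξ * Real.exp (-(β * t))) atTop (𝓝 0) := by
    rw [← mul_zero (B * C * conorm g ξ)]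
    exact (Real.tendsto_exp_neg_atTop_nhds_zero.comp
      (tendsto_id.const_mul_atTop h.beta_pos)).const_mul _
  have := ge_of_tendsto hlim ((eventually_gt_atTop 0).mono hle)
  exact abs_nonpos_iff.1 this

/-- Positivity of the derivative of G on the level {G = k} makes {G ≥ k} forward invariant, and
entered strictly at later times. The growth inequality is the integral of the derivative of the
logarithmic norm A, which remains at least β there. -/
theorem isSink_trapped (𝒜 : ChartCover n M) (hb : ∀ i, IsCk 0 (b i)) {K : ℝ} (hK : 0 ≤ K)
    (hf : IsFrame g b K) {X : VField n M} (hX : IsCk 1 X) {G G' A A' : Cotangent n M → ℝ}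
    {k a β C : ℝ}
    (hGc : ∀ t, ContinuousOn (fun ξ => G (lift X t ξ)) {ξ : Cotangent n M | ξ.2 ≠ 0})
    (hGs : ∀ r : ℝ, 0 < r → ∀ ξ : Cotangent n M, ξ.2 ≠ 0 → G (scale r ξ) = G ξ)
    (hG : ∀ ξ : Cotangent n M, ξ.2 ≠ 0 → HasDerivAt (fun t => G (lift X t ξ)) (G' ξ) 0)
    (hGk : ∀ ξ : Cotangent n M, ξ.2 ≠ 0 → G ξ = k → 0 < G' ξ)
    (hA : ∀ ξ : Cotangent n M, ξ.2 ≠ 0 → HasDerivAt (fun t => A (lift X t ξ)) (A' ξ) 0)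
    (hAk : ∀ ξ : Cotangent n M, ξ.2 ≠ 0 → k ≤ G ξ → β ≤ A' ξ)
    (hAa : ∀ ξ : Cotangent n M, ξ.2 ≠ 0 → |A ξ - Real.log (conorm g ξ)| ≤ a)
    (hβ : 0 < β) (hC : Real.exp (2 * a) ≤ C) :
    IsSink g (lift X) (trapped X G k) {ξ | ξ.2 ≠ 0 ∧ k < G ξ} C β := by
  have hC0 : 0 < C := (Real.exp_pos _).trans_le hC
  have hnz := hf.isOpen_ne_zero g hb
  have hmono : ∀ (ξ : Cotangent n M), ξ.2 ≠ 0 → ∀ s t, s < t → k ≤ G (lift X s ξ) →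
      k < G (lift X t ξ) := fun ξ hξ s t hst hs =>
    lt_of_deriv_pos_of_eq (f := fun t => G (lift X t ξ)) (f' := fun t => G' (lift X t ξ))
      (fun t => hasDerivAt_comp_lift hX (hG _ (lift_ne_zero hX t hξ)))
      (fun t => hGk _ (lift_ne_zero hX t hξ)) hst hs
  have hG0 : ∀ {ξ : Cotangent n M}, G (lift X 0 ξ) = G ξ := by
    intro ξ
    rw [lift_zero hX]
  have hmono0 : ∀ (ξ : Cotangent n M), ξ.2 ≠ 0 → k < G ξ → ∀ t, 0 ≤ t → k < G (lift X t ξ) := by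
    intro ξ hξ h t ht
    rcases ht.eq_or_lt with rfl | ht
    · rwa [hG0]
    · exact hmono ξ hξ 0 t ht (by rw [hG0]; exact h.le)
  refine ⟨hC0, hβ, ?_, ?_, ?_, ⟨⟨?_, fun ξ h => h.1, ?_⟩, ?_⟩, ?_, ?_⟩
  -- The zero section belongs to the trapped set by definition, so the complement is a union of open
  -- sets of nonzero covectors.
  · have : (trapped X G k)ᶜ = ⋃ t, ({ξ : Cotangent n M | ξ.2 ≠ 0} ∩
        (fun ξ => G (lift X t ξ)) ⁻¹' Iio k) := by
      ext ξ
      simp only [trapped, mem_compl_iff, mem_iUnion, mem_inter_iff, mem_preimage, mem_Iio,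
        Set.mem_ofPred_eq]
      push Not
      exact ⟨fun ⟨h, t, ht⟩ => ⟨t, h, ht⟩, fun ⟨t, h, ht⟩ => ⟨h, t, ht⟩⟩
    rw [← isOpen_compl_iff, this]
    exact isOpen_iUnion fun t => (hGc t).isOpen_inter_preimage hnz isOpen_Iio
  · intro r hr ξ hξ h0 t
    have h0' := (scale_ne_zero hr).1 h0
    rw [lift_scale, hGs r hr _ (lift_ne_zero hX t h0')]
    exact hξ h0' t
  · intro t ξ hξ h0 s
    rw [← lift_add hX]
    exact hξ ((lift_ne_zero_iff hX t ξ).1 h0) _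
  · have h := (hGc 0).isOpen_inter_preimage hnz (isOpen_Ioi (a := k))
    simp only [hG0] at h
    exact h
  · intro r hr ξ hξ
    exact ⟨(scale_ne_zero hr).2 hξ.1, by rw [hGs r hr ξ hξ.1]; exact hξ.2⟩
  · intro ξ hξ h0
    refine ⟨h0, ?_⟩
    rw [← hG0]
    exact hmono ξ h0 (-1) 0 (by norm_num) (hξ h0 _)
  · intro ξ hξ t ht
    have h1 := le_sub_of_le_deriv (f := fun t => A (lift X t ξ)) (f' := fun t => A' (lift X t ξ))
      (δ := β) (fun t => hasDerivAt_comp_lift hX (hA _ (lift_ne_zero hX t hξ.1))) ht.le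
      (fun r hr _ => hAk _ (lift_ne_zero hX r hξ.1) (hmono0 ξ hξ.1 hξ.2 r hr).le)
    simp only [lift_zero hX, sub_zero] at h1
    have h2 := abs_le.1 (hAa ξ hξ.1)
    have h3 := abs_le.1 (hAa _ (lift_ne_zero hX t hξ.1))
    have h4 := conorm_pos g hξ.1
    have h5 := conorm_pos g (lift_ne_zero hX t hξ.1)
    have h6 : Real.exp (β * t + Real.log (conorm g ξ)) ≤
        Real.exp (2 * a + Real.log (conorm g (lift X t ξ))) := Real.exp_le_exp.2 (by linarith)
    rw [Real.exp_add, Real.exp_log h4, Real.exp_add, Real.exp_log h5] at h6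
    rw [one_div, mul_assoc, inv_mul_le_iff₀ hC0]
    exact h6.trans (by gcongr)
  · intro W hW
    have hcomp : IsCompact ({ξ : Cotangent n M | sqSum b ξ = 1} ∩ Wᶜ) :=
      (hf.isCompact_sphere g 𝒜 hb hK).inter_right hW.1.isOpen.isClosed_compl
    have hS0 : ∀ ξ : Cotangent n M, sqSum b ξ = 1 → ξ.2 ≠ 0 := by
      intro ξ h h0
      have : sqSum b ξ = 0 := by
        simp only [sqSum, symbol, h0]
        simp
      linarith
    -- A unit covector outside W is not trapped, so it has G < k at some time, and then at all
    -- earlier ones by forward invariance. Compactness provides one time -N at which this holds for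
    -- all of them.
    obtain ⟨N, hN⟩ := hcomp.elim_directed_cover
      (fun N : ℕ => {ξ : Cotangent n M | ξ.2 ≠ 0} ∩ (fun ξ => G (lift X (-(N : ℝ)) ξ)) ⁻¹' Iio k)
      (fun N => (hGc _).isOpen_inter_preimage hnz isOpen_Iio)
      (fun ξ hξ => by
        have h0 := hS0 ξ hξ.1
        have h1 : ξ ∉ trapped X G k := fun h => hξ.2 (hW.2 ξ h h0)
        simp only [trapped, Set.mem_ofPred_eq] at h1
        push Not at h1
        obtain ⟨-, t, ht⟩ := h1
        obtain ⟨N, hN⟩ := exists_nat_gt (-t)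
        refine mem_iUnion.2 ⟨N, h0, ?_⟩
        by_contra hcon
        exact absurd (hmono ξ h0 _ t (by linarith) (not_lt.1 hcon)) (not_lt.2 ht.le))
      (monotone_nat_of_le_succ fun N ξ hξ => ⟨hξ.1, by
        by_contra hcon
        have h2 := hmono ξ hξ.1 _ (-(N : ℝ)) (by push_cast; linarith) (not_lt.1 hcon)
        exact absurd hξ.2 (not_lt.2 h2.le)⟩).directed_le
    -- If Φ_t ξ were outside W, its image at time -N would have G < k; but this is a point of the
    -- forward orbit of ξ, where G > k.
    filter_upwards [eventually_ge_atTop (N : ℝ)] with t ht ξ hξ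
    by_contra hcon
    have h0 := lift_ne_zero hX t hξ.1
    have hpos := Real.sqrt_pos.2 (hf.sqSum_pos g h0)
    have h1 : scale (√(sqSum b (lift X t ξ)))⁻¹ (lift X t ξ) ∈
        {ξ : Cotangent n M | sqSum b ξ = 1} ∩ Wᶜ := by
      constructor
      · change sqSum b _ = 1
        rw [sqSum_scale, inv_pow, Real.sq_sqrt (sqSum_nonneg b _),
          inv_mul_cancel₀ (hf.sqSum_pos g h0).ne']
      · intro h
        have := hW.1.scale_mem _ hpos _ h
        rw [scale_scale, mul_inv_cancel₀ hpos.ne', scale_one] at this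
        exact hcon this
    have h2 := (hN h1).2
    rw [mem_preimage, lift_scale, ← lift_add hX,
      hGs _ (inv_pos.2 hpos) _ (lift_ne_zero hX _ hξ.1)] at h2
    exact absurd (hmono0 ξ hξ.1 hξ.2 (-(N : ℝ) + t) (by linarith)) (not_lt.2 h2.le)

end Sink

/-! ### Symmetric versions of the scalar estimates, and the slope over a long window. -/

section Scalar

variable {β e B Δ S : ℝ} {L : ℝ → ℝ} {J : ℕ}

theorem one_le_of_abs_oddMean_mem (hβ : 0 < β) (he : 0 ≤ e) (hΔ : 0 ≤ Δ) (hJ : 0 < J)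
    (hS : 14 * e + 6 ≤ β * (J * Δ)) (hT : Trichotomy β e L) (h1 : 3 * e + 1 ≤ |oddMean L J Δ|)
    (h2 : |oddMean L J Δ| ≤ 3 * e + 2) : 1 ≤ L (J * Δ) - 2 * L 0 + L (-(J * Δ)) := by
  rcases le_total 0 (oddMean L J Δ) with h | h
  · rw [abs_of_nonneg h] at h1 h2
    exact one_le_of_oddMean_mem hβ he hΔ hJ hS hT h1 h2
  · rw [abs_of_nonpos h, ← oddMean_neg] at h1 h2
    have := one_le_of_oddMean_mem hβ he hΔ hJ hS hT.neg h1 h2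
    simp only [neg_neg, neg_zero] at this
    linarith

theorem one_le_of_growsFrom_zero_or (hβ : 0 < β) (he : 0 ≤ e) (hΔ : 0 ≤ Δ) (hJ : 0 < J)
    (hS : 14 * e + 6 ≤ β * (J * Δ)) (hT : Trichotomy β e L)
    (h0 : GrowsFrom β e L 0 ∨ GrowsFrom β e (fun s => L (-s)) 0)
    (h : |oddMean L J Δ| ≤ 3 * e + 2) : 1 ≤ L (J * Δ) - 2 * L 0 + L (-(J * Δ)) := by
  rw [abs_le] at h
  rcases h0 with h0 | h0
  · exact one_le_of_growsFrom_zero hβ he hΔ hJ hS hT h0 h.2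
  · have := one_le_of_growsFrom_zero hβ he hΔ hJ hS hT.neg h0 (by rw [oddMean_neg]; linarith)
    simp only [neg_neg, neg_zero] at this
    linarith

/-- Growth starts at some τ ≤ J Δ, and before τ the loss is at most B τ. The long window S is chosen
so that this loss, the delay β τ and the error e together cost only β S / 16. -/
theorem mul_le_sub_of_le_oddMean (hβ : 0 < β) (he : 0 ≤ e) (hΔ : 0 ≤ Δ) (hJ : 0 < J)
    (hT : Trichotomy β e L) (hB : 0 ≤ B) (hL : ∀ s t, |L s - L t| ≤ B * |s - t|)
    (hS : J * Δ ≤ S) (hS' : β * (J * Δ) + B * (J * Δ) + e ≤ β / 16 * S)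
    (h : 3 * e + 1 ≤ oddMean L J Δ) : 15 / 16 * β * S ≤ L S - L 0 := by
  obtain ⟨τ, h0, h1, h2, -⟩ := growsFrom_of_le_oddMean hβ he hΔ hJ hT h
  have h3 := h2 τ S le_rfl (by linarith)
  have h4 := (abs_le.1 (hL τ 0)).1
  rw [sub_zero, abs_of_nonneg h0] at h4
  have h5 : B * τ ≤ B * (J * Δ) := by gcongr
  have h6 : β * τ ≤ β * (J * Δ) := by gcongr
  linarith

end Scalar

/-! ### The escape function and its robustness under C¹ perturbation. -/

section Lyapunov

variable {n : ℕ} {M : Type*} [TopologicalSpace M] [ChartedSpace (Model n) M]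
  [IsManifold (𝓡 n) ∞ M] (g : Metric n M) [CompactSpace M] [T2Space M] [Nonempty M]
  {ι : Type*} [Fintype ι] {b : ι → VField n M} {X₀ : VField n M}

theorem C1Norm_sub_self (𝒜 : ChartCover n M) (X : VField n M) :
    C1Norm 𝒜 (fun x => X x - X x) = 0 := by
  simp only [C1Norm, ENNReal.iSup_eq_zero]
  intro c hc y hy
  have hz := mem_target (𝒜.subset_source c hc hy)
  have e : localRep (fun x => X x - X x) c =ᶠ[𝓝 (extChartAt (𝓡 n) c y)] fun _ => 0 := by
    filter_upwards [(isOpen_extChartAt_target c).mem_nhds hz] with z hz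
    rw [localRep_sub X X hz, sub_self]
  rw [e.self_of_nhds, e.fderiv_eq, fderiv_fun_const]
  exact (congrArg₂ (· + ·) (enorm_zero (E := Model n))
    (enorm_zero (E := Model n →L[ℝ] Model n))).trans (add_zero 0)

/-- An escape function for the lifted flow of an Anosov vector field, and two logarithmic norms
which grow in the future and in the past, where the escape function is large. -/
structure IsLyapunov (𝒜 : ChartCover n M) (X₀ : VField n M) (G A A' : Cotangent n M → ℝ)
    (c δ β η : ℝ) : Prop where
  c_pos : 0 < c
  delta_pos : 0 < δ
  eta_pos : 0 < η
  smooth : ContMDiffOn ((𝓡 n).prod 𝓘(ℝ, Model n →L[ℝ] ℝ)) 𝓘(ℝ, ℝ) ∞ G {ξ | ξ.2 ≠ 0}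
  scale_eq : ∀ r : ℝ, 0 < r → ∀ ξ : Cotangent n M, ξ.2 ≠ 0 → G (scale r ξ) = G ξ
  bound : ∃ a, ∀ ξ : Cotangent n M, ξ.2 ≠ 0 →
    |A ξ - Real.log (conorm g ξ)| ≤ a ∧ |A' ξ - Real.log (conorm g ξ)| ≤ a
  continuousOn : ∀ X : VField n M, IsCk 1 X → ∀ t,
    ContinuousOn (fun ξ => G (lift X t ξ)) {ξ | ξ.2 ≠ 0}
  deriv : ∀ X : VField n M, IsCk 1 X → C1Norm 𝒜 (fun x => X x - X₀ x) < ENNReal.ofReal η →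
    ∃ dG dA dA' : Cotangent n M → ℝ, ∀ ξ : Cotangent n M, ξ.2 ≠ 0 →
      HasDerivAt (fun t => G (lift X t ξ)) (dG ξ) 0 ∧
      HasDerivAt (fun t => A (lift X t ξ)) (dA ξ) 0 ∧
      HasDerivAt (fun t => A' (lift X t ξ)) (dA' ξ) 0 ∧
      (c ≤ |G ξ| → |G ξ| ≤ c + 1 → δ ≤ dG ξ) ∧
      (symbol X ξ = 0 → |G ξ| ≤ c + 1 → δ ≤ dG ξ) ∧
      (c ≤ G ξ → 3 / 4 * β ≤ dA ξ) ∧ (G ξ ≤ -c → dA' ξ ≤ -(3 / 4 * β))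

/-- All the estimates are obtained for X₀ from the scalar lemmas, with room to spare. The step Δ of
the averages and then the radius η are chosen small enough for the discretisation and perturbation
errors to fit in that room. -/
theorem IsAnosov.exists_isLyapunov (𝒜 : ChartCover n M) (hX₀ : IsCk ∞ X₀)
    {Eu Es : (x : M) → Submodule ℝ (TangentSpace (𝓡 n) x)} {C β Λ : ℝ}
    (hA : IsAnosov g X₀ Eu Es C β) (hΛ0 : 0 ≤ Λ) (hΛ : HasMetricRate g X₀ Λ) :
    ∃ (G A A' : Cotangent n M → ℝ) (c δ η : ℝ), IsLyapunov g 𝒜 X₀ G A A' c δ β η := by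
  have hX₁ : IsCk 1 X₀ := hX₀.of_le (by norm_cast)
  have hβ := hA.beta_pos
  obtain ⟨b, K, hb, hK, hf⟩ := exists_isFrame g 𝒜
  obtain ⟨e, ν, he, hν, htri⟩ := hA.exists_trichotomy g hX₀ hΛ hK hf
  obtain ⟨B, hB0, hB⟩ := abs_meanRate_sub_slope_le g 𝒜 hX₀ hb hK hf
  have hgr := hΛ.hasGrowthRate g hX₁
  -- the two windows
  obtain ⟨S, hS0, hS⟩ : ∃ S, 0 < S ∧ 14 * e + 6 ≤ β * S :=
    ⟨(14 * e + 6) / β, by positivity, by field_simp; exact le_rfl⟩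
  obtain ⟨S₂, hS₂, hSS, hS₂'⟩ : ∃ S₂, 0 < S₂ ∧ S ≤ S₂ ∧ β * S + B * S + e ≤ β / 16 * S₂ := by
    refine ⟨S + (β * S + B * S + e) / (β / 16), by positivity, ?_, ?_⟩
    · exact le_add_of_nonneg_right (by positivity)
    · rw [mul_add, mul_div_cancel₀ _ (by positivity)]
      exact le_add_of_nonneg_left (by positivity)
  have hdiv : ∀ S q : ℝ, 0 < S → 0 < q → ∃ (J : ℕ) (Δ : ℝ), 0 < J ∧ 0 < Δ ∧ J * Δ = S ∧
      B * Δ ≤ q := by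
    intro S q hS hq
    obtain ⟨J, hJ⟩ := exists_nat_gt (B * S / q)
    have hJ0 : (0 : ℝ) < J := lt_of_le_of_lt (by positivity) hJ
    refine ⟨J, S / J, by exact_mod_cast hJ0, by positivity, mul_div_cancel₀ _ hJ0.ne', ?_⟩
    rw [div_lt_iff₀ hq] at hJ
    rw [← mul_div_assoc, div_le_iff₀ hJ0]
    linarith
  -- For G the slope is at least 1 / S = 4 / (4 S); the two discretisation errors and the
  -- perturbation cost 1 / (4 S) each, leaving δ = 1 / (4 S). For the logarithmic norms, 15/16 -
  -- 1/16 - 2/16 = 3/4.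
  obtain ⟨J, Δ, hJ, hΔ, hJS, hBΔ⟩ := hdiv S (1 / (4 * S)) hS0 (by positivity)
  obtain ⟨J₂, Δ₂, hJ₂, hΔ₂, hJS₂, hBΔ₂⟩ := hdiv S₂ (β / 16) hS₂ (by positivity)
  -- the perturbation bounds
  have hpert := fun J hJ Δ => abs_meanRate_sub_le g 𝒜 hX₀ hb hK hf hΛ0 hgr (J := J) hJ Δ
  obtain ⟨κ₁, hκ₁, h₁⟩ := hpert J hJ Δ
  obtain ⟨κ₂, hκ₂, h₂⟩ := hpert J hJ (-Δ)
  obtain ⟨κ₃, hκ₃, h₃⟩ := hpert J₂ hJ₂ Δ₂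
  obtain ⟨κ₄, hκ₄, h₄⟩ := hpert J₂ hJ₂ (-Δ₂)
  obtain ⟨κ₅, hκ₅, h₅⟩ := exists_abs_symbol_le g 𝒜
  obtain ⟨η, hη, e₁, e₂, e₃⟩ : ∃ η, 0 < η ∧ (κ₁ + κ₂) * η ≤ 1 / (4 * S) ∧
      (κ₃ + κ₄) * η ≤ β / 8 ∧ κ₅ * η < ν := by
    have hsmall : ∀ κ q : ℝ, 0 < q → ∀ᶠ η in 𝓝[>] (0 : ℝ), κ * η < q := by
      intro κ q hq
      have : Tendsto (fun η : ℝ => κ * η) (𝓝[>] 0) (𝓝 (κ * 0)) :=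
        (tendsto_id.const_mul κ).mono_left nhdsWithin_le_nhds
      rw [mul_zero] at this
      exact this.eventually_lt_const hq
    obtain ⟨η, ⟨⟨h1, h2⟩, h3⟩, h4⟩ := (((hsmall (κ₁ + κ₂) (1 / (4 * S)) (by positivity)).and
      (hsmall (κ₃ + κ₄) (β / 8) (by positivity))).and (hsmall κ₅ ν hν)).and
      self_mem_nhdsWithin |>.exists
    exact ⟨η, h4, h1.le, h2.le, h3⟩
  obtain ⟨a, ha⟩ := exists_abs_meanSum_sub_le g hX₀ hK hf hΛ0 hgr hJ₂ Δ₂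
  obtain ⟨a', ha'⟩ := exists_abs_meanSum_sub_le g hX₀ hK hf hΛ0 hgr hJ₂ (-Δ₂)
  refine ⟨fun ξ => meanSum X₀ b J Δ ξ - meanSum X₀ b J (-Δ) ξ, meanSum X₀ b J₂ Δ₂,
    meanSum X₀ b J₂ (-Δ₂), 3 * e + 1, 1 / (4 * S), η, by positivity, by positivity, hη,
    (contMDiffOn_meanSum g hX₀ hb hf J Δ).sub (contMDiffOn_meanSum g hX₀ hb hf J (-Δ)), ?_,
    ⟨max a a', fun ξ hξ => ⟨(ha ξ hξ).trans (le_max_left _ _),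
      (ha' ξ hξ).trans (le_max_right _ _)⟩⟩,
    fun X hX t => (continuousOn_meanSum_lift g hX₀ hb hf hX J Δ t).sub
      (continuousOn_meanSum_lift g hX₀ hb hf hX J (-Δ) t), ?_⟩
  · intro r hr ξ hξ
    rw [meanSum_scale g hX₀ hf hJ Δ hr hξ, meanSum_scale g hX₀ hf hJ (-Δ) hr hξ]
    ring
  intro X hX hXη
  refine ⟨fun ξ => meanRate X X₀ b J Δ ξ - meanRate X X₀ b J (-Δ) ξ, meanRate X X₀ b J₂ Δ₂,
    meanRate X X₀ b J₂ (-Δ₂), fun ξ hξ => ⟨?_, hasDerivAt_meanSum g hX₀ hb hf hX J₂ Δ₂ hξ,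
      hasDerivAt_meanSum g hX₀ hb hf hX J₂ (-Δ₂) hξ, ?_⟩⟩
  · exact (hasDerivAt_meanSum g hX₀ hb hf hX J Δ hξ).sub
      (hasDerivAt_meanSum g hX₀ hb hf hX J (-Δ) hξ)
  obtain ⟨hT, hgrow⟩ := htri ξ hξ
  obtain ⟨hlip, hslope⟩ := hB ξ hξ
  have hodd : meanSum X₀ b J Δ ξ - meanSum X₀ b J (-Δ) ξ =
      oddMean (fun t => logSum b (lift X₀ t ξ)) J Δ := (oddMean_eq _ J Δ).symm
  have p₁ := abs_le.1 (h₁ X η hX hXη ξ hξ)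
  have p₂ := abs_le.1 (h₂ X η hX hXη ξ hξ)
  have p₃ := abs_le.1 (h₃ X η hX hXη ξ hξ)
  have p₄ := abs_le.1 (h₄ X η hX hXη ξ hξ)
  have q₁ := abs_le.1 (hslope J Δ hJ hΔ.ne')
  have q₂ := abs_le.1 (hslope J (-Δ) hJ (neg_ne_zero.2 hΔ.ne'))
  have q₃ := abs_le.1 (hslope J₂ Δ₂ hJ₂ hΔ₂.ne')
  have q₄ := abs_le.1 (hslope J₂ (-Δ₂) hJ₂ (neg_ne_zero.2 hΔ₂.ne'))
  rw [mul_neg, abs_neg] at q₂ q₄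
  rw [abs_of_pos hΔ, hJS] at q₁ q₂
  rw [abs_of_pos hΔ₂, hJS₂] at q₃ q₄
  rw [div_neg] at q₂ q₄
  have hL0 : logSum b (lift X₀ 0 ξ) = logSum b ξ := by rw [lift_zero hX₁]
  have hconv : 1 ≤ logSum b (lift X₀ S ξ) - 2 * logSum b ξ + logSum b (lift X₀ (-S) ξ) →
      1 / (4 * S) ≤ meanRate X X₀ b J Δ ξ - meanRate X X₀ b J (-Δ) ξ := by
    intro h
    have h1 : 1 / S ≤ (logSum b (lift X₀ S ξ) - logSum b ξ) / S +
        (logSum b (lift X₀ (-S) ξ) - logSum b ξ) / S := by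
      rw [← add_div]
      gcongr
      linarith
    have h2 : 1 / S = 4 * (1 / (4 * S)) := by field_simp
    linarith
  have hS' : 14 * e + 6 ≤ β * (J * Δ) := by rwa [hJS]
  simp only [hodd]
  rw [add_mul] at e₁ e₂
  refine ⟨fun k1 k2 => hconv ?_, fun k0 k1 => hconv ?_, fun k => ?_, fun k => ?_⟩
  · have := one_le_of_abs_oddMean_mem hβ he hΔ.le hJ hS' hT k1 (by linarith)
    rwa [hJS, hL0] at this
  -- The hypothesis concerns the characteristic set of X, while the trichotomy is that of X₀;
  -- closeness of X to X₀ makes the symbol of X₀ small there.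
  · have hs : |symbol X₀ ξ| < ν * conorm g ξ := by
      have h6 := h₅ _ η hXη ξ
      have h7 : symbol (fun x => X x - X₀ x) ξ = symbol X ξ - symbol X₀ ξ := symbol_sub _ _ _
      rw [h7, k0, zero_sub, abs_neg] at h6
      exact h6.trans_lt (mul_lt_mul_of_pos_right e₃ (conorm_pos g hξ))
    have := one_le_of_growsFrom_zero_or hβ he hΔ.le hJ hS' hT (hgrow hs) (by linarith)
    rwa [hJS, hL0] at this
  · have := mul_le_sub_of_le_oddMean hβ he hΔ.le hJ hT hB0.le hlip (S := S₂) (by rwa [hJS])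
      (by rwa [hJS]) k
    rw [hL0, ← le_div_iff₀ hS₂] at this
    linarith [mul_nonneg hκ₄ hη.le]
  · have := mul_le_sub_of_le_oddMean hβ he hΔ.le hJ hT.neg hB0.le
      (fun s t => (hlip (-s) (-t)).trans_eq (by rw [← abs_neg]; ring_nf)) (S := S₂) (by rwa [hJS])
      (by rwa [hJS])
      (by have := oddMean_neg (fun t => logSum b (lift X₀ t ξ)) J Δ; linarith)
    simp only [neg_zero] at this
    rw [hL0, ← le_div_iff₀ hS₂] at this
    linarith [mul_nonneg hκ₃ hη.le]

end Lyapunov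

/-! ### Transit times and the cutoff. -/

/-- A function which increases at a definite rate as long as its absolute value is at most `k`
goes from `-k` to `k` in a bounded time. -/
theorem lt_of_le_deriv_of_abs_le {f f' : ℝ → ℝ} {k δ t : ℝ} (hf : ∀ t, HasDerivAt f (f' t) t)
    (hk : 0 ≤ k) (hδ : 0 < δ) (h : ∀ t, |f t| ≤ k → δ ≤ f' t) (h0 : -k ≤ f 0)
    (ht : 2 * k / δ < t) : k < f t := by
  by_contra hcon
  have ht0 : 0 < t := lt_of_le_of_lt (by positivity) ht
  have hlow : ∀ r, 0 ≤ r → -k ≤ f r := by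
    intro r hr
    rcases hr.eq_or_lt with rfl | hr
    · exact h0
    · exact (lt_of_deriv_pos_of_eq hf (fun s hs => hδ.trans_le (h s (by
        rw [hs, abs_neg, abs_of_nonneg hk]))) hr h0).le
  have hup : ∀ r, r ≤ t → f r ≤ k := by
    intro r hr
    by_contra hr2
    rcases hr.eq_or_lt with rfl | hr
    · exact hr2 (not_lt.1 hcon)
    · exact hcon (lt_of_deriv_pos_of_eq hf (fun s hs => hδ.trans_le (h s (by
        rw [hs, abs_of_nonneg hk]))) hr (not_le.1 hr2).le)
  have h1 := le_sub_of_le_deriv hf ht0.le (fun r h0 h1 => h r (abs_le.2 ⟨hlow r h0, hup r h1⟩))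
  rw [div_lt_iff₀ hδ] at ht
  linarith [hup t le_rfl]

/-- A smooth nondecreasing function which is `-1` on `(-∞, -c - 1]`, `0` on `[-c, c]` and `1` on
`[c + 1, ∞)`. -/
def cutoff (c x : ℝ) : ℝ := Real.smoothTransition (x - c) - Real.smoothTransition (-x - c)

theorem contDiff_cutoff (c : ℝ) : ContDiff ℝ ∞ (cutoff c) :=
  (Real.smoothTransition.contDiff.comp (contDiff_id.sub contDiff_const)).sub
    (Real.smoothTransition.contDiff.comp (contDiff_id.neg.sub contDiff_const))

theorem monotone_cutoff (c : ℝ) : Monotone (cutoff c) := fun x y hxy =>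
  sub_le_sub (Real.smoothTransition.monotone (by linarith))
    (Real.smoothTransition.monotone (by linarith))

theorem cutoff_eq_one {c x : ℝ} (hc : 0 < c) (h : c + 1 ≤ x) : cutoff c x = 1 := by
  rw [cutoff, Real.smoothTransition.one_of_one_le (by linarith),
    Real.smoothTransition.zero_of_nonpos (by linarith), sub_zero]

theorem cutoff_eq_neg_one {c x : ℝ} (hc : 0 < c) (h : x ≤ -(c + 1)) : cutoff c x = -1 := by
  rw [cutoff, Real.smoothTransition.one_of_one_le (by linarith : 1 ≤ -x - c),
    Real.smoothTransition.zero_of_nonpos (by linarith), zero_sub]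

theorem cutoff_eq_zero {c x : ℝ} (h : |x| ≤ c) : cutoff c x = 0 := by
  rw [abs_le] at h
  rw [cutoff, Real.smoothTransition.zero_of_nonpos (by linarith),
    Real.smoothTransition.zero_of_nonpos (by linarith), sub_zero]

theorem deriv_cutoff_eq_zero {c x : ℝ} (hc : 0 < c) (h : |x| < c ∨ c + 1 < |x|) :
    deriv (cutoff c) x = 0 := by
  have hconst : ∀ a : ℝ, cutoff c =ᶠ[𝓝 x] (fun _ => a) → deriv (cutoff c) x = 0 := by
    intro a ha
    rw [ha.deriv_eq, deriv_const]
  rcases h with h | h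
  · refine hconst 0 ?_
    filter_upwards [continuous_abs.continuousAt.eventually_lt_const h] with y hy
    exact cutoff_eq_zero hy.le
  · rcases lt_abs.1 h with h | h
    · refine hconst 1 ?_
      filter_upwards [lt_mem_nhds h] with y hy using cutoff_eq_one hc hy.le
    · refine hconst (-1) ?_
      filter_upwards [gt_mem_nhds (lt_neg.1 h)] with y hy using cutoff_eq_neg_one hc hy.le

/-! ### Sinks, sources, monotone weight and bounds on the strength for perturbed fields. -/

section Final

variable {n : ℕ} {M : Type*} [TopologicalSpace M] [ChartedSpace (Model n) M]
  [IsManifold (𝓡 n) ∞ M] (g : Metric n M)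

theorem exists_ne_zero (g : Metric n M) {x : M} {v : TangentSpace (𝓡 n) x} (hv : v ≠ 0) :
    ∃ ξ : Cotangent n M, ξ.2 ≠ 0 := by
  refine ⟨⟨x, g.inner x v⟩, fun h => ?_⟩
  have h1 := vnorm_pos g hv
  have h2 : g.inner x v v = 0 := congrArg (fun φ : Model n →L[ℝ] ℝ => φ v) h
  rw [vnorm, h2, Real.sqrt_zero] at h1
  exact lt_irrefl _ h1

/-- Suprema in `EReal` are infinite for empty or unbounded families; nonemptiness and a uniform
bound bring them back to real numbers. -/
theorem exists_real_iSup {ι : Type*} [Nonempty ι] {f : ι → ℝ} {a : ℝ} (h : ∀ i, |f i| ≤ a) :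
    ∃ r : ℝ, (⨆ i, (f i : EReal)) = r ∧ |r| ≤ a := by
  obtain ⟨i₀⟩ := (inferInstance : Nonempty ι)
  have h1 : (⨆ i, (f i : EReal)) ≤ (a : ℝ) :=
    iSup_le fun i => EReal.coe_le_coe_iff.2 (abs_le.1 (h i)).2
  have h2 : ((-a : ℝ) : EReal) ≤ ⨆ i, (f i : EReal) :=
    (EReal.coe_le_coe_iff.2 (abs_le.1 (h i₀)).1).trans (le_iSup (fun i => (f i : EReal)) i₀)
  have h3 : (⨆ i, (f i : EReal)) ≠ ⊤ := (h1.trans_lt (EReal.coe_lt_top a)).ne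
  have h4 : (⨆ i, (f i : EReal)) ≠ ⊥ := ((EReal.bot_lt_coe _).trans_le h2).ne'
  refine ⟨(⨆ i, (f i : EReal)).toReal, (EReal.coe_toReal h3 h4).symm, abs_le.2 ⟨?_, ?_⟩⟩ <;>
    rw [← EReal.coe_le_coe_iff, EReal.coe_toReal h3 h4]
  exacts [h2, h1]

theorem strength_bounds [Nonempty M] {X : VField n M} {d q F : ℝ} (hd : ∀ x, |divergence g X x| ≤ d)
    (hq : ∀ ξ : Cotangent n M, ξ.2 ≠ 0 → |normRate g X ξ| ≤ q)
    (hne : ∃ ξ : Cotangent n M, ξ.2 ≠ 0) {Λ κ β' : ℝ} (h0 : 0 ≤ Λ⁻¹ * (2 / κ) ^ (Λ / β'))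
    (hF : Λ⁻¹ * (2 / κ) ^ (Λ / β') ≤ F) (s : ℂ) :
    ((-(F * (2 * d + 4 * |s.re| + q)) : ℝ) : EReal) ≤ strength g X Λ κ β' s ∧
      strength g X Λ κ β' s ≤ ((F * (2 * d + 4 * |s.re| + q) : ℝ) : EReal) := by
  obtain ⟨r, hr, hrd⟩ := exists_real_iSup (f := fun x : M => |divergence g X x|)
    (fun x => by rw [abs_abs]; exact hd x)
  obtain ⟨ξ₀, hξ₀⟩ := hne
  have : Nonempty {ξ : Cotangent n M // ξ.2 ≠ 0} := ⟨⟨ξ₀, hξ₀⟩⟩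
  obtain ⟨p, hp, hpq⟩ := exists_real_iSup
    (f := fun ξ : {ξ : Cotangent n M // ξ.2 ≠ 0} => normRate g X ξ.1) (fun ξ => hq ξ.1 ξ.2)
  have e : strength g X Λ κ β' s =
      ((Λ⁻¹ * (2 / κ) ^ (Λ / β') * (2 * r - 4 * s.re + p) : ℝ) : EReal) := by
    rw [strength, supDiv, supNormRate, hr, hp]
    push_cast
    rfl
  have h1 : |2 * r - 4 * s.re + p| ≤ 2 * d + 4 * |s.re| + q := by
    rw [abs_le] at hrd hpq ⊢
    have h2 := neg_abs_le s.re
    have h3 := le_abs_self s.re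
    constructor <;> linarith
  have h2 : |Λ⁻¹ * (2 / κ) ^ (Λ / β') * (2 * r - 4 * s.re + p)| ≤
      F * (2 * d + 4 * |s.re| + q) := by
    rw [abs_mul, abs_of_nonneg h0]
    exact mul_le_mul hF h1 (abs_nonneg _) (h0.trans hF)
  rw [e, EReal.coe_le_coe_iff, EReal.coe_le_coe_iff]
  exact abs_le.1 h2

theorem inv_mul_rpow_le {β' l Λ κ P : ℝ} (hβ : 0 < β') (hl : β' ≤ l) (hlΛ : l ≤ Λ) (hκ : 0 < κ)
    (hP : 1 ≤ P) (hκP : 2 / κ ≤ P) :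
    0 ≤ l⁻¹ * (2 / κ) ^ (l / β') ∧ l⁻¹ * (2 / κ) ^ (l / β') ≤ β'⁻¹ * P ^ (Λ / β') := by
  have hl0 : 0 < l := hβ.trans_le hl
  refine ⟨by positivity, mul_le_mul (inv_anti₀ hβ hl) ?_ (by positivity) (by positivity)⟩
  exact (Real.rpow_le_rpow (by positivity) hκP (by positivity)).trans
    (Real.rpow_le_rpow_of_exponent_le hP (by gcongr))

theorem HasGrowthRate.mono {X : VField n M} {Λ Λ' : ℝ} (h : HasGrowthRate g X Λ) (hΛ : Λ ≤ Λ') :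
    HasGrowthRate g X Λ' := fun t ξ => (h t ξ).trans
  (mul_le_mul_of_nonneg_right (Real.exp_le_exp.2 (by gcongr)) (conorm_nonneg g ξ))

variable [CompactSpace M] [T2Space M] {𝒜 : ChartCover n M} {X₀ X : VField n M}
  {G A A' : Cotangent n M → ℝ} {c δ β η : ℝ}

theorem IsLyapunov.isSmoothWeight (h : IsLyapunov g 𝒜 X₀ G A A' c δ β η) :
    IsSmoothWeight (fun ξ => cutoff c (G ξ)) :=
  ⟨(contDiff_cutoff c).contMDiff.comp_contMDiffOn h.smooth,
    fun ξ hξ r hr => congrArg (cutoff c) (h.scale_eq r hr ξ hξ)⟩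

theorem IsLyapunov.isOpenCone (h : IsLyapunov g 𝒜 X₀ G A A' c δ β η)
    (hn : IsOpen {ξ : Cotangent n M | ξ.2 ≠ 0}) (k : ℝ) :
    IsOpenCone {ξ | ξ.2 ≠ 0 ∧ k < G ξ} ∧ IsOpenCone {ξ | ξ.2 ≠ 0 ∧ k < -G ξ} := by
  refine ⟨⟨h.smooth.continuousOn.isOpen_inter_preimage hn isOpen_Ioi, fun ξ hξ => hξ.1,
    fun r hr ξ hξ => ⟨(scale_ne_zero hr).2 hξ.1, ?_⟩⟩,
    ⟨h.smooth.continuousOn.neg.isOpen_inter_preimage hn isOpen_Ioi, fun ξ hξ => hξ.1,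
    fun r hr ξ hξ => ⟨(scale_ne_zero hr).2 hξ.1, ?_⟩⟩⟩ <;>
  · rw [h.scale_eq r hr ξ hξ.1]
    exact hξ.2

theorem IsLyapunov.hasDerivAt_cutoff (h : IsLyapunov g 𝒜 X₀ G A A' c δ β η) (hX : IsCk 1 X)
    (hη : C1Norm 𝒜 (fun x => X x - X₀ x) < ENNReal.ofReal η) {ξ : Cotangent n M} (hξ : ξ.2 ≠ 0) :
    ∃ d : ℝ, 0 ≤ d ∧ HasDerivAt (fun t => cutoff c (G (lift X t ξ))) d 0 := by
  obtain ⟨dG, _, _, hd⟩ := h.deriv X hX hη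
  obtain ⟨hG, -, -, h1, -⟩ := hd ξ hξ
  refine ⟨_root_.deriv (cutoff c) (G ξ) * dG ξ, ?_, ?_⟩
  -- The cutoff is locally constant where nothing is known on the derivative of G; in the remaining
  -- region G increases.
  · by_cases hr : |G ξ| < c ∨ c + 1 < |G ξ|
    · rw [deriv_cutoff_eq_zero h.c_pos hr, zero_mul]
    · push Not at hr
      exact mul_nonneg (monotone_cutoff c).deriv_nonneg (h.delta_pos.le.trans (h1 hr.1 hr.2))
  · have h2 : HasDerivAt (cutoff c) (_root_.deriv (cutoff c) (G ξ)) (G (lift X 0 ξ)) := by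
      rw [lift_zero hX]
      exact ((contDiff_cutoff c).differentiable (by norm_num)).differentiableAt.hasDerivAt
    exact h2.comp (0 : ℝ) hG

/-- The characteristic set of X is invariant, and on it G increases at rate at least δ as long as
|G| ≤ c + 1, so crossing this interval of length 2 (c + 1) takes at most the stated time. -/
theorem IsLyapunov.transit (h : IsLyapunov g 𝒜 X₀ G A A' c δ β η) (hX : IsCk 1 X)
    (hη : C1Norm 𝒜 (fun x => X x - X₀ x) < ENNReal.ofReal η) {ξ : Cotangent n M} (hξ : ξ.2 ≠ 0)
    (h0 : symbol X ξ = 0) {t : ℝ} (ht : 2 * (c + 1) / δ < t) :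
    (-(c + 1) ≤ G ξ → c + 1 < G (lift X t ξ)) ∧ (G ξ ≤ c + 1 → c + 1 < -G (lift X (-t) ξ)) := by
  obtain ⟨dG, _, _, hd⟩ := h.deriv X hX hη
  have hc := h.c_pos
  have hG : ∀ t, HasDerivAt (fun t => G (lift X t ξ)) (dG (lift X t ξ)) t := fun t =>
    hasDerivAt_comp_lift hX (hd _ (lift_ne_zero hX t hξ)).1
  have hδ : ∀ t, |G (lift X t ξ)| ≤ c + 1 → δ ≤ dG (lift X t ξ) := fun t =>
    (hd _ (lift_ne_zero hX t hξ)).2.2.2.2.1 (by rw [symbol_self_lift hX, h0])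
  refine ⟨fun hle => ?_, fun hle => ?_⟩
  · exact lt_of_le_deriv_of_abs_le hG (by linarith) h.delta_pos hδ (by rwa [lift_zero hX]) ht
  · refine lt_of_le_deriv_of_abs_le (f := fun t => -G (lift X (-t) ξ))
      (f' := fun t => dG (lift X (-t) ξ))
      (fun t => (((hG (-t)).comp t (hasDerivAt_neg t)).neg).congr_deriv (by simp))
      (by linarith) h.delta_pos (fun t ht => hδ _ (by rwa [abs_neg] at ht)) ?_ ht
    rw [neg_zero, lift_zero hX]
    linarith

/-- The source comes from `isSink_trapped` applied to -X with the functions -G and A': reversing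
time changes the sign of both the escape function and the derivatives. -/
theorem IsLyapunov.exists_isSink_isSource (h : IsLyapunov g 𝒜 X₀ G A A' c δ β η) (hβ : 0 < β)
    {a C : ℝ} (ha : ∀ ξ : Cotangent n M, ξ.2 ≠ 0 →
      |A ξ - Real.log (conorm g ξ)| ≤ a ∧ |A' ξ - Real.log (conorm g ξ)| ≤ a)
    (hC : Real.exp (2 * a) ≤ C) (hX : IsCk 1 X)
    (hη : C1Norm 𝒜 (fun x => X x - X₀ x) < ENNReal.ofReal η) :
    ∃ Lu Ls : Set (Cotangent n M),
      IsSink g (lift X) Lu {ξ | ξ.2 ≠ 0 ∧ c + 1 < G ξ} C (3 / 4 * β) ∧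
      IsSource g (lift X) Ls {ξ | ξ.2 ≠ 0 ∧ c + 1 < -G ξ} C (3 / 4 * β) ∧
      (∀ ξ ∈ Lu, symbol X ξ = 0) ∧ ∀ ξ ∈ Ls, symbol X ξ = 0 := by
  obtain ⟨b, K, hb, hK, hf⟩ := exists_isFrame g 𝒜
  have hb0 : ∀ i, IsCk 0 (b i) := fun i => (hb i).of_le (by norm_cast)
  obtain ⟨dG, dA, dA', hd⟩ := h.deriv X hX hη
  have hc := h.c_pos
  have hXn : IsCk 1 (fun x => -X x) := ContMDiff.neg_section hX
  have hl : lift (fun x => -X x) = fun t => lift X (-t) := by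
    funext t ξ
    exact lift_neg_field hX t ξ
  have hneg : ∀ {f : ℝ → ℝ} {d : ℝ}, HasDerivAt f d 0 → HasDerivAt (fun t => f (-t)) (-d) 0 := by
    intro f d hfd
    rw [← neg_zero] at hfd
    exact (hfd.comp (0 : ℝ) (hasDerivAt_neg 0)).congr_deriv (by simp)
  have hu : IsSink g (lift X) (trapped X G (c + 1)) {ξ | ξ.2 ≠ 0 ∧ c + 1 < G ξ} C (3 / 4 * β) :=
    isSink_trapped g 𝒜 hb0 (by linarith) hf hX (h.continuousOn X hX) h.scale_eq
      (fun ξ hξ => (hd ξ hξ).1)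
      (fun ξ hξ hk => h.delta_pos.trans_le ((hd ξ hξ).2.2.2.1
        (by rw [hk, abs_of_nonneg (by linarith)]; linarith)
        (by rw [hk, abs_of_nonneg (by linarith)])))
      (fun ξ hξ => (hd ξ hξ).2.1) (fun ξ hξ hk => (hd ξ hξ).2.2.2.2.2.1 (by linarith))
      (fun ξ hξ => (ha ξ hξ).1) (by positivity) hC
  have hs : IsSink g (lift fun x => -X x) (trapped (fun x => -X x) (fun ξ => -G ξ) (c + 1))
      {ξ | ξ.2 ≠ 0 ∧ c + 1 < -G ξ} C (3 / 4 * β) :=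
    isSink_trapped g 𝒜 hb0 (by linarith) hf hXn
      (fun t => by rw [hl]; exact (h.continuousOn X hX (-t)).neg)
      (fun r hr ξ hξ => by rw [h.scale_eq r hr ξ hξ])
      (G' := dG) (fun ξ hξ => by
        rw [hl]
        exact ((hneg (hd ξ hξ).1).neg).congr_deriv (neg_neg _))
      (fun ξ hξ hk => h.delta_pos.trans_le ((hd ξ hξ).2.2.2.1
        (by rw [← abs_neg, hk, abs_of_nonneg (by linarith)]; linarith)
        (by rw [← abs_neg, hk, abs_of_nonneg (by linarith)])))
      (A' := fun ξ => -dA' ξ) (fun ξ hξ => by rw [hl]; exact hneg (hd ξ hξ).2.2.1)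
      (fun ξ hξ hk => le_neg.1 ((hd ξ hξ).2.2.2.2.2.2 (by linarith)))
      (fun ξ hξ => (ha ξ hξ).2) (by positivity) hC
  refine ⟨_, _, hu, by rw [hl] at hs; exact hs, fun ξ hξ => hu.symbol_eq_zero g 𝒜 hX hξ,
    fun ξ hξ => ?_⟩
  have h1 := hs.symbol_eq_zero g 𝒜 hXn hξ
  have h2 : symbol (fun x => -X x) ξ = -symbol X ξ := map_neg (ξ.2 : Model n →L[ℝ] ℝ) (X ξ.1)
  rw [h2] at h1
  exact neg_eq_zero.1 h1

end Final

end AnosovWeight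

end

/-! ### Assembling the constants. -/

theorem mainTheorem3 {n : ℕ} {M : Type*} [TopologicalSpace M]
    [ChartedSpace (AnosovWeight.Model n) M]
    [IsManifold (𝓡 n) ∞ M] [CompactSpace M] [T2Space M] [Nonempty M]
    (g : AnosovWeight.Metric n M) (𝒜 : AnosovWeight.ChartCover n M)
    (X₀ : AnosovWeight.VField n M) (hX₀ : AnosovWeight.IsCk ∞ X₀)
    (Eu Es : (x : M) → Submodule ℝ (TangentSpace (𝓡 n) x)) (C β : ℝ)
    (hA : AnosovWeight.IsAnosov g X₀ Eu Es C β) :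
    ∃ (Uu Us : Set (AnosovWeight.Cotangent n M)) (m : AnosovWeight.Cotangent n M → ℝ)
      (η T C' β' Λ : ℝ) (R : ℂ → ℝ),
      0 < η ∧ 0 < T ∧ C / 2 < C' ∧ β / 2 < β' ∧ β' ≤ Λ ∧
      AnosovWeight.IsOpenCone Uu ∧ AnosovWeight.IsOpenCone Us ∧
      AnosovWeight.IsSmoothWeight m ∧ (∀ ξ ∈ Uu, m ξ = 1) ∧ (∀ ξ ∈ Us, m ξ = -1) ∧
      ∀ X : AnosovWeight.VField n M, AnosovWeight.IsCk 1 X →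
        AnosovWeight.C1Norm 𝒜 (fun x => X x - X₀ x) < ENNReal.ofReal η →
        -- a sink and a source, inside the characteristic set, with admissible neighbourhoods
        (∃ Lu Ls : Set (AnosovWeight.Cotangent n M),
          AnosovWeight.IsSink g (AnosovWeight.lift X) Lu Uu C' β' ∧
          AnosovWeight.IsSource g (AnosovWeight.lift X) Ls Us C' β' ∧
          (∀ ξ ∈ Lu, AnosovWeight.symbol X ξ = 0) ∧ (∀ ξ ∈ Ls, AnosovWeight.symbol X ξ = 0) ∧
          (∀ ξ ∈ Lu, ξ.2 ≠ 0 → m ξ = 1) ∧ (∀ ξ ∈ Ls, ξ.2 ≠ 0 → m ξ = -1)) ∧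
        -- uniform transit time between the neighbourhoods
        (∀ ξ : AnosovWeight.Cotangent n M, ξ.2 ≠ 0 → AnosovWeight.symbol X ξ = 0 → ∀ t, T < t →
          (ξ ∉ Us → AnosovWeight.lift X t ξ ∈ Uu) ∧
          (ξ ∉ Uu → AnosovWeight.lift X (-t) ξ ∈ Us)) ∧
        -- the weight is nondecreasing along the lifted flow
        (∀ ξ : AnosovWeight.Cotangent n M, ξ.2 ≠ 0 →
          ∃ c : ℝ, 0 ≤ c ∧ HasDerivAt (fun t => m (AnosovWeight.lift X t ξ)) c 0) ∧
        -- uniform bound on the minimal strength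
        AnosovWeight.HasGrowthRate g X Λ ∧
        ∀ l : ℝ, β' ≤ l → l ≤ Λ → AnosovWeight.HasGrowthRate g X l → ∀ s : ℂ,
          ∀ κ ∈ ({1 / C', C'} : Set ℝ),
            ((-R s : ℝ) : EReal) ≤ AnosovWeight.strength g X l κ β' s ∧
            AnosovWeight.strength g X l κ β' s ≤ ((R s : ℝ) : EReal) := by
  classical
  obtain ⟨x₀⟩ := (inferInstance : Nonempty M)
  have hX₁ : AnosovWeight.IsCk 1 X₀ := hX₀.of_le (by norm_cast)
  obtain ⟨Λ₀, hΛ₀, hΛ⟩ := AnosovWeight.exists_metricRate_le g 𝒜 hX₁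
  obtain ⟨G, A, A', c, δ, η, h⟩ := hA.exists_isLyapunov g 𝒜 hX₀ (by linarith)
    (hΛ X₀ hX₁ (by rw [AnosovWeight.C1Norm_sub_self]; simp))
  obtain ⟨a, ha⟩ := h.bound
  have hβ := hA.beta_pos
  have hc := h.c_pos
  have hδ := h.delta_pos
  obtain ⟨b, K, hb, hK, hf⟩ := AnosovWeight.exists_isFrame g 𝒜
  have hcone := h.isOpenCone g (hf.isOpen_ne_zero g fun i => (hb i).of_le (by norm_cast)) (c + 1)
  -- A nonzero covector exists because X₀ has no zero; it keeps the supremum of the norm rate from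
  -- being taken over the empty set.
  have hne := AnosovWeight.exists_ne_zero g (hA.ne_zero x₀)
  set C' : ℝ := max (C / 2 + 1) (Real.exp (2 * a)) with hC'
  have hCC : C / 2 < C' := (lt_add_one _).trans_le (le_max_left _ _)
  have hC0 : 0 < C' := (Real.exp_pos _).trans_le (le_max_right _ _)
  set Λ : ℝ := max Λ₀ (3 / 4 * β) with hΛ'
  -- P is at least 1 and dominates 2 / κ for both values of κ, so powers of it with exponent Λ / β'
  -- bound every factor of the strength.
  set P : ℝ := 1 + 2 * C' + 2 / C' with hP
  -- The radius is cut to 1, the range of validity of the uniform metric rate Λ₀. In the last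
  -- function, n Λ₀ bounds the divergence and 2 Λ₀ the norm rate.
  refine ⟨{ξ | ξ.2 ≠ 0 ∧ c + 1 < G ξ}, {ξ | ξ.2 ≠ 0 ∧ c + 1 < -G ξ},
    fun ξ => AnosovWeight.cutoff c (G ξ), min η 1, 2 * (c + 1) / δ, C', 3 / 4 * β, Λ,
    fun s => (3 / 4 * β)⁻¹ * P ^ (Λ / (3 / 4 * β)) *
      (2 * (n * Λ₀) + 4 * |s.re| + 2 * Λ₀),
    lt_min h.eta_pos one_pos, by positivity, hCC, by linarith, le_max_right _ _,
    hcone.1, hcone.2, h.isSmoothWeight g,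
    fun ξ hξ => AnosovWeight.cutoff_eq_one hc hξ.2.le,
    fun ξ hξ => AnosovWeight.cutoff_eq_neg_one hc (le_neg.1 hξ.2.le), fun X hX hXη => ?_⟩
  have hη : AnosovWeight.C1Norm 𝒜 (fun x => X x - X₀ x) < ENNReal.ofReal η :=
    hXη.trans_le (ENNReal.ofReal_le_ofReal (min_le_left _ _))
  have hrate : AnosovWeight.HasMetricRate g X Λ₀ :=
    hΛ X hX (hXη.trans_le (ENNReal.ofReal_le_ofReal (min_le_right _ _)))
  have hgrowth := hrate.hasGrowthRate g hX
  refine ⟨?_, fun ξ hξ h0 t ht => ?_, fun ξ hξ => h.hasDerivAt_cutoff g hX hη hξ,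
    hgrowth.mono g (le_max_left _ _), fun l hl hlΛ _ s κ hκ => ?_⟩
  · obtain ⟨Lu, Ls, hu, hs, hu0, hs0⟩ :=
      h.exists_isSink_isSource g hβ ha (le_max_right _ _) hX hη
    exact ⟨Lu, Ls, hu, hs, hu0, hs0,
      fun ξ hξ h0 => AnosovWeight.cutoff_eq_one hc (hu.nhd.2 ξ hξ h0).2.le,
      fun ξ hξ h0 => AnosovWeight.cutoff_eq_neg_one hc (le_neg.1 (hs.nhd.2 ξ hξ h0).2.le)⟩
  · obtain ⟨h1, h2⟩ := h.transit g hX hη hξ h0 ht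
    refine ⟨fun hξs => ⟨AnosovWeight.lift_ne_zero hX t hξ, h1 ?_⟩,
      fun hξu => ⟨AnosovWeight.lift_ne_zero hX (-t) hξ, h2 ?_⟩⟩
    · by_contra hcon
      exact hξs ⟨hξ, by linarith⟩
    · by_contra hcon
      exact hξu ⟨hξ, not_le.1 hcon⟩
  · have hκ' : 0 < κ ∧ 2 / κ ≤ P := by
      have h2 : 0 < 2 / C' := by positivity
      rcases hκ with rfl | rfl
      · refine ⟨by positivity, ?_⟩
        rw [one_div, div_inv_eq_mul]
        linarith
      · exact ⟨hC0, by linarith⟩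
    obtain ⟨h1, h2⟩ := AnosovWeight.inv_mul_rpow_le (by positivity) hl hlΛ hκ'.1
      (by have : 0 < 2 / C' := by positivity
          linarith) hκ'.2
    exact AnosovWeight.strength_bounds g (AnosovWeight.abs_divergence_le g hX hrate)
      (fun ξ hξ => AnosovWeight.abs_normRate_le g hX (by linarith) hgrowth hξ) hne h1 h2 s
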